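/- **Notation.** Let $\mathbb R_5$ be the real Clifford algebra generated by $e_1,\dots,e_5$ with $e_i^2=-1$, $e_ie_j=-e_je_i$ ($i\ne j$). A point $x=(x_0,\dots,x_5)\in\mathbb R^6$ is identified with the paravector $x=x_0+\sum_{i=1}^5x_ie_i$; put $\bar x=x_0-\sum_{i=1}^5x_ie_i$, $|x|^2=\sum_{i=0}^5x_i^2$. Let $\mathbb S=\{J=\sum_{i=1}^5 J_ie_i:\ \sum J_i^2=1\}$, $\mathbb C_J=\{u+Jv:u,v\in\mathbb R\}$ for $J\in\mathbb S$, and $[s]=\{s_0+J|s-s_0|:J\in\mathbb S\}$. A set $U\subset\mathbb R^6$ is axially symmetric if $u+Iv\in U$ for one $I\in\mathbb S$ implies $u+Jv\in U$ for all $J\in\mathbb S$. A slice Cauchy domain is an axially symmetric open set $U$ such that for every $J\in\mathbb S$ the boundary of $U\cap\mathbb C_J$ in $\mathbb C_J$ is a finite union of nonintersecting piecewise $C^1$ Jordan curves; $\partial(U\cap\mathbb C_J)$ is positively oriented, i.e. it has winding number $1$ around the points of $U\cap\mathbb C_J$ and $0$ around the points of $\mathbb C_J$ outside the closure of $U\cap\mathbb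 C_J$. For $W\subset\mathbb R^6$ open and axially symmetric, $f:W\to\mathbb R_5$ is left slice hyperholomorphic, $f\in SH_L(W)$, if $f(u+Jv)=\alpha(u,v)+J\beta(u,v)$ for all $u+Jv\in W$, $J\in\mathbb S$, where $\alpha,\beta$ are $\mathbb R_5$-valued and differentiable, $\alpha$ is even and $\beta$ is odd in $v$, and $\partial_u\alpha=\partial_v\beta$, $\partial_v\alpha=-\partial_u\beta$. It is right slice hyperholomorphic, $f\in SH_R(W)$, if the same holds with $f(u+Jv)=\alpha(u,v)+\beta(u,v)J$. Let $\mathcal D f=\partial_{x_0}f+\sum_{i=1}^5e_i\partial_{x_i}f$, $\overline{\mathcal D}f=\partial_{x_0}f-\sum_{i=1}^5e_i\partial_{x_i}f$, $f\mathcal D=\partial_{x_0}f+\sum_{i=1}^5(\partial_{x_i}f)e_i$, $f\overline{\mathcal D}=\partial_{x_0}f-\sum_{i=1}^5(\partial_{x_i}f)e_i$, and $\Delta=\sum_{i=0}^5\partial_{x_i}^2$. A sufficiently often continuously differentiable function $g$ on $W$ is called $k$-harmonic if $\Delta^kg=0$; left holomorphic Cliffordian of order $1$ if $\Delta\mathcal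 Dg=0$; left anti-holomorphic Cliffordian of order $1$ if $\Delta\overline{\mathcal D}g=0$; left polyanalytic of order $m$ if $\mathcal D^mg=0$; left polyanalytic Cliffordian of order $(1,2)$ if $\Delta\mathcal D^2g=0$; the right classes are defined with the operators acting from the right. For $x\notin[s]$ put $\mathcal Q=\mathcal Q_{c,s}(x)=s^2-2x_0s+|x|^2$, $S_L^{-1}(s,x)=(s-\bar x)\mathcal Q^{-1}$, $S_R^{-1}(s,x)=\mathcal Q^{-1}(s-\bar x)$, and for each of the operators $T$ below let $S^{-1}_{T,L}(s,x)=T S_L^{-1}(s,x)$ and $S^{-1}_{T,R}(s,x)=S_R^{-1}(s,x)T$, where $T$ acts in $x$. **Theorem.** (a) For $x\notin[s]$ the kernels are $$S^{-1}_{\mathcal D,L}=S^{-1}_{\mathcal D,R}=-4\mathcal Q^{-1},\qquad S^{-1}_{\Delta\mathcal D,L}=S^{-1}_{\Delta\mathcal D,R}=16\mathcal Q^{-2},$$ $$S^{-1}_{\Delta,L}=-8S_L^{-1}(s,x)\mathcal Q^{-1},\qquad S^{-1}_{\Delta,R}=-8\mathcal Q^{-1}S_R^{-1}(s,x),$$ $$S^{-1}_{\overline{\mathcal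 D},L}=4(s-\bar x)\mathcal Q^{-2}(s-x_0)+2\mathcal Q^{-1},\qquad S^{-1}_{\overline{\mathcal D},R}=4(s-x_0)\mathcal Q^{-2}(s-\bar x)+2\mathcal Q^{-1},$$ $$S^{-1}_{\overline{\mathcal D}^2,L}=32(s-\bar x)\mathcal Q^{-3}(s-x_0)^2,\qquad S^{-1}_{\overline{\mathcal D}^2,R}=32(s-x_0)^2\mathcal Q^{-3}(s-\bar x),$$ $$S^{-1}_{\Delta\overline{\mathcal D},L}=-64(s-\bar x)\mathcal Q^{-3}(s-x_0),\qquad S^{-1}_{\Delta\overline{\mathcal D},R}=-64(s-x_0)\mathcal Q^{-3}(s-\bar x),$$ $$S^{-1}_{\mathcal D^2,L}=-8S_L^{-1}(s,\bar x)\mathcal Q^{-1},\qquad S^{-1}_{\mathcal D^2,R}=-8\mathcal Q^{-1}S_R^{-1}(s,\bar x).$$ (b) Let $W\subset\mathbb R^6$ be open and axially symmetric and let $f\in SH_L(W)$. Then, on $W$: $\Delta^{1-\ell}\mathcal Df$ is $(\ell+1)$-harmonic for $\ell=0,1$; $\Delta f$ is left holomorphic Cliffordian of order $1$; $\overline{\mathcal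 D}f$ is left polyanalytic Cliffordian of order $(1,2)$; $\Delta^\ell\overline{\mathcal D}^{2-\ell}f$ is left polyanalytic of order $3-\ell$ for $\ell=0,1$; $\mathcal D^2f$ is left anti-holomorphic Cliffordian of order $1$. Moreover, for each of the operators $T\in\{\Delta\mathcal D,\mathcal D,\Delta,\overline{\mathcal D},\overline{\mathcal D}^2,\Delta\overline{\mathcal D},\mathcal D^2\}$, every bounded slice Cauchy domain $U$ with $\overline U\subset W$, every $J\in\mathbb S$ and every $x\in U$, with $ds_J=ds(-J)$, $$Tf(x)=\frac1{2\pi}\int_{\partial(U\cap\mathbb C_J)}S^{-1}_{T,L}(s,x)\,ds_J\,f(s).$$ (c) If $f\in SH_R(W)$, the same holds with the operators acting from the right, the right classes, and $$(fT)(x)=\frac1{2\pi}\int_{\partial(U\cap\mathbb C_J)}f(s)\,ds_J\,S^{-1}_{T,R}(s,x).$$ (d) For given $x$, the integrals in (b) and (c) depend neither on $U\ni x$ nor on $J\in\mathbb S$. -/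

import Mathlib

noncomputable section

namespace FineStructure

/-! ### The Clifford algebra with five imaginary units -/

/-- The negative definite form `v ↦ -(v₁² + ⋯ + v₅²)` on `ℝ⁵`. -/
def negForm : QuadraticForm ℝ (Fin 5 → ℝ) :=
  QuadraticMap.weightedSumSquares ℝ (fun _ : Fin 5 => (-1 : ℝ))

/-- The real Clifford algebra `ℝ₅`: generators `e₁, …, e₅` with `eᵢ² = -1`, `eᵢ eⱼ = -eⱼ eᵢ`. -/
abbrev Cl5 : Type := CliffordAlgebra negForm

/-- A linear basis of `ℝ₅`, indexed by the subsets of the set of generators. -/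
def cl5Basis : Module.Basis (Finset (Fin 5)) ℝ Cl5 :=
  (Pi.basisFun ℝ (Fin 5)).ExteriorAlgebra.map (CliffordAlgebra.equivExterior negForm).symm

instance instFiniteDimensionalCl5 : FiniteDimensional ℝ Cl5 :=
  Module.Finite.of_basis cl5Basis

/-- A submultiplicative norm on the finite dimensional algebra `ℝ₅` (the matrix norm of left
multiplication). Only the topology it induces, which is the canonical one, is ever used: it gives
meaning to derivatives and integrals of `ℝ₅`-valued functions. -/
instance instNormedRingCl5 : NormedRing Cl5 :=
  letI := Matrix.linftyOpNormedRing (n := Finset (Fin 5)) (α := ℝ)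
  NormedRing.induced Cl5 (Matrix (Finset (Fin 5)) (Finset (Fin 5)) ℝ)
    (Algebra.leftMulMatrix cl5Basis) (Algebra.leftMulMatrix_injective cl5Basis)

instance instNormedAlgebraCl5 : NormedAlgebra ℝ Cl5 :=
  letI := Matrix.linftyOpNormedRing (n := Finset (Fin 5)) (α := ℝ)
  letI := Matrix.linftyOpNormedAlgebra (R := ℝ) (n := Finset (Fin 5)) (α := ℝ)
  NormedAlgebra.induced ℝ Cl5 (Matrix (Finset (Fin 5)) (Finset (Fin 5)) ℝ)
    (Algebra.leftMulMatrix cl5Basis)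

instance instCompleteSpaceCl5 : CompleteSpace Cl5 := FiniteDimensional.complete ℝ Cl5

/-! ### Paravectors -/

/-- The space `ℝ⁶` of points `x = (x₀, x₁, …, x₅)`. -/
abbrev R6 : Type := EuclideanSpace ℝ (Fin 6)

/-- The units `e₀ = 1, e₁, …, e₅`. -/
def gen : Fin 6 → Cl5 :=
  Fin.cons 1 (fun i => CliffordAlgebra.ι negForm (Pi.single i 1))

/-- The conjugate units `1, -e₁, …, -e₅`. -/
def genBar : Fin 6 → Cl5 :=
  Fin.cons 1 (fun i => -CliffordAlgebra.ι negForm (Pi.single i 1))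

/-- The identification of the point `x` with the paravector `x₀ + x₁ e₁ + ⋯ + x₅ e₅`. -/
def para (x : R6) : Cl5 := ∑ i, x i • gen i

/-- The conjugate paravector `x₀ - x₁ e₁ - ⋯ - x₅ e₅`, as a point. -/
def pconj (x : R6) : R6 := WithLp.toLp 2 (fun i => if i = 0 then x 0 else -x i)

/-- The sphere `𝕊` of imaginary units. -/
def imagSphere : Set R6 := {J | J 0 = 0 ∧ ‖J‖ = 1}

/-- The point `u + J v`. -/
def slicePt (J : R6) (u v : ℝ) : R6 := u • EuclideanSpace.single 0 1 + v • J

/-- The identification of `ℂ` with the plane `ℂ_J`. -/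
def toSlice (J : R6) (z : ℂ) : R6 := slicePt J z.re z.im

/-- The set `U ∩ ℂ_J`, seen in `ℂ`. -/
def sliceOf (U : Set R6) (J : R6) : Set ℂ := {z | toSlice J z ∈ U}

/-- The sphere `[s] = {Re s + J |Im s| : J ∈ 𝕊}`. -/
def sphereOf (s : R6) : Set R6 :=
  {x | ∃ J ∈ imagSphere, x = slicePt J (s 0) ‖s - s 0 • EuclideanSpace.single 0 1‖}

/-- Axially symmetric sets. -/
def AxiallySymmetric (U : Set R6) : Prop :=
  ∀ u v : ℝ, ∀ I ∈ imagSphere, slicePt I u v ∈ U → ∀ J ∈ imagSphere, slicePt J u v ∈ U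

/-! ### Slice hyperholomorphic functions -/

/-- The set of the `(u, v)` with `u + J v ∈ W` for all imaginary units `J`. -/
def sliceRegion (W : Set R6) : Set (ℝ × ℝ) := {p | ∀ J ∈ imagSphere, slicePt J p.1 p.2 ∈ W}

/-- Differentiable pairs `(α, β)` on the region of `W` that satisfy the even-odd conditions and
the Cauchy-Riemann system. -/
structure IsStem (W : Set R6) (α β : ℝ × ℝ → Cl5) : Prop where
  diff_left : ∀ p ∈ sliceRegion W, DifferentiableAt ℝ α p
  diff_right : ∀ p ∈ sliceRegion W, DifferentiableAt ℝ β p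
  even : ∀ p ∈ sliceRegion W, α p = α (p.1, -p.2)
  odd : ∀ p ∈ sliceRegion W, β p = -β (p.1, -p.2)
  cr_one : ∀ p ∈ sliceRegion W, fderiv ℝ α p (1, 0) - fderiv ℝ β p (0, 1) = 0
  cr_two : ∀ p ∈ sliceRegion W, fderiv ℝ α p (0, 1) + fderiv ℝ β p (1, 0) = 0

/-- `f ∈ SH_L(W)`. -/
def SliceHypL (W : Set R6) (f : R6 → Cl5) : Prop :=
  ∃ α β : ℝ × ℝ → Cl5, IsStem W α β ∧
    ∀ p ∈ sliceRegion W, ∀ J ∈ imagSphere, f (slicePt J p.1 p.2) = α p + para J * β p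

/-- `f ∈ SH_R(W)`. -/
def SliceHypR (W : Set R6) (f : R6 → Cl5) : Prop :=
  ∃ α β : ℝ × ℝ → Cl5, IsStem W α β ∧
    ∀ p ∈ sliceRegion W, ∀ J ∈ imagSphere, f (slicePt J p.1 p.2) = α p + β p * para J

/-! ### Differential operators and the function classes -/

/-- The partial derivative with respect to `xᵢ`. -/
def pd (i : Fin 6) (g : R6 → Cl5) (x : R6) : Cl5 := fderiv ℝ g x (EuclideanSpace.single i 1)

/-- `𝒟 g = ∂₀ g + ∑ eᵢ ∂ᵢ g`. -/
def diracL (g : R6 → Cl5) (x : R6) : Cl5 := ∑ i, gen i * pd i g x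

/-- `g 𝒟 = ∂₀ g + ∑ (∂ᵢ g) eᵢ`. -/
def diracR (g : R6 → Cl5) (x : R6) : Cl5 := ∑ i, pd i g x * gen i

/-- `𝒟̄ g = ∂₀ g - ∑ eᵢ ∂ᵢ g`. -/
def diracBarL (g : R6 → Cl5) (x : R6) : Cl5 := ∑ i, genBar i * pd i g x

/-- `g 𝒟̄ = ∂₀ g - ∑ (∂ᵢ g) eᵢ`. -/
def diracBarR (g : R6 → Cl5) (x : R6) : Cl5 := ∑ i, pd i g x * genBar i

/-- The Laplace operator of `ℝ⁶`. -/
def lap (g : R6 → Cl5) : R6 → Cl5 := Laplacian.laplacian g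

/-- Polyharmonic functions of degree `k`. -/
def IsPolyharmonic (k : ℕ) (W : Set R6) (g : R6 → Cl5) : Prop :=
  ContDiffOn ℝ (2 * k : ℕ) g W ∧ ∀ x ∈ W, lap^[k] g x = 0

/-- Left holomorphic Cliffordian functions of order `k`. -/
def IsHolCliffordL (k : ℕ) (W : Set R6) (g : R6 → Cl5) : Prop :=
  ContDiffOn ℝ (2 * k + 1 : ℕ) g W ∧ ∀ x ∈ W, lap^[k] (diracL g) x = 0

/-- Right holomorphic Cliffordian functions of order `k`. -/
def IsHolCliffordR (k : ℕ) (W : Set R6) (g : R6 → Cl5) : Prop :=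
  ContDiffOn ℝ (2 * k + 1 : ℕ) g W ∧ ∀ x ∈ W, lap^[k] (diracR g) x = 0

/-- Left anti-holomorphic Cliffordian functions of order `k`. -/
def IsAntiHolCliffordL (k : ℕ) (W : Set R6) (g : R6 → Cl5) : Prop :=
  ContDiffOn ℝ (2 * k + 1 : ℕ) g W ∧ ∀ x ∈ W, lap^[k] (diracBarL g) x = 0

/-- Right anti-holomorphic Cliffordian functions of order `k`. -/
def IsAntiHolCliffordR (k : ℕ) (W : Set R6) (g : R6 → Cl5) : Prop :=
  ContDiffOn ℝ (2 * k + 1 : ℕ) g W ∧ ∀ x ∈ W, lap^[k] (diracBarR g) x = 0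

/-- Left polyanalytic functions of order `m`. -/
def IsPolyanalyticL (m : ℕ) (W : Set R6) (g : R6 → Cl5) : Prop :=
  ContDiffOn ℝ (m : ℕ) g W ∧ ∀ x ∈ W, diracL^[m] g x = 0

/-- Right polyanalytic functions of order `m`. -/
def IsPolyanalyticR (m : ℕ) (W : Set R6) (g : R6 → Cl5) : Prop :=
  ContDiffOn ℝ (m : ℕ) g W ∧ ∀ x ∈ W, diracR^[m] g x = 0

/-- Left polyanalytic Cliffordian functions of order `(k, m)`. -/
def IsPolyCliffordL (k m : ℕ) (W : Set R6) (g : R6 → Cl5) : Prop :=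
  ContDiffOn ℝ (2 * k + m : ℕ) g W ∧ ∀ x ∈ W, lap^[k] (diracL^[m] g) x = 0

/-- Right polyanalytic Cliffordian functions of order `(k, m)`. -/
def IsPolyCliffordR (k m : ℕ) (W : Set R6) (g : R6 → Cl5) : Prop :=
  ContDiffOn ℝ (2 * k + m : ℕ) g W ∧ ∀ x ∈ W, lap^[k] (diracR^[m] g) x = 0

/-! ### Kernels -/

/-- `𝒬_{c,s}(x)⁻¹ = (s² - 2 x₀ s + |x|²)⁻¹`; the inverse is a true one for `x ∉ [s]`. -/
def Qinv (s x : R6) : Cl5 :=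
  Ring.inverse (para s ^ 2 - (2 * x 0) • para s + algebraMap ℝ Cl5 (‖x‖ ^ 2))

/-- The left slice hyperholomorphic Cauchy kernel `S_L⁻¹(s, x) = (s - x̄) 𝒬_{c,s}(x)⁻¹`. -/
def cauchyL (s x : R6) : Cl5 := (para s - para (pconj x)) * Qinv s x

/-- The right slice hyperholomorphic Cauchy kernel `S_R⁻¹(s, x) = 𝒬_{c,s}(x)⁻¹ (s - x̄)`. -/
def cauchyR (s x : R6) : Cl5 := Qinv s x * (para s - para (pconj x))

/-- The left slice `T`-kernel: the operator `T` applied to `S_L⁻¹(s, ·)`. -/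
def kernelL (T : (R6 → Cl5) → (R6 → Cl5)) (s x : R6) : Cl5 := T (cauchyL s) x

/-- The right slice `T`-kernel: the operator `T` applied to `S_R⁻¹(s, ·)`. -/
def kernelR (T : (R6 → Cl5) → (R6 → Cl5)) (s x : R6) : Cl5 := T (cauchyR s) x

/-! ### Slice Cauchy domains and their oriented boundaries -/

/-- Piecewise continuously differentiable Jordan curves, parametrized by `[0, 1]`. -/
structure IsPiecewiseC1Jordan (c : ℝ → ℂ) : Prop where
  closed : c 0 = c 1
  simple : Set.InjOn c (Set.Ico 0 1)
  piecewise : ∃ (n : ℕ) (p : ℕ → ℝ), p 0 = 0 ∧ p n = 1 ∧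
    ∀ i < n, p i < p (i + 1) ∧ ContDiffOn ℝ 1 c (Set.Icc (p i) (p (i + 1)))

/-- The boundary of `Ω` is the union of the finitely many nonintersecting piecewise `C¹` Jordan
curves `γ k`. -/
structure IsBoundarySystem (Ω : Set ℂ) {m : ℕ} (γ : Fin m → ℝ → ℂ) : Prop where
  jordan : ∀ k, IsPiecewiseC1Jordan (γ k)
  disjoint : ∀ k l, k ≠ l → Disjoint (γ k '' Set.Icc 0 1) (γ l '' Set.Icc 0 1)
  frontier_eq : frontier Ω = ⋃ k, γ k '' Set.Icc 0 1

/-- The winding number of the cycle `∑ γ k` around `z`. -/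
def index {m : ℕ} (γ : Fin m → ℝ → ℂ) (z : ℂ) : ℂ :=
  ∑ k, (2 * Real.pi * Complex.I)⁻¹ * ∫ t in (0 : ℝ)..1, deriv (γ k) t / (γ k t - z)

/-- The boundary cycle is positively oriented: it winds once around the points of `Ω` and does
not wind around the exterior points. -/
def PositivelyOriented (Ω : Set ℂ) {m : ℕ} (γ : Fin m → ℝ → ℂ) : Prop :=
  (∀ z ∈ Ω, index γ z = 1) ∧ ∀ z, z ∉ closure Ω → index γ z = 0

/-- Slice Cauchy domains. -/
def IsSliceCauchyDomain (U : Set R6) : Prop :=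
  IsOpen U ∧ AxiallySymmetric U ∧
    ∀ J ∈ imagSphere, ∃ (m : ℕ) (γ : Fin m → ℝ → ℂ), IsBoundarySystem (sliceOf U J) γ

/-- `U` is a bounded slice Cauchy domain with closure in `W`, `J` is an imaginary unit, and `γ`
is a positively oriented parametrization of `∂(U ∩ ℂ_J)`. -/
structure IsContour (W U : Set R6) (J : R6) {m : ℕ} (γ : Fin m → ℝ → ℂ) : Prop where
  cauchy : IsSliceCauchyDomain U
  bounded : Bornology.IsBounded U
  closure_subset : closure U ⊆ W
  unit : J ∈ imagSphere
  boundary : IsBoundarySystem (sliceOf U J) γ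
  oriented : PositivelyOriented (sliceOf U J) γ

/-! ### Integrals over the boundary -/

/-- The density of `ds_J = ds (-J)` along the curve `c` in `ℂ_J`. -/
def dsJ (J : R6) (c : ℝ → ℂ) (t : ℝ) : Cl5 := para (toSlice J (deriv c t)) * (-para J)

/-- The integrand of `∫ K(s, x) ds_J f(s)` along the curve `c` in `ℂ_J`. -/
def integrandL (K : R6 → R6 → Cl5) (J : R6) (c : ℝ → ℂ) (f : R6 → Cl5) (x : R6) (t : ℝ) : Cl5 :=
  K (toSlice J (c t)) x * dsJ J c t * f (toSlice J (c t))

/-- The integrand of `∫ f(s) ds_J K(s, x)` along the curve `c` in `ℂ_J`. -/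
def integrandR (K : R6 → R6 → Cl5) (J : R6) (c : ℝ → ℂ) (f : R6 → Cl5) (x : R6) (t : ℝ) : Cl5 :=
  f (toSlice J (c t)) * dsJ J c t * K (toSlice J (c t)) x

/-- `∫_{∂(U ∩ ℂ_J)} K(s, x) ds_J f(s)`. -/
def integralL (K : R6 → R6 → Cl5) (J : R6) {m : ℕ} (γ : Fin m → ℝ → ℂ) (f : R6 → Cl5)
    (x : R6) : Cl5 :=
  ∑ k, ∫ t in (0 : ℝ)..1, integrandL K J (γ k) f x t

/-- `∫_{∂(U ∩ ℂ_J)} f(s) ds_J K(s, x)`. -/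
def integralR (K : R6 → R6 → Cl5) (J : R6) {m : ℕ} (γ : Fin m → ℝ → ℂ) (f : R6 → Cl5)
    (x : R6) : Cl5 :=
  ∑ k, ∫ t in (0 : ℝ)..1, integrandR K J (γ k) f x t

/-- `T f(x) = (1 / 2π) ∫_{∂(U ∩ ℂ_J)} K_T(s, x) ds_J f(s)` for `x ∈ U`, where `K_T` is the left
slice `T`-kernel, with an absolutely convergent integral. -/
def HasIntegralRepL (W : Set R6) (f : R6 → Cl5) (T : (R6 → Cl5) → (R6 → Cl5)) : Prop :=
  ∀ (U : Set R6) (J : R6) (m : ℕ) (γ : Fin m → ℝ → ℂ), IsContour W U J γ → ∀ x ∈ U,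
    (∀ k, IntervalIntegrable (integrandL (kernelL T) J (γ k) f x) MeasureTheory.volume 0 1) ∧
    T f x = (2 * Real.pi)⁻¹ • integralL (kernelL T) J γ f x

/-- `f(x) T = (1 / 2π) ∫_{∂(U ∩ ℂ_J)} f(s) ds_J K_T(s, x)` for `x ∈ U`, where `K_T` is the right
slice `T`-kernel, with an absolutely convergent integral. -/
def HasIntegralRepR (W : Set R6) (f : R6 → Cl5) (T : (R6 → Cl5) → (R6 → Cl5)) : Prop :=
  ∀ (U : Set R6) (J : R6) (m : ℕ) (γ : Fin m → ℝ → ℂ), IsContour W U J γ → ∀ x ∈ U,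
    (∀ k, IntervalIntegrable (integrandR (kernelR T) J (γ k) f x) MeasureTheory.volume 0 1) ∧
    T f x = (2 * Real.pi)⁻¹ • integralR (kernelR T) J γ f x

/-- The integrals `∫_{∂(U ∩ ℂ_J)} K_T(s, x) ds_J f(s)` depend neither on `U` nor on `J`. -/
def IntegralIndepL (W : Set R6) (f : R6 → Cl5) (T : (R6 → Cl5) → (R6 → Cl5)) : Prop :=
  ∀ (U : Set R6) (J : R6) (m : ℕ) (γ : Fin m → ℝ → ℂ)
    (U' : Set R6) (J' : R6) (m' : ℕ) (γ' : Fin m' → ℝ → ℂ),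
    IsContour W U J γ → IsContour W U' J' γ' → ∀ x ∈ U ∩ U',
      integralL (kernelL T) J γ f x = integralL (kernelL T) J' γ' f x

/-- The integrals `∫_{∂(U ∩ ℂ_J)} f(s) ds_J K_T(s, x)` depend neither on `U` nor on `J`. -/
def IntegralIndepR (W : Set R6) (f : R6 → Cl5) (T : (R6 → Cl5) → (R6 → Cl5)) : Prop :=
  ∀ (U : Set R6) (J : R6) (m : ℕ) (γ : Fin m → ℝ → ℂ)
    (U' : Set R6) (J' : R6) (m' : ℕ) (γ' : Fin m' → ℝ → ℂ),
    IsContour W U J γ → IsContour W U' J' γ' → ∀ x ∈ U ∩ U',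
      integralR (kernelR T) J γ f x = integralR (kernelR T) J' γ' f x

/-! ### The operators of the fine structure -/

/-- `g ↦ Δ^{1-ℓ} 𝒟 g`. -/
def opDL (l : ℕ) (g : R6 → Cl5) : R6 → Cl5 := lap^[1 - l] (diracL g)

/-- `g ↦ g Δ^{1-ℓ} 𝒟`. -/
def opDR (l : ℕ) (g : R6 → Cl5) : R6 → Cl5 := lap^[1 - l] (diracR g)

/-- `g ↦ Δ^ℓ 𝒟̄^{2-ℓ} g`. -/
def opDBarL (l : ℕ) (g : R6 → Cl5) : R6 → Cl5 := lap^[l] (diracBarL^[2 - l] g)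

/-- `g ↦ g Δ^ℓ 𝒟̄^{2-ℓ}`. -/
def opDBarR (l : ℕ) (g : R6 → Cl5) : R6 → Cl5 := lap^[l] (diracBarR^[2 - l] g)

/-- `g ↦ 𝒟² g`. -/
def opDSqL (g : R6 → Cl5) : R6 → Cl5 := diracL (diracL g)

/-- `g ↦ g 𝒟²`. -/
def opDSqR (g : R6 → Cl5) : R6 → Cl5 := diracR (diracR g)

end FineStructure

end

/-! Everything is carried by the Cauchy kernel. The slice Cauchy formula f(x) = (1/2π) ∫ S_L⁻¹(s, x)
ds_J f(s) (`IsNullCycle.cycleIntegral_cauchyL`) contains x only in the kernel, which is smooth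
wherever 𝒬 is invertible. An operator T composed of 𝒟, 𝒟̄ and Δ therefore passes under the integral
sign (`IsKernelOp`), and this is the representation of T f. Since the other side T f(x) knows
nothing of U and J, neither does the integral.

The Cauchy formula is a statement in one plane ℂ_J. The sphere [x] meets ℂ_J in two conjugate points
z and z̄, and partial fractions write S_L⁻¹(ζ, x) as a combination of 1/(ζ - z) and 1/(ζ - z̄). The
coefficients are exactly those that recover f(x) = α + Iβ from the values α ± Jβ of f at the two
points. Those values come from the complex Cauchy formula, applied to f on ℂ_J after composition
with ℂ_J-linear functionals. As the contours are known only through their winding numbers, the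
homological form is needed. It follows from Dixon's argument: the integral of the difference
quotient extends to an entire function that vanishes at infinity (`IsNullCycle.cauchy_formula`).

The explicit kernels rest on identities for d = -½∇𝒬, whose components commute with 𝒬: ∂ᵢ𝒬⁻¹ =
2dᵢ𝒬⁻², Σ dᵢ² = 𝒬, Σ eᵢ(s - x̄)dᵢ = 𝒬. They give 𝒟S_L⁻¹ = -4𝒬⁻¹ and Δ𝒬⁻ᵏ = 4k(k - 2)𝒬⁻ᵏ⁻¹, hence
Δ²𝒟S_L⁻¹ = 0. Consequently Δ²𝒟f = 0 (`SliceHypL.lap_lap_diracL`), and every function class in the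
theorem reduces to this equation through 𝒟𝒟̄ = 𝒟̄𝒟 = Δ. The equation is local, so small circles
around z and z̄ suffice as contours for it.

Reversion, the antiautomorphism that fixes the paravectors, exchanges left and right and deduces the
right-sided statements from the left-sided ones. -/

noncomputable section

namespace FineStructure

open MeasureTheory Set Filter Topology Metric
open scoped ContDiff

section

/-! ### The homological Cauchy theorem for weighted curves -/

/-- Local boundedness of difference quotients of a holomorphic function. -/
theorem exists_bound_dslope {f : ℂ → ℂ} {Ω K : Set ℂ} (hΩ : IsOpen Ω)
    (hf : DifferentiableOn ℂ f Ω) (hK : IsCompact K) (hKΩ : K ⊆ Ω) {z₀ : ℂ} (hz₀ : z₀ ∈ Ω) :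
    ∃ r > 0, ∃ C : ℝ, ball z₀ r ⊆ Ω ∧ ∀ z ∈ ball z₀ r, ∀ w ∈ K, ‖dslope f w z‖ ≤ C := by
  obtain ⟨r, hr, hrΩ⟩ := nhds_basis_closedBall.mem_iff.1 (hΩ.mem_nhds hz₀)
  have hL : IsCompact (K ∪ closedBall z₀ r) := hK.union (isCompact_closedBall _ _)
  have hLΩ : K ∪ closedBall z₀ r ⊆ Ω := union_subset hKΩ hrΩ
  -- On a compact thickening inside `Ω` both `f` and its derivative are bounded. Quotients with |z -
  -- w| ≤ δ are controlled by the mean value inequality on a disc around w, all others by 2 sup|f| /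
  -- δ.
  obtain ⟨δ, hδ, hδΩ⟩ := hL.exists_cthickening_subset_open hΩ hLΩ
  have hT : IsCompact (cthickening δ (K ∪ closedBall z₀ r)) := hL.cthickening
  obtain ⟨C₁, hC₁⟩ := hT.exists_bound_of_continuousOn ((hf.deriv hΩ).continuousOn.mono hδΩ)
  obtain ⟨C₀, hC₀⟩ := hT.exists_bound_of_continuousOn (hf.continuousOn.mono hδΩ)
  have hsub : K ∪ closedBall z₀ r ⊆ cthickening δ (K ∪ closedBall z₀ r) :=
    self_subset_cthickening _
  refine ⟨r, hr, max C₁ (2 * C₀ / δ), ball_subset_closedBall.trans hrΩ, fun z hz w hw => ?_⟩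
  have hwT := hsub (Or.inl hw)
  have hzT := hsub (Or.inr (ball_subset_closedBall hz))
  rcases eq_or_ne z w with rfl | hne
  · rw [dslope_same]
    exact (hC₁ _ hwT).trans (le_max_left _ _)
  have hpos : 0 < ‖z - w‖ := norm_pos_iff.2 (sub_ne_zero.2 hne)
  rw [dslope_of_ne _ hne, slope_def_module, norm_smul, norm_inv, inv_mul_le_iff₀ hpos]
  by_cases hd : dist z w ≤ δ
  · have hball : closedBall w δ ⊆ cthickening δ (K ∪ closedBall z₀ r) :=
      closedBall_subset_cthickening (mem_union_left _ hw) δ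
    have := Convex.norm_image_sub_le_of_norm_deriv_le (f := f) (C := C₁)
      (fun y hy => (hf.differentiableAt (hΩ.mem_nhds (hδΩ (hball hy)))))
      (fun y hy => hC₁ y (hball hy)) (convex_closedBall w δ)
      (mem_closedBall_self hδ.le) (mem_closedBall.2 hd)
    calc ‖f z - f w‖ ≤ C₁ * ‖z - w‖ := this
      _ ≤ ‖z - w‖ * max C₁ (2 * C₀ / δ) := by
        rw [mul_comm]; gcongr; exact le_max_left _ _
  · have h1 : ‖f z - f w‖ ≤ 2 * C₀ := by
      have := norm_sub_le (f z) (f w)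
      have h2 := hC₀ z hzT
      have h3 := hC₀ w hwT
      linarith
    have hd' : δ ≤ ‖z - w‖ := by rw [← dist_eq_norm]; exact (not_le.1 hd).le
    have h0 : 0 ≤ 2 * C₀ := (norm_nonneg _).trans h1
    calc ‖f z - f w‖ ≤ δ * (2 * C₀ / δ) := by rw [mul_div_cancel₀ _ hδ.ne']; exact h1
      _ ≤ ‖z - w‖ * (2 * C₀ / δ) := by gcongr
      _ ≤ ‖z - w‖ * max C₁ (2 * C₀ / δ) := by gcongr; exact le_max_right _ _

/-- Holomorphic dependence of an integral on a parameter. -/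
theorem differentiableAt_integral_of_bound {w : ℝ → ℂ} (hw : IntervalIntegrable w volume 0 1)
    {k : ℝ → ℂ → ℂ} {z₀ : ℂ} {r C : ℝ} (hr : 0 < r)
    (hd : ∀ t ∈ Icc (0 : ℝ) 1, DifferentiableOn ℂ (k t) (ball z₀ r))
    (hb : ∀ t ∈ Icc (0 : ℝ) 1, ∀ z ∈ ball z₀ r, ‖k t z‖ ≤ C)
    (hc : ∀ z ∈ ball z₀ r, ContinuousOn (fun t => k t z) (Icc 0 1)) :
    DifferentiableAt ℂ (fun z => ∫ t in (0 : ℝ)..1, w t * k t z) z₀ := by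
  have hsub : uIoc (0 : ℝ) 1 ⊆ Icc 0 1 := by
    rw [uIoc_of_le zero_le_one]; exact Ioc_subset_Icc_self
  have hmeas : ∀ z ∈ ball z₀ r,
      AEStronglyMeasurable (fun t => w t * k t z) (volume.restrict (uIoc (0 : ℝ) 1)) := by
    intro z hz
    refine (intervalIntegrable_iff.1 hw).aestronglyMeasurable.mul ?_
    exact ((hc z hz).aestronglyMeasurable measurableSet_Icc).mono_set hsub
  have hder : ∀ t ∈ Icc (0 : ℝ) 1, ∀ z ∈ ball z₀ r, HasDerivAt (k t) (deriv (k t) z) z :=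
    fun t ht z hz => ((hd t ht).differentiableAt (isOpen_ball.mem_nhds hz)).hasDerivAt
  have hz₀ : z₀ ∈ ball z₀ r := mem_ball_self hr
  have hrr : ball z₀ (r / 2) ⊆ ball z₀ r := ball_subset_ball (by linarith)
  refine (intervalIntegral.hasDerivAt_integral_of_dominated_loc_of_deriv_le
    (F := fun z t => w t * k t z) (F' := fun z t => w t * deriv (k t) z)
    (bound := fun t => ‖w t‖ * (C / (r / 4))) (ball_mem_nhds z₀ (half_pos hr)) ?_ ?_ ?_ ?_ ?_
    ?_).2.differentiableAt
  · filter_upwards [ball_mem_nhds z₀ hr] with z hz using hmeas z hz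
  · refine hw.mul_continuousOn ?_
    rw [uIcc_of_le zero_le_one]
    exact hc z₀ hz₀
  · refine (intervalIntegrable_iff.1 hw).aestronglyMeasurable.mul ?_
    -- Nothing is assumed about the measurability of t ↦ (k t)'(z₀). It is a pointwise limit of
    -- difference quotients along this sequence, and these are continuous in t.
    have hseq : Tendsto (fun n : ℕ => (z₀ + ((r / 2 : ℝ) : ℂ) * (1 / ((n : ℂ) + 1)) : ℂ)) atTop
        (𝓝[≠] z₀) := by
      refine tendsto_nhdsWithin_iff.2 ⟨?_, Eventually.of_forall fun n => ?_⟩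
      · have := (tendsto_one_div_add_atTop_nhds_zero_nat (𝕜 := ℂ)).const_mul ((r / 2 : ℝ) : ℂ)
        simpa using this.const_add z₀
      · have h1 : ((n : ℂ) + 1) ≠ 0 := by exact_mod_cast n.succ_ne_zero
        simp [hr.ne', h1]
    refine aestronglyMeasurable_of_tendsto_ae (u := atTop) (f := fun (n : ℕ) t =>
      slope (k t) z₀ (z₀ + ((r / 2 : ℝ) : ℂ) * (1 / ((n : ℂ) + 1)))) (fun n => ?_) ?_
    · have hmem : z₀ + ((r / 2 : ℝ) : ℂ) * (1 / ((n : ℂ) + 1)) ∈ ball z₀ r := by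
        rw [mem_ball, dist_eq_norm, add_sub_cancel_left, norm_mul, Complex.norm_real,
          Real.norm_of_nonneg (by positivity)]
        have : ‖(1 / ((n : ℂ) + 1))‖ ≤ 1 := by
          rw [norm_div, norm_one, div_le_one₀]
          · have : ‖(n : ℂ) + 1‖ = (n : ℝ) + 1 := by
              exact_mod_cast Complex.norm_natCast (n + 1)
            rw [this]; linarith [(Nat.cast_nonneg n : (0 : ℝ) ≤ n)]
          · exact norm_pos_iff.2 (by exact_mod_cast n.succ_ne_zero)
        nlinarith
      simp only [slope_def_module]
      have hcont := ContinuousOn.fun_const_smul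
        (ContinuousOn.fun_sub (hc _ hmem) (hc _ hz₀))
        (z₀ + ((r / 2 : ℝ) : ℂ) * (1 / ((n : ℂ) + 1)) - z₀)⁻¹
      exact (hcont.aestronglyMeasurable measurableSet_Icc).mono_set hsub
    · refine (ae_restrict_iff' measurableSet_uIoc).2 (Eventually.of_forall fun t ht => ?_)
      exact (hasDerivAt_iff_tendsto_slope.1 (hder t (hsub ht) z₀ hz₀)).comp hseq
  · refine Eventually.of_forall fun t ht z hz => ?_
    rw [norm_mul]
    gcongr
    -- Cauchy's estimate on the circle of radius r/4 around z, which stays in the ball of radius r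
    -- because z is within r/2 of z₀.
    have hzr : closedBall z (r / 4) ⊆ ball z₀ r := by
      intro y hy
      rw [mem_ball] at hz ⊢
      rw [mem_closedBall] at hy
      linarith [dist_triangle y z z₀]
    refine Complex.norm_deriv_le_of_forall_mem_sphere_norm_le (by linarith) ?_ fun y hy =>
      hb t (hsub ht) y (hzr (sphere_subset_closedBall hy))
    refine ((hd t (hsub ht)).mono ?_).diffContOnCl
    exact closure_ball_subset_closedBall.trans hzr
  · exact hw.norm.mul_const _
  · refine Eventually.of_forall fun t ht z hz => ?_
    exact (hder t (hsub ht) z (hrr hz)).const_mul (w t)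

/-- The symmetry converts continuity of the difference quotient in its second argument into
continuity along the curve, where the first argument moves. -/
theorem dslope_comm (f : ℂ → ℂ) (a b : ℂ) : dslope f a b = dslope f b a := by
  rcases eq_or_ne a b with rfl | h
  · rfl
  · rw [dslope_of_ne _ h.symm, dslope_of_ne _ h, slope_comm]

/-- Finitely many curves `γ k : [0, 1] → ℂ` with integrable weights `w k`, lying in the open set
`Ω`, and not winding around the points of a neighbourhood `Ω'` of the complement of `Ω` and of
infinity. -/
structure IsNullCycle (Ω Ω' : Set ℂ) {m : ℕ} (γ : Fin m → ℝ → ℂ) (w : Fin m → ℝ → ℂ) : Prop where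
  isOpen_left : IsOpen Ω
  isOpen_right : IsOpen Ω'
  cover : Ω ∪ Ω' = univ
  bounded : Bornology.IsBounded Ω'ᶜ
  continuousOn : ∀ k, ContinuousOn (γ k) (Icc 0 1)
  integrable : ∀ k, IntervalIntegrable (w k) volume 0 1
  mem : ∀ k, ∀ t ∈ Icc (0 : ℝ) 1, γ k t ∈ Ω
  notMem : ∀ k, ∀ t ∈ Icc (0 : ℝ) 1, γ k t ∉ Ω'
  index_eq_zero : ∀ z ∈ Ω', ∑ k, ∫ t in (0 : ℝ)..1, w k t / (γ k t - z) = 0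

variable {Ω Ω' : Set ℂ} {m : ℕ} {γ : Fin m → ℝ → ℂ} {w : Fin m → ℝ → ℂ}

theorem IsNullCycle.isCompact_image (h : IsNullCycle Ω Ω' γ w) (k : Fin m) :
    IsCompact (γ k '' Icc 0 1) := isCompact_Icc.image_of_continuousOn (h.continuousOn k)

theorem IsNullCycle.differentiableAt_integral_dslope (h : IsNullCycle Ω Ω' γ w) {f : ℂ → ℂ}
    (hf : DifferentiableOn ℂ f Ω) (k : Fin m) {z₀ : ℂ} (hz₀ : z₀ ∈ Ω) :
    DifferentiableAt ℂ (fun z => ∫ t in (0 : ℝ)..1, w k t * dslope f (γ k t) z) z₀ := by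
  obtain ⟨r, hr, C, hrΩ, hC⟩ := exists_bound_dslope h.isOpen_left hf (h.isCompact_image k)
    (by rintro _ ⟨t, ht, rfl⟩; exact h.mem k t ht) hz₀
  refine differentiableAt_integral_of_bound (h.integrable k) hr (fun t ht => ?_)
    (fun t ht z hz => hC z hz _ ⟨t, ht, rfl⟩) fun z hz => ?_
  · exact ((Complex.differentiableOn_dslope (h.isOpen_left.mem_nhds (h.mem k t ht))).2 hf).mono hrΩ
  · simp_rw [fun t => dslope_comm f (γ k t) z]
    have hzΩ := h.isOpen_left.mem_nhds (hrΩ hz)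
    exact ((continuousOn_dslope hzΩ).2 ⟨hf.continuousOn, hf.differentiableAt hzΩ⟩).comp
      (h.continuousOn k) (h.mem k)

theorem IsNullCycle.intervalIntegrable_mul (h : IsNullCycle Ω Ω' γ w) {f : ℂ → ℂ}
    (hf : ContinuousOn f Ω) (k : Fin m) :
    IntervalIntegrable (fun t => w k t * f (γ k t)) volume 0 1 := by
  refine (h.integrable k).mul_continuousOn ?_
  rw [uIcc_of_le zero_le_one]
  exact hf.comp (h.continuousOn k) (h.mem k)

theorem IsNullCycle.differentiableAt_cauchyIntegral (h : IsNullCycle Ω Ω' γ w) {f : ℂ → ℂ}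
    (hf : ContinuousOn f Ω) (k : Fin m) {z₀ : ℂ} (hz₀ : z₀ ∈ Ω') :
    DifferentiableAt ℂ (fun z => ∫ t in (0 : ℝ)..1, w k t * f (γ k t) * (γ k t - z)⁻¹) z₀ := by
  obtain ⟨r, hr, hrΩ⟩ := nhds_basis_ball.mem_iff.1 (h.isOpen_right.mem_nhds hz₀)
  have hdist : ∀ t ∈ Icc (0 : ℝ) 1, ∀ z ∈ ball z₀ (r / 2), r / 2 ≤ ‖γ k t - z‖ := by
    intro t ht z hz
    by_contra! hlt
    refine h.notMem k t ht (hrΩ ?_)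
    rw [mem_ball] at hz ⊢
    rw [← dist_eq_norm] at hlt
    linarith [dist_triangle (γ k t) z z₀]
  have hne : ∀ t ∈ Icc (0 : ℝ) 1, ∀ z ∈ ball z₀ (r / 2), γ k t - z ≠ 0 := fun t ht z hz =>
    norm_pos_iff.1 ((half_pos hr).trans_le (hdist t ht z hz))
  refine differentiableAt_integral_of_bound (k := fun t z => (γ k t - z)⁻¹)
    (h.intervalIntegrable_mul hf k) (half_pos hr) (C := (r / 2)⁻¹)
    (fun t ht => ?_) (fun t ht z hz => ?_) fun z hz => ?_
  · exact DifferentiableOn.inv (by fun_prop) (hne t ht)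
  · rw [norm_inv]
    exact inv_anti₀ (half_pos hr) (hdist t ht z hz)
  · exact ((h.continuousOn k).sub continuousOn_const).inv₀ fun t ht => hne t ht z hz

/-- If the curve lies in the disc of radius R, then the integrand is at most ‖W t‖ / (|z| - R) for
|z| > R. -/
theorem tendsto_cauchyIntegral_cocompact {c W : ℝ → ℂ} (hc : ContinuousOn c (Icc 0 1))
    (hW : IntervalIntegrable W volume 0 1) :
    Tendsto (fun z => ∫ t in (0 : ℝ)..1, W t * (c t - z)⁻¹) (cocompact ℂ) (𝓝 0) := by
  obtain ⟨R, hR⟩ := isCompact_Icc.exists_bound_of_continuousOn hc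
  have hlim : Tendsto (fun z : ℂ => (∫ t in (0 : ℝ)..1, ‖W t‖) * (‖z‖ - R)⁻¹) (cocompact ℂ)
      (𝓝 0) := by
    have h1 : Tendsto (fun z : ℂ => ‖z‖ - R) (cocompact ℂ) atTop :=
      tendsto_atTop_add_const_right _ _ tendsto_norm_cocompact_atTop
    simpa using (tendsto_inv_atTop_zero.comp h1).const_mul (∫ t in (0 : ℝ)..1, ‖W t‖)
  refine squeeze_zero_norm' ?_ hlim
  filter_upwards [(tendsto_norm_cocompact_atTop (E := ℂ)).eventually_gt_atTop R] with z hz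
  rw [← intervalIntegral.integral_mul_const]
  refine intervalIntegral.norm_integral_le_of_norm_le zero_le_one ?_ (hW.norm.mul_const _)
  refine Eventually.of_forall fun t ht => ?_
  rw [norm_mul, norm_inv]
  gcongr
  have := norm_sub_norm_le z (c t)
  rw [norm_sub_rev] at this
  linarith [hR t (Ioc_subset_Icc_self ht)]

/-- Off the curves the difference quotient may be split into its two terms, each of which is
integrable. This links Dixon's function to the Cauchy integral and to the winding number. -/
theorem IsNullCycle.sum_integral_dslope (h : IsNullCycle Ω Ω' γ w) {f : ℂ → ℂ}
    (hf : DifferentiableOn ℂ f Ω) {z : ℂ} (hoff : ∀ k, ∀ t ∈ Icc (0 : ℝ) 1, γ k t ≠ z) :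
    ∑ k, ∫ t in (0 : ℝ)..1, w k t * dslope f (γ k t) z =
      (∑ k, ∫ t in (0 : ℝ)..1, w k t * f (γ k t) * (γ k t - z)⁻¹) -
        f z * ∑ k, ∫ t in (0 : ℝ)..1, w k t / (γ k t - z) := by
  rw [Finset.mul_sum, ← Finset.sum_sub_distrib]
  refine Finset.sum_congr rfl fun k _ => ?_
  have hinv : ContinuousOn (fun t => (γ k t - z)⁻¹) (uIcc 0 1) := by
    rw [uIcc_of_le zero_le_one]
    exact ((h.continuousOn k).sub continuousOn_const).inv₀ fun t ht =>
      sub_ne_zero.2 (hoff k t ht)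
  have h1 := (h.intervalIntegrable_mul hf.continuousOn k).mul_continuousOn hinv
  have h2 : IntervalIntegrable (fun t => w k t / (γ k t - z)) volume 0 1 := by
    simpa only [div_eq_mul_inv] using (h.integrable k).mul_continuousOn hinv
  rw [← intervalIntegral.integral_const_mul, ← intervalIntegral.integral_sub h1 (h2.const_mul _)]
  refine intervalIntegral.integral_congr fun t ht => ?_
  rw [uIcc_of_le zero_le_one] at ht
  have hne := hoff k t ht
  simp only [dslope_of_ne f hne.symm, slope_def_field]
  have h3 : z - γ k t ≠ 0 := sub_ne_zero.2 hne.symm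
  have h4 : γ k t - z ≠ 0 := sub_ne_zero.2 hne
  field_simp
  ring

/-- The Cauchy integral formula for a cycle that is null-homologous in `Ω`. -/
theorem IsNullCycle.cauchy_formula (h : IsNullCycle Ω Ω' γ w) {f : ℂ → ℂ}
    (hf : DifferentiableOn ℂ f Ω) {z : ℂ} (hz : z ∈ Ω)
    (hoff : ∀ k, ∀ t ∈ Icc (0 : ℝ) 1, γ k t ≠ z) :
    ∑ k, ∫ t in (0 : ℝ)..1, w k t * f (γ k t) * (γ k t - z)⁻¹ =
      f z * ∑ k, ∫ t in (0 : ℝ)..1, w k t / (γ k t - z) := by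
  classical
  set g₁ : ℂ → ℂ := fun z => ∑ k, ∫ t in (0 : ℝ)..1, w k t * dslope f (γ k t) z with hg₁
  set g₂ : ℂ → ℂ := fun z => ∑ k, ∫ t in (0 : ℝ)..1, w k t * f (γ k t) * (γ k t - z)⁻¹ with hg₂
  -- On the overlap the winding number vanishes, so the term containing f(z) drops out and the two
  -- definitions coincide.
  have hagree : ∀ z ∈ Ω, z ∈ Ω' → g₁ z = g₂ z := by
    intro z hz hz'
    have := h.sum_integral_dslope hf fun k t ht he => h.notMem k t ht (he ▸ hz')
    rw [h.index_eq_zero z hz', mul_zero, sub_zero] at this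
    exact this
  -- Dixon's function: the two formulas glue to an entire function because `Ω` and `Ω'` are open and
  -- cover the plane.
  set g : ℂ → ℂ := fun z => if z ∈ Ω then g₁ z else g₂ z with hg
  have hgΩ' : ∀ z ∈ Ω', g z = g₂ z := by
    intro z hz
    by_cases hzΩ : z ∈ Ω
    · rw [hg]; simp only [hzΩ, if_true]; exact hagree z hzΩ hz
    · rw [hg]; simp only [hzΩ, if_false]
  have hdiff : Differentiable ℂ g := by
    intro z
    have hzu : z ∈ Ω ∪ Ω' := h.cover ▸ mem_univ z
    rcases hzu with hz | hz
    · have : DifferentiableAt ℂ g₁ z :=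
        DifferentiableAt.fun_sum fun k _ => h.differentiableAt_integral_dslope hf k hz
      refine this.congr_of_eventuallyEq ?_
      filter_upwards [h.isOpen_left.mem_nhds hz] with y hy
      rw [hg]; simp only [hy, if_true]
    · have : DifferentiableAt ℂ g₂ z :=
        DifferentiableAt.fun_sum fun k _ => h.differentiableAt_cauchyIntegral hf.continuousOn k hz
      refine this.congr_of_eventuallyEq ?_
      filter_upwards [h.isOpen_right.mem_nhds hz] with y hy using hgΩ' y hy
  have hlim : Tendsto g (cocompact ℂ) (𝓝 0) := by
    have h2 : Tendsto g₂ (cocompact ℂ) (𝓝 0) := by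
      have := tendsto_finsetSum (Finset.univ : Finset (Fin m)) fun k _ =>
        tendsto_cauchyIntegral_cocompact (h.continuousOn k)
          (h.intervalIntegrable_mul hf.continuousOn k)
      simpa using this
    refine h2.congr' ?_
    have hb : Ω' ∈ cocompact ℂ := by
      rw [← cobounded_eq_cocompact]
      exact Bornology.isCobounded_def.1 (Bornology.isBounded_compl_iff.1 h.bounded)
    filter_upwards [hb] with y hy using (hgΩ' y hy).symm
  -- Liouville's theorem.
  have hzero : g z = 0 := hdiff.apply_eq_of_tendsto_cocompact z hlim
  have hgz : g z = g₁ z := by rw [hg]; simp only [hz, if_true]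
  rw [hgz, hg₁] at hzero
  simp only at hzero
  rw [h.sum_integral_dslope hf hoff] at hzero
  exact sub_eq_zero.1 hzero

end

section

/-! ### Algebra of paravectors -/

theorem gen_zero : gen 0 = 1 := rfl

theorem gen_succ (i : Fin 5) : gen i.succ = CliffordAlgebra.ι negForm (Pi.single i 1) := rfl

theorem genBar_zero : genBar 0 = 1 := rfl

theorem genBar_succ (i : Fin 5) : genBar i.succ = -gen i.succ := rfl

/-- The vector part `x₁ e₁ + ⋯ + x₅ e₅` of a paravector. -/
def vecPart (x : R6) : Cl5 := ∑ i : Fin 5, x i.succ • gen i.succ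

theorem negForm_apply (v : Fin 5 → ℝ) : negForm v = -∑ i, v i ^ 2 := by
  simp [negForm, QuadraticMap.weightedSumSquares_apply, sq]

theorem vecPart_eq_ι (x : R6) : vecPart x = CliffordAlgebra.ι negForm (fun i => x i.succ) := by
  simp_rw [vecPart, gen_succ, ← map_smul, ← map_sum]
  congr 1
  ext j
  simp [Finset.sum_apply, Pi.single_apply]

theorem para_eq (x : R6) : para x = algebraMap ℝ Cl5 (x 0) + vecPart x := by
  rw [para, Fin.sum_univ_succ, gen_zero, Algebra.algebraMap_eq_smul_one]
  rfl

theorem para_pconj (x : R6) : para (pconj x) = algebraMap ℝ Cl5 (x 0) - vecPart x := by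
  rw [para, Fin.sum_univ_succ, gen_zero, Algebra.algebraMap_eq_smul_one, vecPart, sub_eq_add_neg,
    ← Finset.sum_neg_distrib]
  simp [pconj, Fin.succ_ne_zero]

theorem norm_sq_eq (x : R6) : ‖x‖ ^ 2 = x 0 ^ 2 + ∑ i : Fin 5, x i.succ ^ 2 := by
  rw [EuclideanSpace.norm_sq_eq, Fin.sum_univ_succ]
  simp

theorem vecPart_mul_self (x : R6) :
    vecPart x * vecPart x = -algebraMap ℝ Cl5 (∑ i : Fin 5, x i.succ ^ 2) := by
  rw [vecPart_eq_ι, CliffordAlgebra.ι_sq_scalar, negForm_apply, map_neg]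

theorem gen_succ_mul_self (i : Fin 5) : gen i.succ * gen i.succ = -1 := by
  rw [gen_succ, CliffordAlgebra.ι_sq_scalar, negForm_apply, ← map_one (algebraMap ℝ Cl5),
    ← map_neg]
  congr 2
  simp [Pi.single_apply]

theorem gen_succ_mul_add_swap {i j : Fin 5} (h : i ≠ j) :
    gen i.succ * gen j.succ + gen j.succ * gen i.succ = 0 := by
  rw [gen_succ, gen_succ, CliffordAlgebra.ι_mul_ι_add_swap, QuadraticMap.polar]
  simp only [negForm_apply]
  rw [← map_zero (algebraMap ℝ Cl5)]
  congr 1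
  simp only [Pi.add_apply, add_sq, Finset.sum_add_distrib]
  have : ∑ x : Fin 5, 2 * (Pi.single i 1 : Fin 5 → ℝ) x * (Pi.single j 1 : Fin 5 → ℝ) x = 0 := by
    refine Finset.sum_eq_zero fun k _ => ?_
    rcases eq_or_ne k i with rfl | hk
    · simp [Pi.single_eq_of_ne h]
    · simp [Pi.single_eq_of_ne hk]
  rw [this]
  ring

theorem gen_mul_genBar_self (i : Fin 6) : gen i * genBar i = 1 := by
  refine Fin.cases ?_ (fun j => ?_) i
  · simp [gen_zero, genBar_zero]
  · rw [genBar_succ, mul_neg, gen_succ_mul_self, neg_neg]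

theorem genBar_mul_gen_self (i : Fin 6) : genBar i * gen i = 1 := by
  refine Fin.cases ?_ (fun j => ?_) i
  · simp [gen_zero, genBar_zero]
  · rw [genBar_succ, neg_mul, gen_succ_mul_self, neg_neg]

/-- This is the polarised form of x x̄ = |x|². For vector units it is anticommutation; when one
index is 0 the sign of the conjugate unit produces the cancellation. -/
theorem gen_mul_genBar_add_swap {i j : Fin 6} (h : i ≠ j) :
    gen i * genBar j + gen j * genBar i = 0 := by
  induction i using Fin.cases with
  | zero =>
    induction j using Fin.cases with
    | zero => exact absurd rfl h
    | succ j => simp [gen_zero, genBar_zero, genBar_succ]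
  | succ i =>
    induction j using Fin.cases with
    | zero => simp [gen_zero, genBar_zero, genBar_succ]
    | succ j =>
      have := gen_succ_mul_add_swap (i := i) (j := j) (fun e => h (by rw [e]))
      rw [genBar_succ, genBar_succ, mul_neg, mul_neg, ← neg_add, this, neg_zero]

theorem genBar_mul_gen_add_swap {i j : Fin 6} (h : i ≠ j) :
    genBar i * gen j + genBar j * gen i = 0 := by
  induction i using Fin.cases with
  | zero =>
    induction j using Fin.cases with
    | zero => exact absurd rfl h
    | succ j => simp [gen_zero, genBar_zero, genBar_succ]
  | succ i =>
    induction j using Fin.cases with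
    | zero => simp [gen_zero, genBar_zero, genBar_succ]
    | succ j =>
      have := gen_succ_mul_add_swap (i := i) (j := j) (fun e => h (by rw [e]))
      rw [genBar_succ, genBar_succ, neg_mul, neg_mul, ← neg_add, this, neg_zero]

/-- A double sum against a symmetric array only sees the symmetric part of the coefficients. -/
theorem sum_sum_mul_eq_sum_diag {a b : Fin 6 → Cl5} (h1 : ∀ i, a i * b i = 1)
    (h2 : ∀ i j, i ≠ j → a i * b j + a j * b i = 0) {c : Fin 6 → Fin 6 → Cl5}
    (hc : ∀ i j, c i j = c j i) : ∑ i, ∑ j, a i * (b j * c i j) = ∑ i, c i i := by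
  have hsym : ∀ i j, a i * (b j * c i j) + a j * (b i * c j i) =
      if i = j then (2 : ℝ) • c i i else 0 := by
    intro i j
    rw [hc j i, ← mul_assoc, ← mul_assoc, ← add_mul]
    split_ifs with e
    · subst e
      rw [h1, two_smul, add_mul, one_mul]
    · rw [h2 i j e, zero_mul]
  -- Adding the sum to its transpose leaves twice the diagonal; the factor 2 is cancelled at the
  -- end.
  have hdouble : (2 : ℝ) • ∑ i, ∑ j, a i * (b j * c i j) = (2 : ℝ) • ∑ i, c i i := by
    calc (2 : ℝ) • ∑ i, ∑ j, a i * (b j * c i j)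
        = (∑ i, ∑ j, a i * (b j * c i j)) + ∑ i, ∑ j, a j * (b i * c j i) := by
          rw [two_smul]
          congr 1
          exact Finset.sum_comm
      _ = ∑ i, ∑ j, (a i * (b j * c i j) + a j * (b i * c j i)) := by
          simp only [Finset.sum_add_distrib]
      _ = (2 : ℝ) • ∑ i, c i i := by
          simp only [hsym, Finset.sum_ite_eq, Finset.mem_univ, if_true, Finset.smul_sum]
  exact smul_right_injective Cl5 (two_ne_zero' ℝ) hdouble

/-! ### Calculus of the differential operators -/

variable {V : Set R6} {f g : R6 → Cl5}

theorem pd_congr (hV : IsOpen V) (h : EqOn f g V) (i : Fin 6) : EqOn (pd i f) (pd i g) V := by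
  intro x hx
  have : f =ᶠ[𝓝 x] g := by filter_upwards [hV.mem_nhds hx] with y hy using h hy
  rw [pd, pd, this.fderiv_eq]

theorem lap_congr (hV : IsOpen V) (h : EqOn f g V) : EqOn (lap f) (lap g) V := by
  intro x hx
  have : f =ᶠ[𝓝 x] g := by filter_upwards [hV.mem_nhds hx] with y hy using h hy
  exact (InnerProductSpace.laplacian_congr_nhds this).eq_of_nhds

theorem diracL_congr (hV : IsOpen V) (h : EqOn f g V) : EqOn (diracL f) (diracL g) V := by
  intro x hx
  exact Finset.sum_congr rfl fun i _ => by rw [pd_congr hV h i hx]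

theorem diracBarL_congr (hV : IsOpen V) (h : EqOn f g V) :
    EqOn (diracBarL f) (diracBarL g) V := by
  intro x hx
  exact Finset.sum_congr rfl fun i _ => by rw [pd_congr hV h i hx]

/-- Since 𝒟 + 𝒟̄ = 2∂₀, only 𝒟 and ∂₀ of the kernels ever have to be calculated. -/
theorem diracBarL_eq (g : R6 → Cl5) (x : R6) :
    diracBarL g x = (2 : ℝ) • pd 0 g x - diracL g x := by
  simp only [diracBarL, diracL, Fin.sum_univ_succ (n := 5), gen_zero, genBar_zero, two_smul, one_mul,
    genBar_succ, neg_mul, Finset.sum_neg_distrib]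
  abel

theorem contDiffOn_pd (hV : IsOpen V) (hg : ContDiffOn ℝ ∞ g V) (i : Fin 6) :
    ContDiffOn ℝ ∞ (pd i g) V :=
  (hg.fderiv_of_isOpen hV (m := ∞) (by simp)).clm_apply contDiffOn_const

theorem differentiableAt_of_contDiffOn (hV : IsOpen V) (hg : ContDiffOn ℝ ∞ g V) {x : R6} (hx : x ∈ V) :
    DifferentiableAt ℝ g x :=
  (hg.differentiableOn (by simp)).differentiableAt (hV.mem_nhds hx)

theorem contDiffOn_diracL (hV : IsOpen V) (hg : ContDiffOn ℝ ∞ g V) :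
    ContDiffOn ℝ ∞ (diracL g) V :=
  ContDiffOn.sum fun i _ => contDiffOn_const.mul (contDiffOn_pd hV hg i)

theorem contDiffOn_diracBarL (hV : IsOpen V) (hg : ContDiffOn ℝ ∞ g V) :
    ContDiffOn ℝ ∞ (diracBarL g) V :=
  ContDiffOn.sum fun i _ => contDiffOn_const.mul (contDiffOn_pd hV hg i)

theorem pd_pd_eq (hV : IsOpen V) (hg : ContDiffOn ℝ ∞ g V) (i j : Fin 6) {x : R6} (hx : x ∈ V) :
    pd i (pd j g) x =
      fderiv ℝ (fderiv ℝ g) x (EuclideanSpace.single i 1) (EuclideanSpace.single j 1) := by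
  have hd : DifferentiableAt ℝ (fderiv ℝ g) x :=
    ((hg.fderiv_of_isOpen hV (m := ∞) (by simp)).differentiableOn (by simp)).differentiableAt
      (hV.mem_nhds hx)
  have : fderiv ℝ (pd j g) x = (ContinuousLinearMap.apply ℝ Cl5
      (EuclideanSpace.single j 1 : R6)).comp (fderiv ℝ (fderiv ℝ g) x) :=
    ((ContinuousLinearMap.apply ℝ Cl5 (EuclideanSpace.single j 1 : R6)).hasFDerivAt.comp x
      hd.hasFDerivAt).fderiv
  rw [pd, this]
  rfl

theorem pd_comm (hV : IsOpen V) (hg : ContDiffOn ℝ ∞ g V) (i j : Fin 6) {x : R6} (hx : x ∈ V) :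
    pd i (pd j g) x = pd j (pd i g) x := by
  rw [pd_pd_eq hV hg i j hx, pd_pd_eq hV hg j i hx]
  have : IsSymmSndFDerivAt ℝ g x := (hg.contDiffAt (hV.mem_nhds hx)).isSymmSndFDerivAt
    (by simpa using ENat.LEInfty.out)
  exact this _ _

theorem lap_eq_sum (hV : IsOpen V) (hg : ContDiffOn ℝ ∞ g V) {x : R6} (hx : x ∈ V) :
    lap g x = ∑ i, pd i (pd i g) x := by
  rw [lap, InnerProductSpace.laplacian_eq_iteratedFDeriv_orthonormalBasis g
    (EuclideanSpace.basisFun (Fin 6) ℝ)]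
  refine Finset.sum_congr rfl fun i _ => ?_
  rw [pd_pd_eq hV hg i i hx, iteratedFDeriv_two_apply]
  simp

theorem contDiffOn_lap (hV : IsOpen V) (hg : ContDiffOn ℝ ∞ g V) : ContDiffOn ℝ ∞ (lap g) V := by
  refine ContDiffOn.congr (f := fun x => ∑ i, pd i (pd i g) x)
    (ContDiffOn.sum fun i _ => contDiffOn_pd hV (contDiffOn_pd hV hg i) i) fun x hx => ?_
  exact lap_eq_sum hV hg hx

theorem pd_const_mul (c : Cl5) (i : Fin 6) {x : R6} (hg : DifferentiableAt ℝ g x) :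
    pd i (fun y => c * g y) x = c * pd i g x := by
  rw [pd, fderiv_const_mul hg]
  rfl

theorem pd_sum {ι : Type*} (s : Finset ι) {h : ι → R6 → Cl5} (i : Fin 6) {x : R6}
    (hg : ∀ k ∈ s, DifferentiableAt ℝ (h k) x) :
    pd i (fun y => ∑ k ∈ s, h k y) x = ∑ k ∈ s, pd i (h k) x := by
  rw [pd, fderiv_fun_sum hg]
  simp [pd]

theorem pd_mul (i : Fin 6) {x : R6} (hf : DifferentiableAt ℝ f x) (hg : DifferentiableAt ℝ g x) :
    pd i (fun y => f y * g y) x = pd i f x * g x + f x * pd i g x := by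
  rw [pd, fderiv_fun_mul' hf hg]
  simp [pd, add_comm]

theorem pd_add (i : Fin 6) {x : R6} (hf : DifferentiableAt ℝ f x) (hg : DifferentiableAt ℝ g x) :
    pd i (fun y => f y + g y) x = pd i f x + pd i g x := by
  rw [pd, fderiv_fun_add hf hg]
  rfl

theorem pd_const_smul (c : ℝ) (i : Fin 6) {x : R6} (hg : DifferentiableAt ℝ g x) :
    pd i (fun y => c • g y) x = c • pd i g x := by
  rw [pd, fderiv_fun_const_smul hg]
  rfl

/-- Operators `∑ aᵢ ∂ᵢ` with constant coefficients commute with partial derivatives. -/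
theorem pd_sum_mul_pd (hV : IsOpen V) (hg : ContDiffOn ℝ ∞ g V) (a : Fin 6 → Cl5) (i : Fin 6)
    {x : R6} (hx : x ∈ V) :
    pd i (fun y => ∑ j, a j * pd j g y) x = ∑ j, a j * pd j (pd i g) x := by
  have hd : ∀ j, DifferentiableAt ℝ (pd j g) x := fun j =>
    differentiableAt_of_contDiffOn hV (contDiffOn_pd hV hg j) hx
  rw [pd_sum _ _ fun j _ => (hd j).const_mul (a j)]
  refine Finset.sum_congr rfl fun j _ => ?_
  rw [pd_const_mul _ _ (hd j), pd_comm hV hg i j hx]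

theorem pd_diracL (hV : IsOpen V) (hg : ContDiffOn ℝ ∞ g V) (i : Fin 6) :
    EqOn (pd i (diracL g)) (diracL (pd i g)) V := fun _ hx => pd_sum_mul_pd hV hg gen i hx

theorem pd_diracBarL (hV : IsOpen V) (hg : ContDiffOn ℝ ∞ g V) (i : Fin 6) :
    EqOn (pd i (diracBarL g)) (diracBarL (pd i g)) V := fun _ hx => pd_sum_mul_pd hV hg genBar i hx

/-- The second partial derivatives form a symmetric array, so only the symmetric part of eᵢēⱼ
matters, and that is the identity matrix. -/
theorem diracL_diracBarL (hV : IsOpen V) (hg : ContDiffOn ℝ ∞ g V) :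
    EqOn (diracL (diracBarL g)) (lap g) V := by
  intro x hx
  rw [lap_eq_sum hV hg hx, diracL]
  simp_rw [pd_diracBarL hV hg _ hx, diracBarL, Finset.mul_sum]
  exact sum_sum_mul_eq_sum_diag (c := fun i j => pd j (pd i g) x) gen_mul_genBar_self
    (fun i j h => gen_mul_genBar_add_swap h) fun i j => pd_comm hV hg j i hx

theorem diracBarL_diracL (hV : IsOpen V) (hg : ContDiffOn ℝ ∞ g V) :
    EqOn (diracBarL (diracL g)) (lap g) V := by
  intro x hx
  rw [lap_eq_sum hV hg hx, diracBarL]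
  simp_rw [pd_diracL hV hg _ hx, diracL, Finset.mul_sum]
  exact sum_sum_mul_eq_sum_diag (c := fun i j => pd j (pd i g) x) genBar_mul_gen_self
    (fun i j h => genBar_mul_gen_add_swap h) fun i j => pd_comm hV hg j i hx

/-- Both sides are 𝒟𝒟̄𝒟, bracketed in two ways. -/
theorem diracL_lap (hV : IsOpen V) (hg : ContDiffOn ℝ ∞ g V) :
    EqOn (diracL (lap g)) (lap (diracL g)) V := by
  intro x hx
  rw [← diracL_diracBarL hV (contDiffOn_diracL hV hg) hx,
    diracL_congr hV (diracBarL_diracL hV hg) hx]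

theorem diracBarL_lap (hV : IsOpen V) (hg : ContDiffOn ℝ ∞ g V) :
    EqOn (diracBarL (lap g)) (lap (diracBarL g)) V := by
  intro x hx
  rw [← diracBarL_diracL hV (contDiffOn_diracBarL hV hg) hx,
    diracBarL_congr hV (diracL_diracBarL hV hg) hx]

end

section

/-! ### The kernels -/

/-- `𝒬_{c,s}(x) = s² - 2 x₀ s + |x|²`. -/
def Qc (s x : R6) : Cl5 :=
  para s ^ 2 - (2 * x 0) • para s + algebraMap ℝ Cl5 (‖x‖ ^ 2)

theorem Qinv_eq (s x : R6) : Qinv s x = Ring.inverse (Qc s x) := rfl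

/-- The pairs `(s, x)` with invertible `𝒬_{c,s}(x)`. -/
def regularPairs : Set (R6 × R6) := {p | IsUnit (Qc p.1 p.2)}

/-- The points `x` with invertible `𝒬_{c,s}(x)`. -/
def regularAt (s : R6) : Set R6 := {x | IsUnit (Qc s x)}

/-- `s - x₀`. -/
def subRe (s x : R6) : Cl5 := para s - algebraMap ℝ Cl5 (x 0)

/-- `s - x̄`. -/
def subConj (s x : R6) : Cl5 := para s - para (pconj x)

/-- The components of `-½ ∇ 𝒬`. -/
def halfGrad (s x : R6) : Fin 6 → Cl5 :=
  Fin.cons (subRe s x) fun j => -algebraMap ℝ Cl5 (x j.succ)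

theorem subConj_eq (s x : R6) : subConj s x = subRe s x + vecPart x := by
  rw [subConj, subRe, para_pconj]
  abel

theorem Qc_eq (s x : R6) :
    Qc s x = subRe s x ^ 2 + algebraMap ℝ Cl5 (∑ i : Fin 5, x i.succ ^ 2) := by
  have hc : algebraMap ℝ Cl5 (x 0) * para s = x 0 • para s := by rw [Algebra.smul_def]
  have hc' : para s * algebraMap ℝ Cl5 (x 0) = x 0 • para s := by
    rw [Algebra.smul_def, Algebra.commutes]
  rw [Qc, subRe, norm_sq_eq, map_add, map_pow, sq (para s - _), sub_mul, mul_sub, mul_sub, hc, hc',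
    sq, sq, mul_smul, two_smul]
  abel

theorem contDiff_para : ContDiff ℝ ∞ para := by
  unfold para
  fun_prop

theorem contDiff_vecPart : ContDiff ℝ ∞ vecPart := by
  unfold vecPart
  fun_prop

theorem contDiff_algebraMap_coord (i : Fin 6) :
    ContDiff ℝ ∞ (fun x : R6 => algebraMap ℝ Cl5 (x i)) := by
  simp_rw [Algebra.algebraMap_eq_smul_one]
  fun_prop

theorem contDiff_Qc : ContDiff ℝ ∞ (fun p : R6 × R6 => Qc p.1 p.2) := by
  unfold Qc
  simp_rw [Algebra.algebraMap_eq_smul_one]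
  have h1 : ContDiff ℝ ∞ (fun p : R6 × R6 => para p.1) := contDiff_para.comp contDiff_fst
  have h2 : ContDiff ℝ ∞ (fun p : R6 × R6 => p.2 0) := by fun_prop
  have h3 : ContDiff ℝ ∞ (fun p : R6 × R6 => ‖p.2‖ ^ 2) := contDiff_snd.norm_sq ℝ
  exact ((h1.pow 2).sub ((contDiff_const.mul h2).smul h1)).add (h3.fun_smul contDiff_const)

theorem isOpen_regularPairs : IsOpen regularPairs :=
  Units.isOpen.preimage contDiff_Qc.continuous

theorem isOpen_regularAt (s : R6) : IsOpen (regularAt s) :=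
  isOpen_regularPairs.preimage (f := fun x => (s, x)) (by fun_prop)

theorem contDiffOn_Qinv : ContDiffOn ℝ ∞ (fun p : R6 × R6 => Qinv p.1 p.2) regularPairs := by
  intro p hp
  obtain ⟨u, hu⟩ : IsUnit (Qc p.1 p.2) := hp
  have h := contDiffAt_ringInverse (n := ∞) ℝ u
  rw [hu] at h
  exact (h.comp p contDiff_Qc.contDiffAt).contDiffWithinAt

theorem contDiff_subConj : ContDiff ℝ ∞ (fun p : R6 × R6 => subConj p.1 p.2) := by
  simp_rw [subConj_eq, subRe]
  have h1 : ContDiff ℝ ∞ (fun p : R6 × R6 => para p.1) := contDiff_para.comp contDiff_fst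
  have h2 : ContDiff ℝ ∞ (fun p : R6 × R6 => algebraMap ℝ Cl5 (p.2 0)) :=
    (contDiff_algebraMap_coord 0).comp contDiff_snd
  exact (h1.sub h2).add (contDiff_vecPart.comp contDiff_snd)

theorem contDiffOn_cauchyL_prod :
    ContDiffOn ℝ ∞ (fun p : R6 × R6 => cauchyL p.1 p.2) regularPairs :=
  contDiff_subConj.contDiffOn.mul contDiffOn_Qinv

variable {s x : R6}

theorem contDiffOn_Qinv_right (s : R6) : ContDiffOn ℝ ∞ (Qinv s) (regularAt s) :=
  contDiffOn_Qinv.comp (f := fun x => (s, x)) (by fun_prop) fun _ hx => hx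

theorem contDiffOn_cauchyL (s : R6) : ContDiffOn ℝ ∞ (cauchyL s) (regularAt s) :=
  contDiffOn_cauchyL_prod.comp (f := fun x => (s, x)) (by fun_prop) fun _ hx => hx

theorem contDiff_subConj_right (s : R6) : ContDiff ℝ ∞ (subConj s) :=
  contDiff_subConj.comp (f := fun x => (s, x)) (by fun_prop)

theorem contDiff_subRe_right (s : R6) : ContDiff ℝ ∞ (subRe s) :=
  contDiff_const.sub (contDiff_algebraMap_coord 0)

theorem Qc_mul_Qinv (hx : x ∈ regularAt s) : Qc s x * Qinv s x = 1 :=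
  Ring.mul_inverse_cancel _ hx

theorem Qinv_mul_Qc (hx : x ∈ regularAt s) : Qinv s x * Qc s x = 1 :=
  Ring.inverse_mul_cancel _ hx

theorem commute_subRe_Qc (s x : R6) : Commute (subRe s x) (Qc s x) := by
  rw [Qc_eq]
  exact ((Commute.refl _).pow_right 2).add_right (Algebra.commutes _ _).symm

theorem commute_ringInverse {a b : Cl5} (h : Commute a b) (hb : IsUnit b) :
    Commute a (Ring.inverse b) := by
  obtain ⟨u, rfl⟩ := hb
  rw [Ring.inverse_unit]
  exact h.units_inv_right

theorem commute_subRe_Qinv (hx : x ∈ regularAt s) : Commute (subRe s x) (Qinv s x) :=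
  commute_ringInverse (commute_subRe_Qc s x) hx

/-- The component d₀ = s - x₀ lies in the commutative algebra generated by s, and the other
components are real. Powers of 𝒬⁻¹ can therefore be differentiated as in a commutative ring. -/
theorem commute_halfGrad_Qinv (hx : x ∈ regularAt s) (i : Fin 6) :
    Commute (halfGrad s x i) (Qinv s x) := by
  refine Fin.cases ?_ (fun j => ?_) i
  · exact commute_subRe_Qinv hx
  · exact Commute.neg_left (Algebra.commutes _ _)

/-! ### First and second derivatives of `𝒬` and of its inverse powers -/

theorem pd_algebraMap_coord (i j : Fin 6) (x : R6) :
    pd i (fun y => algebraMap ℝ Cl5 (y j)) x = if i = j then 1 else 0 := by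
  have : (fun y : R6 => algebraMap ℝ Cl5 (y j)) =
      ((ContinuousLinearMap.smulRight (EuclideanSpace.proj j : R6 →L[ℝ] ℝ) (1 : Cl5)) :
        R6 → Cl5) := by
    ext y
    simp [Algebra.algebraMap_eq_smul_one]
  rw [pd, this, ContinuousLinearMap.fderiv]
  by_cases h : i = j
  · subst h; simp
  · simp [h, Ne.symm h]

theorem pd_const (i : Fin 6) (c : Cl5) (x : R6) : pd i (fun _ => c) x = 0 := by
  simp [pd]

theorem pd_subRe_zero (s x : R6) : pd 0 (subRe s) x = -1 := by
  have h := pd_algebraMap_coord 0 0 x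
  rw [if_pos rfl] at h
  unfold subRe
  rw [pd, fderiv_const_sub, neg_apply]
  exact congrArg Neg.neg h

theorem pd_subRe_succ (s x : R6) (j : Fin 5) : pd j.succ (subRe s) x = 0 := by
  have h := pd_algebraMap_coord j.succ 0 x
  rw [if_neg (Fin.succ_ne_zero j)] at h
  unfold subRe
  rw [pd, fderiv_const_sub, neg_apply]
  exact (congrArg Neg.neg h).trans neg_zero

theorem pd_halfGrad (s x : R6) (i : Fin 6) : pd i (fun y => halfGrad s y i) x = -1 := by
  refine Fin.cases ?_ (fun j => ?_) i
  · exact pd_subRe_zero s x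
  · have h := pd_algebraMap_coord j.succ j.succ x
    rw [if_pos rfl] at h
    simp only [halfGrad, Fin.cons_succ]
    rw [pd, fderiv_fun_neg, neg_apply]
    exact congrArg Neg.neg h

theorem contDiff_halfGrad (s : R6) (i : Fin 6) : ContDiff ℝ ∞ (fun y => halfGrad s y i) := by
  refine Fin.cases ?_ (fun j => ?_) i
  · exact contDiff_subRe_right s
  · exact (contDiff_algebraMap_coord j.succ).neg

theorem pd_vecPart (x : R6) (i : Fin 6) : pd i vecPart x = if i = 0 then 0 else gen i := by
  have : vecPart = fun y => ∑ j : Fin 5, algebraMap ℝ Cl5 (y j.succ) * gen j.succ := by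
    ext y
    simp only [vecPart, Algebra.smul_def]
  rw [this, pd_sum]
  · have hj : ∀ j : Fin 5, pd i (fun y => algebraMap ℝ Cl5 (y j.succ) * gen j.succ) x =
        if i = j.succ then gen j.succ else 0 := by
      intro j
      rw [pd_mul _ ((contDiff_algebraMap_coord j.succ).differentiable (by simp) x)
        (differentiableAt_const _), pd_algebraMap_coord, pd_const, mul_zero, add_zero]
      split_ifs <;> simp
    simp_rw [hj]
    refine Fin.cases ?_ (fun k => ?_) i
    · simp [(Fin.succ_ne_zero _).symm]
    · simp [Fin.succ_ne_zero]
  · intro j _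
    exact ((contDiff_algebraMap_coord j.succ).differentiable (by simp) x).mul_const _

theorem pd_subConj (s x : R6) (i : Fin 6) : pd i (subConj s) x = -genBar i := by
  have : subConj s = fun y => subRe s y + vecPart y := funext fun y => subConj_eq s y
  rw [this, pd_add _ ((contDiff_subRe_right s).differentiable (by simp) x)
    (contDiff_vecPart.differentiable (by simp) x), pd_vecPart]
  refine Fin.cases ?_ (fun j => ?_) i
  · rw [pd_subRe_zero, genBar_zero, if_pos rfl, add_zero]
  · rw [pd_subRe_succ, genBar_succ, if_neg (Fin.succ_ne_zero j), zero_add, neg_neg]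

theorem pd_Qc (s x : R6) (i : Fin 6) : pd i (Qc s) x = (-2 : ℝ) • halfGrad s x i := by
  have hQ : Qc s = fun y => subRe s y * subRe s y +
      ∑ j : Fin 5, algebraMap ℝ Cl5 (y j.succ) * algebraMap ℝ Cl5 (y j.succ) := by
    ext y
    rw [Qc_eq, sq, map_sum]
    simp only [sq, map_mul]
  have hr := (contDiff_subRe_right s).differentiable (by simp) x
  have hc : ∀ j : Fin 6, DifferentiableAt ℝ (fun y : R6 => algebraMap ℝ Cl5 (y j)) x := fun j =>
    (contDiff_algebraMap_coord j).differentiable (by simp) x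
  rw [hQ, pd_add _ (hr.fun_mul hr) (DifferentiableAt.fun_sum fun j _ => (hc _).fun_mul (hc _)),
    pd_sum _ _ fun j _ => (hc _).fun_mul (hc _), pd_mul _ hr hr]
  simp_rw [fun j : Fin 5 => pd_mul i (hc j.succ) (hc j.succ), pd_algebraMap_coord]
  refine Fin.cases ?_ (fun k => ?_) i
  · rw [pd_subRe_zero]
    simp only [(Fin.succ_ne_zero _).symm, if_false, halfGrad, Fin.cons_zero, neg_mul, one_mul,
      mul_neg, mul_one, zero_mul, mul_zero, add_zero, Finset.sum_const_zero]
    module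
  · rw [pd_subRe_succ]
    simp only [Fin.succ_inj, halfGrad, Fin.cons_succ, zero_mul, mul_zero, add_zero, zero_add,
      ite_mul, mul_ite, one_mul, mul_one, Finset.sum_add_distrib, Finset.sum_ite_eq,
      Finset.mem_univ, if_true]
    module

theorem sum_halfGrad_mul_self (s x : R6) : ∑ i, halfGrad s x i * halfGrad s x i = Qc s x := by
  rw [Fin.sum_univ_succ, Qc_eq, map_sum, sq]
  simp [halfGrad, sq]

theorem sum_gen_mul_halfGrad (s x : R6) :
    ∑ i, gen i * halfGrad s x i = subRe s x - vecPart x := by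
  rw [Fin.sum_univ_succ, gen_zero, one_mul, sub_eq_add_neg, vecPart, ← Finset.sum_neg_distrib]
  congr 1
  refine Finset.sum_congr rfl fun j _ => ?_
  simp only [halfGrad, Fin.cons_succ, mul_neg, Algebra.smul_def, Algebra.commutes]

theorem differentiableAt_Qinv (hx : x ∈ regularAt s) : DifferentiableAt ℝ (Qinv s) x :=
  differentiableAt_of_contDiffOn (isOpen_regularAt s) (contDiffOn_Qinv_right s) hx

/-- Differentiate 𝒬𝒬⁻¹ = 1 and move dᵢ past 𝒬⁻¹. -/
theorem pd_Qinv (hx : x ∈ regularAt s) (i : Fin 6) :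
    pd i (Qinv s) x = (2 : ℝ) • (halfGrad s x i * Qinv s x ^ 2) := by
  have hQ : DifferentiableAt ℝ (Qc s) x :=
    (contDiff_Qc.comp (f := fun x => (s, x)) (by fun_prop)).differentiable (by simp) x
  have h1 : pd i (fun y => Qc s y * Qinv s y) x = 0 := by
    rw [← pd_const i 1 x]
    exact pd_congr (isOpen_regularAt s) (fun y hy => Qc_mul_Qinv hy) i hx
  rw [pd_mul i hQ (differentiableAt_Qinv hx), pd_Qc] at h1
  have h2 : Qc s x * pd i (Qinv s) x = (2 : ℝ) • (halfGrad s x i * Qinv s x) := by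
    have := eq_neg_of_add_eq_zero_right h1
    rw [this, smul_mul_assoc, ← neg_smul, neg_neg]
  calc pd i (Qinv s) x = Qinv s x * (Qc s x * pd i (Qinv s) x) := by
        rw [← mul_assoc, Qinv_mul_Qc hx, one_mul]
    _ = _ := by
        rw [h2, mul_smul_comm, ← mul_assoc, ← (commute_halfGrad_Qinv hx i).eq, mul_assoc, sq]

theorem pd_Qinv_pow (hx : x ∈ regularAt s) (i : Fin 6) (k : ℕ) :
    pd i (fun y => Qinv s y ^ k) x =
      (2 * k : ℝ) • (halfGrad s x i * Qinv s x ^ (k + 1)) := by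
  induction k with
  | zero => simp [pd_const]
  | succ k ih =>
    simp_rw [pow_succ (Qinv s _) k]
    rw [pd_mul i ((differentiableAt_Qinv hx).fun_pow k) (differentiableAt_Qinv hx), ih, pd_Qinv hx,
      mul_smul_comm, smul_mul_assoc, mul_assoc, ← pow_succ, ← mul_assoc,
      ← ((commute_halfGrad_Qinv hx i).pow_right k).eq, mul_assoc, ← pow_add, ← add_smul]
    push_cast
    ring_nf

/-- With ∂ᵢdᵢ = -1 in six variables and Σ dᵢ² = 𝒬, the coefficient is -12k + 4k(k + 1) = 4k(k - 2).
Its zero at k = 2 is what makes Δ²𝒟 annihilate the Cauchy kernel. -/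
theorem lap_Qinv_pow (hx : x ∈ regularAt s) (k : ℕ) :
    lap (fun y => Qinv s y ^ k) x = (4 * k * (k - 2) : ℝ) • Qinv s x ^ (k + 1) := by
  have hV := isOpen_regularAt s
  rw [lap_eq_sum hV ((contDiffOn_Qinv_right s).pow k) hx]
  have hi : ∀ i, pd i (pd i fun y => Qinv s y ^ k) x = (-(2 * k) : ℝ) • Qinv s x ^ (k + 1) +
      (2 * k * (2 * (k + 1)) : ℝ) • ((halfGrad s x i * halfGrad s x i) * Qinv s x ^ (k + 2)) := by
    intro i
    have hg : DifferentiableAt ℝ (fun y => halfGrad s y i) x :=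
      (contDiff_halfGrad s i).differentiable (by simp) x
    have hR : DifferentiableAt ℝ (fun y => Qinv s y ^ (k + 1)) x :=
      (differentiableAt_Qinv hx).pow (k + 1)
    rw [pd_congr hV (fun y hy => pd_Qinv_pow hy i k) i hx, pd_const_smul _ _ (hg.fun_mul hR),
      pd_mul i hg hR, pd_halfGrad, pd_Qinv_pow hx, mul_smul_comm, ← mul_assoc, neg_one_mul]
    push_cast
    module
  simp_rw [hi, Finset.sum_add_distrib, ← Finset.smul_sum, ← Finset.sum_mul,
    sum_halfGrad_mul_self]
  rw [pow_succ' _ (k + 1), ← mul_assoc (Qc s x), Qc_mul_Qinv hx, one_mul]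
  simp only [Finset.sum_const, Finset.card_univ, Fintype.card_fin]
  module

theorem diracL_Qinv_pow (hx : x ∈ regularAt s) (k : ℕ) :
    diracL (fun y => Qinv s y ^ k) x =
      (2 * k : ℝ) • ((subRe s x - vecPart x) * Qinv s x ^ (k + 1)) := by
  simp_rw [diracL, pd_Qinv_pow hx, mul_smul_comm, ← Finset.smul_sum, ← mul_assoc,
    ← Finset.sum_mul, sum_gen_mul_halfGrad]

/-- `∑ eᵢ (s - x̄) dᵢ = 𝒬` for the components `dᵢ` of `-½ ∇ 𝒬`. -/
theorem sum_gen_mul_subConj_mul_halfGrad (s x : R6) :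
    ∑ i, gen i * (subConj s x * halfGrad s x i) = Qc s x := by
  rw [Fin.sum_univ_succ, gen_zero, one_mul]
  have : ∑ j : Fin 5, gen j.succ * (subConj s x * halfGrad s x j.succ) =
      -(vecPart x * subConj s x) := by
    rw [vecPart, Finset.sum_mul, ← Finset.sum_neg_distrib]
    refine Finset.sum_congr rfl fun j _ => ?_
    simp only [halfGrad, Fin.cons_succ]
    rw [mul_neg, mul_neg, ← Algebra.commutes, ← Algebra.smul_def, mul_smul_comm, smul_mul_assoc]
  -- With r = s - x₀ and v the vector part of x, the sum is (r + v)r - v(r + v) = r² - v². The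
  -- products vr cancel although v and r need not commute.
  rw [this, Qc_eq, subConj_eq]
  simp only [halfGrad, Fin.cons_zero]
  rw [add_mul, mul_add, vecPart_mul_self, sq]
  abel

/-- The Dirac operator of `(s - x̄) g` for `g` with gradient `l e₀ + h d`, where `d = -½ ∇ 𝒬`. -/
theorem diracL_subConj_mul {g : R6 → Cl5} {l h : Cl5} (hg : DifferentiableAt ℝ g x)
    (hpd : ∀ i, pd i g x = (if i = 0 then l else 0) + halfGrad s x i * h) :
    diracL (fun y => subConj s y * g y) x =
      (-6 : ℝ) • g x + subConj s x * l + Qc s x * h := by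
  have ha : DifferentiableAt ℝ (subConj s) x :=
    (contDiff_subConj_right s).differentiable (by simp) x
  simp_rw [diracL, pd_mul _ ha hg, pd_subConj, hpd, mul_add, neg_mul, mul_neg, ← mul_assoc,
    gen_mul_genBar_self, one_mul, Finset.sum_add_distrib, mul_assoc]
  have h3 : ∑ i, gen i * (subConj s x * (halfGrad s x i * h)) = Qc s x * h := by
    rw [← sum_gen_mul_subConj_mul_halfGrad, Finset.sum_mul]
    simp only [mul_assoc]
  rw [h3]
  have h4 : ∑ i : Fin 6, gen i * (subConj s x * if i = 0 then l else 0) = subConj s x * l := by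
    simp [gen_zero]
  rw [h4]
  simp only [Finset.sum_const, Finset.card_univ, Fintype.card_fin]
  module

end

section

/-! ### Explicit form of the left kernels -/

variable {s x : R6} {f g : R6 → Cl5}

theorem diracL_const_smul (c : ℝ) (hg : DifferentiableAt ℝ g x) :
    diracL (fun y => c • g y) x = c • diracL g x := by
  simp_rw [diracL, pd_const_smul c _ hg, mul_smul_comm, Finset.smul_sum]

theorem diracL_add (hf : DifferentiableAt ℝ f x) (hg : DifferentiableAt ℝ g x) :
    diracL (fun y => f y + g y) x = diracL f x + diracL g x := by
  simp_rw [diracL, pd_add _ hf hg, mul_add, Finset.sum_add_distrib]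

theorem lap_const_smul (c : ℝ) (hg : ContDiffAt ℝ ∞ g x) :
    lap (fun y => c • g y) x = c • lap g x :=
  InnerProductSpace.laplacian_smul c (hg.of_le (by simpa using ENat.LEInfty.out))

theorem cauchyL_eq (s : R6) : cauchyL s = fun y => subConj s y * Qinv s y := rfl

theorem differentiableAt_subConj (s x : R6) : DifferentiableAt ℝ (subConj s) x :=
  (contDiff_subConj_right s).differentiable (by simp) x

theorem differentiableAt_subRe (s x : R6) : DifferentiableAt ℝ (subRe s) x :=
  (contDiff_subRe_right s).differentiable (by simp) x

theorem commute_subRe_halfGrad (s x : R6) (i : Fin 6) :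
    Commute (subRe s x) (halfGrad s x i) := by
  refine Fin.cases ?_ (fun j => ?_) i
  · exact Commute.refl _
  · exact Commute.neg_right (Algebra.commutes _ _).symm

theorem halfGrad_zero (s x : R6) : halfGrad s x 0 = subRe s x := rfl

theorem Qc_mul_Qinv_pow (hx : x ∈ regularAt s) (k : ℕ) :
    Qc s x * Qinv s x ^ (k + 1) = Qinv s x ^ k := by
  rw [pow_succ', ← mul_assoc, Qc_mul_Qinv hx, one_mul]

theorem pd_subRe_mul_Qinv_sq (hx : x ∈ regularAt s) (i : Fin 6) :
    pd i (fun y => subRe s y * Qinv s y ^ 2) x = (if i = 0 then -Qinv s x ^ 2 else 0) +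
      halfGrad s x i * ((4 : ℝ) • (subRe s x * Qinv s x ^ 3)) := by
  rw [pd_mul i (differentiableAt_subRe s x) ((differentiableAt_Qinv hx).fun_pow 2),
    pd_Qinv_pow hx, mul_smul_comm, ← mul_assoc, (commute_subRe_halfGrad s x i).eq, mul_assoc,
    mul_smul_comm]
  congr 1
  · refine Fin.cases ?_ (fun j => ?_) i
    · rw [pd_subRe_zero, if_pos rfl, neg_one_mul]
    · rw [pd_subRe_succ, if_neg (Fin.succ_ne_zero j), zero_mul]
  · norm_num

/-- The factor s - x̄ contributes -Σ eᵢēᵢ = -6 and the factor 𝒬⁻¹ contributes 𝒬 · 2𝒬⁻² = 2𝒬⁻¹. -/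
theorem diracL_cauchyL (s : R6) :
    EqOn (diracL (cauchyL s)) (fun y => (-4 : ℝ) • Qinv s y) (regularAt s) := by
  intro x hx
  rw [cauchyL_eq, diracL_subConj_mul (l := 0) (h := (2 : ℝ) • Qinv s x ^ 2)
    (differentiableAt_Qinv hx) fun i => ?_]
  · rw [mul_smul_comm, Qc_mul_Qinv_pow hx 1, mul_zero, pow_one]
    module
  · rw [pd_Qinv hx, ite_self, zero_add, mul_smul_comm]

theorem diracL_Qinv (hx : x ∈ regularAt s) :
    diracL (Qinv s) x = (2 : ℝ) • ((subRe s x - vecPart x) * Qinv s x ^ 2) := by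
  simpa using diracL_Qinv_pow hx 1

theorem diracL_diracL_cauchyL (hx : x ∈ regularAt s) :
    diracL (diracL (cauchyL s)) x = (-8 : ℝ) • ((subRe s x - vecPart x) * Qinv s x ^ 2) := by
  rw [diracL_congr (isOpen_regularAt s) (diracL_cauchyL s) hx,
    diracL_const_smul _ (differentiableAt_Qinv hx), diracL_Qinv hx, smul_smul]
  norm_num

theorem diracBarL_cauchyL (s : R6) : EqOn (diracBarL (cauchyL s))
    (fun y => (4 : ℝ) • (subConj s y * (subRe s y * Qinv s y ^ 2)) + (2 : ℝ) • Qinv s y)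
    (regularAt s) := by
  intro x hx
  rw [diracBarL_eq, diracL_cauchyL s hx, cauchyL_eq, pd_mul _ (differentiableAt_subConj s x)
    (differentiableAt_Qinv hx), pd_subConj, pd_Qinv hx, genBar_zero, halfGrad_zero, neg_one_mul,
    mul_smul_comm]
  module

/-- With a = s - x̄ and r = s - x₀, the operator 𝒟̄ sends 4ar𝒬⁻² to 32ar²𝒬⁻³ - 4a𝒬⁻² and 2𝒬⁻¹ to
4a𝒬⁻², so the terms of order 𝒬⁻² cancel. -/
theorem diracBarL_diracBarL_cauchyL (hx : x ∈ regularAt s) :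
    diracBarL (diracBarL (cauchyL s)) x =
      (32 : ℝ) • (subConj s x * (subRe s x * (subRe s x * Qinv s x ^ 3))) := by
  have hR2 : DifferentiableAt ℝ (fun y => Qinv s y ^ 2) x := (differentiableAt_Qinv hx).fun_pow 2
  have hg : DifferentiableAt ℝ (fun y => subRe s y * Qinv s y ^ 2) x :=
    (differentiableAt_subRe s x).fun_mul hR2
  have hag : DifferentiableAt ℝ (fun y => subConj s y * (subRe s y * Qinv s y ^ 2)) x :=
    (differentiableAt_subConj s x).fun_mul hg
  rw [diracBarL_congr (isOpen_regularAt s) (diracBarL_cauchyL s) hx, diracBarL_eq,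
    pd_add _ (hag.fun_const_smul _) ((differentiableAt_Qinv hx).fun_const_smul _),
    diracL_add (hag.fun_const_smul _) ((differentiableAt_Qinv hx).fun_const_smul _),
    pd_const_smul _ _ hag, pd_const_smul _ _ (differentiableAt_Qinv hx),
    diracL_const_smul _ hag, diracL_const_smul _ (differentiableAt_Qinv hx),
    diracL_subConj_mul hg (pd_subRe_mul_Qinv_sq hx), diracL_Qinv hx, pd_Qinv hx,
    pd_mul _ (differentiableAt_subConj s x) hg, pd_subRe_mul_Qinv_sq hx, pd_subConj,
    genBar_zero, halfGrad_zero, if_pos rfl, neg_one_mul]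
  have h1 : Qc s x * ((4 : ℝ) • (subRe s x * Qinv s x ^ 3)) =
      (4 : ℝ) • (subRe s x * Qinv s x ^ 2) := by
    rw [mul_smul_comm, ← mul_assoc, ← (commute_subRe_Qc s x).eq, mul_assoc, Qc_mul_Qinv_pow hx 2]
  rw [h1]
  simp only [subConj_eq, add_mul, sub_mul, mul_add, mul_neg, mul_smul_comm]
  module

/-- Since Δ = 𝒟̄𝒟, this is -4𝒟̄𝒬⁻¹, and 𝒟̄𝒬⁻¹ = 2(s - x̄)𝒬⁻² follows from 𝒟̄ = 2∂₀ - 𝒟. -/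
theorem lap_cauchyL (s : R6) : EqOn (lap (cauchyL s))
    (fun y => (-8 : ℝ) • (subConj s y * Qinv s y ^ 2)) (regularAt s) := by
  intro x hx
  have hR := differentiableAt_Qinv hx
  rw [← diracBarL_diracL (isOpen_regularAt s) (contDiffOn_cauchyL s) hx,
    diracBarL_congr (isOpen_regularAt s) (diracL_cauchyL s) hx, diracBarL_eq,
    pd_const_smul _ _ hR, diracL_const_smul _ hR, diracL_Qinv hx, pd_Qinv hx, halfGrad_zero]
  simp only [subConj_eq, add_mul, sub_mul]
  module

/-- It is simpler to apply 𝒟̄ to Δ S_L⁻¹ = -8(s - x̄)𝒬⁻². Both 𝒟 and 2∂₀ of (s - x̄)𝒬⁻² contain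
-2𝒬⁻², which disappears in the difference. -/
theorem lap_diracBarL_cauchyL (hx : x ∈ regularAt s) :
    lap (diracBarL (cauchyL s)) x =
      (-64 : ℝ) • (subConj s x * (subRe s x * Qinv s x ^ 3)) := by
  have hR2 : DifferentiableAt ℝ (fun y => Qinv s y ^ 2) x := (differentiableAt_Qinv hx).fun_pow 2
  have ha2 : DifferentiableAt ℝ (fun y => subConj s y * Qinv s y ^ 2) x :=
    (differentiableAt_subConj s x).fun_mul hR2
  have hD : diracL (fun y => subConj s y * Qinv s y ^ 2) x = (-2 : ℝ) • Qinv s x ^ 2 := by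
    rw [diracL_subConj_mul (l := 0) (h := (4 : ℝ) • Qinv s x ^ 3) hR2 fun i => ?_]
    · rw [mul_smul_comm, Qc_mul_Qinv_pow hx 2, mul_zero]
      module
    · rw [pd_Qinv_pow hx, ite_self, zero_add, mul_smul_comm]
      norm_num
  rw [← diracBarL_lap (isOpen_regularAt s) (contDiffOn_cauchyL s) hx,
    diracBarL_congr (isOpen_regularAt s) (lap_cauchyL s) hx, diracBarL_eq,
    pd_const_smul _ _ ha2, diracL_const_smul _ ha2, hD, pd_mul _ (differentiableAt_subConj s x) hR2,
    pd_Qinv_pow hx, pd_subConj, genBar_zero, halfGrad_zero, neg_one_mul, mul_smul_comm]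
  push_cast
  module

theorem lap_diracL_cauchyL (s : R6) : EqOn (lap (diracL (cauchyL s)))
    (fun y => (16 : ℝ) • Qinv s y ^ 2) (regularAt s) := by
  intro x hx
  have h1 : lap (Qinv s) x = (-4 : ℝ) • Qinv s x ^ 2 := by
    have := lap_Qinv_pow hx 1
    simp only [pow_one] at this
    rw [this]
    norm_num
  rw [lap_congr (isOpen_regularAt s) (diracL_cauchyL s) hx, lap_const_smul _
    ((contDiffOn_Qinv_right s).contDiffAt ((isOpen_regularAt s).mem_nhds hx)), h1, smul_smul]
  norm_num

/-- Δ𝒟S_L⁻¹ is a multiple of 𝒬⁻², which is harmonic by the zero of 4k(k - 2) at k = 2. -/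
theorem lap_lap_diracL_cauchyL (hx : x ∈ regularAt s) :
    lap (lap (diracL (cauchyL s))) x = 0 := by
  rw [lap_congr (isOpen_regularAt s) (lap_diracL_cauchyL s) hx, lap_const_smul _
    (((contDiffOn_Qinv_right s).pow 2).contDiffAt ((isOpen_regularAt s).mem_nhds hx)),
    lap_Qinv_pow hx 2]
  norm_num

end

section

/-! ### Integrals that depend on a parameter -/

/-- Kernels that are smooth in both variables on the regular pairs. -/
def SmoothKernel (k : R6 → R6 → Cl5) : Prop :=
  ContDiffOn ℝ ∞ (fun p : R6 × R6 => k p.1 p.2) regularPairs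

/-- Finitely many curves `σ j` with integrable weights, such that `(σ j t, x)` is regular for all
`x ∈ V`. -/
structure IsKernelCycle (V : Set R6) {m : ℕ} (σ : Fin m → ℝ → R6) (w : Fin m → ℝ → Cl5) :
    Prop where
  isOpen : IsOpen V
  continuousOn : ∀ j, ContinuousOn (σ j) (Icc 0 1)
  integrable : ∀ j, IntervalIntegrable (w j) volume 0 1
  regular : ∀ j, ∀ t ∈ Icc (0 : ℝ) 1, ∀ x ∈ V, (σ j t, x) ∈ regularPairs

/-- The integral `∑ ∫ k(σ, x) w`. -/
def cycleIntegral {m : ℕ} (σ : Fin m → ℝ → R6) (w : Fin m → ℝ → Cl5) (k : R6 → R6 → Cl5)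
    (x : R6) : Cl5 :=
  ∑ j, ∫ t in (0 : ℝ)..1, k (σ j t) x * w j t

/-- The derivative of a kernel with respect to the second variable. -/
def kernelDeriv (k : R6 → R6 → Cl5) (p : R6 × R6) : R6 →L[ℝ] Cl5 :=
  (fderiv ℝ (fun p : R6 × R6 => k p.1 p.2) p).comp (ContinuousLinearMap.inr ℝ R6 R6)

variable {k : R6 → R6 → Cl5} {V : Set R6} {m : ℕ} {σ : Fin m → ℝ → R6} {w : Fin m → ℝ → Cl5}
  {x : R6}

theorem SmoothKernel.contDiffOn_kernelDeriv (hk : SmoothKernel k) :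
    ContDiffOn ℝ ∞ (kernelDeriv k) regularPairs :=
  (hk.fderiv_of_isOpen isOpen_regularPairs (m := ∞) (by simp)).clm_comp contDiffOn_const

theorem SmoothKernel.hasFDerivAt (hk : SmoothKernel k) {p : R6 × R6} (hp : p ∈ regularPairs) :
    HasFDerivAt (k p.1) (kernelDeriv k p) p.2 := by
  have h1 : HasFDerivAt (fun p : R6 × R6 => k p.1 p.2) _ (p.1, p.2) :=
    ((hk.differentiableOn (by simp)).differentiableAt (isOpen_regularPairs.mem_nhds hp)).hasFDerivAt
  exact h1.comp p.2 (hasFDerivAt_prodMk_right p.1 p.2)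

theorem SmoothKernel.fderiv_apply (hk : SmoothKernel k) (v : R6) :
    SmoothKernel fun s x => fderiv ℝ (k s) x v := by
  refine ContDiffOn.congr (f := fun p => kernelDeriv k p v)
    (hk.contDiffOn_kernelDeriv.clm_apply contDiffOn_const) fun p hp => ?_
  simp only [(hk.hasFDerivAt hp).fderiv]

theorem SmoothKernel.pd (hk : SmoothKernel k) (i : Fin 6) :
    SmoothKernel fun s => FineStructure.pd i (k s) := hk.fderiv_apply _

theorem SmoothKernel.congr (hk : SmoothKernel k) {k' : R6 → R6 → Cl5}
    (h : ∀ p ∈ regularPairs, k' p.1 p.2 = k p.1 p.2) : SmoothKernel k' :=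
  ContDiffOn.congr hk h

theorem SmoothKernel.contDiffOn_right (hk : SmoothKernel k) (s : R6) :
    ContDiffOn ℝ ∞ (k s) (regularAt s) :=
  ContDiffOn.comp (f := fun x => (s, x)) hk (by fun_prop) fun _ hx => hx

/-! ### Differentiation under the integral sign -/

theorem IsKernelCycle.continuousOn_comp (h : IsKernelCycle V σ w) {E : Type*} [TopologicalSpace E]
    {F : R6 × R6 → E} (hF : ContinuousOn F regularPairs) (j : Fin m) (hx : x ∈ V) :
    ContinuousOn (fun t => F (σ j t, x)) (Icc 0 1) :=
  hF.comp ((h.continuousOn j).prodMk continuousOn_const) fun t ht => h.regular j t ht x hx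

theorem IsKernelCycle.intervalIntegrable (h : IsKernelCycle V σ w) (hk : SmoothKernel k)
    (j : Fin m) (hx : x ∈ V) :
    IntervalIntegrable (fun t => k (σ j t) x * w j t) volume 0 1 := by
  refine (h.integrable j).continuousOn_mul ?_
  rw [uIcc_of_le zero_le_one]
  exact h.continuousOn_comp (F := fun p => k p.1 p.2) hk.continuousOn j hx

theorem IsKernelCycle.cycleIntegral_congr (h : IsKernelCycle V σ w) {k' : R6 → R6 → Cl5}
    (hkk : ∀ p ∈ regularPairs, k p.1 p.2 = k' p.1 p.2) :
    EqOn (cycleIntegral σ w k) (cycleIntegral σ w k') V := by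
  intro x hx
  refine Finset.sum_congr rfl fun j _ => intervalIntegral.integral_congr fun t ht => ?_
  rw [uIcc_of_le zero_le_one] at ht
  simp only [hkk _ (h.regular j t ht x hx)]

theorem IsKernelCycle.cycleIntegral_sum (h : IsKernelCycle V σ w) {ι : Type*} (s : Finset ι)
    (a : ι → Cl5) {k : ι → R6 → R6 → Cl5} (hk : ∀ i, SmoothKernel (k i)) (hx : x ∈ V) :
    cycleIntegral σ w (fun y z => ∑ i ∈ s, a i * k i y z) x =
      ∑ i ∈ s, a i * cycleIntegral σ w (k i) x := by
  simp only [cycleIntegral, Finset.mul_sum]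
  rw [Finset.sum_comm]
  refine Finset.sum_congr rfl fun j _ => ?_
  simp only [Finset.sum_mul, mul_assoc]
  rw [intervalIntegral.integral_finsetSum]
  · refine Finset.sum_congr rfl fun i _ => ?_
    exact (ContinuousLinearMap.mul ℝ Cl5 (a i)).intervalIntegral_comp_comm
      (h.intervalIntegrable (hk i) j hx)
  · intro i _
    exact (h.intervalIntegrable (hk i) j hx).continuousOn_mul continuousOn_const

theorem IsKernelCycle.hasFDerivAt_integral (h : IsKernelCycle V σ w) (hk : SmoothKernel k)
    (j : Fin m) (hx : x ∈ V) :
    ∃ L : R6 →L[ℝ] Cl5, HasFDerivAt (fun y => ∫ t in (0 : ℝ)..1, k (σ j t) y * w j t) L x ∧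
      ∀ v, L v = ∫ t in (0 : ℝ)..1, fderiv ℝ (k (σ j t)) x v * w j t := by
  have hsub : uIoc (0 : ℝ) 1 ⊆ Icc 0 1 := by
    rw [uIoc_of_le zero_le_one]; exact Ioc_subset_Icc_self
  set B := (ContinuousLinearMap.mul ℝ Cl5).flip with hB
  obtain ⟨r, hr, hrV⟩ := nhds_basis_closedBall.mem_iff.1 (h.isOpen.mem_nhds hx)
  have hcont : ContinuousOn (fun q : ℝ × R6 => kernelDeriv k (σ j q.1, q.2))
      (Icc 0 1 ×ˢ closedBall x r) := by
    refine hk.contDiffOn_kernelDeriv.continuousOn.comp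
      (ContinuousOn.prodMk ?_ continuousOn_snd) fun q hq => h.regular j q.1 hq.1 q.2 (hrV hq.2)
    exact (h.continuousOn j).comp continuousOn_fst fun q hq => hq.1
  -- The kernel derivative is bounded uniformly in t and in y near x, so the merely integrable
  -- weight, up to a constant, dominates.
  obtain ⟨C, hC⟩ := (isCompact_Icc.prod (isCompact_closedBall x r)).exists_bound_of_continuousOn
    hcont
  set F' : R6 → ℝ → R6 →L[ℝ] Cl5 := fun y t => (B (w j t)).comp (kernelDeriv k (σ j t, y)) with hF'
  have hmeas : AEStronglyMeasurable (F' x) (volume.restrict (uIoc (0 : ℝ) 1)) := by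
    have h1 : AEStronglyMeasurable (fun t => B (w j t)) (volume.restrict (uIoc (0 : ℝ) 1)) :=
      B.continuous.comp_aestronglyMeasurable
        (intervalIntegrable_iff.1 (h.integrable j)).aestronglyMeasurable
    have h2 : AEStronglyMeasurable (fun t => kernelDeriv k (σ j t, x))
        (volume.restrict (uIoc (0 : ℝ) 1)) :=
      ((h.continuousOn_comp hk.contDiffOn_kernelDeriv.continuousOn j hx).aestronglyMeasurable
        measurableSet_Icc).mono_set hsub
    exact (isBoundedBilinearMap_comp (𝕜 := ℝ) (E := R6) (F := Cl5)
      (G := Cl5)).continuous.comp_aestronglyMeasurable (h1.prodMk h2)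
  have hbound : ∀ t ∈ uIoc (0 : ℝ) 1, ∀ y ∈ closedBall x r, ‖F' y t‖ ≤ ‖B‖ * ‖w j t‖ * C := by
    intro t ht y hy
    refine (ContinuousLinearMap.opNorm_comp_le _ _).trans ?_
    gcongr
    · exact B.le_opNorm _
    · exact hC (t, y) ⟨hsub ht, hy⟩
  have hbd : IntervalIntegrable (fun t => ‖B‖ * ‖w j t‖ * C) volume 0 1 :=
    ((h.integrable j).norm.const_mul _).mul_const _
  have hF'int : IntervalIntegrable (F' x) volume 0 1 := by
    refine hbd.mono_fun hmeas ?_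
    refine (ae_restrict_iff' measurableSet_uIoc).2 (Eventually.of_forall fun t ht => ?_)
    exact (hbound t ht x (mem_closedBall_self hr.le)).trans (le_abs_self _)
  refine ⟨∫ t in (0 : ℝ)..1, F' x t,
    intervalIntegral.hasFDerivAt_integral_of_dominated_of_fderiv_le
      (F := fun y t => k (σ j t) y * w j t) (F' := F') (closedBall_mem_nhds x hr) ?_
      (h.intervalIntegrable hk j hx) hmeas (Eventually.of_forall hbound) hbd
      (Eventually.of_forall fun t ht y hy => ?_), fun v => ?_⟩
  · filter_upwards [h.isOpen.mem_nhds hx] with y hy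
    exact (intervalIntegrable_iff.1 (h.intervalIntegrable hk j hy)).aestronglyMeasurable
  · exact (B (w j t)).hasFDerivAt.comp y (hk.hasFDerivAt (h.regular j t (hsub ht) y (hrV hy)))
  · rw [ContinuousLinearMap.intervalIntegral_apply hF'int]
    refine intervalIntegral.integral_congr fun t ht => ?_
    rw [uIcc_of_le zero_le_one] at ht
    simp only [(hk.hasFDerivAt (h.regular j t ht x hx)).fderiv]
    rfl

theorem IsKernelCycle.differentiableAt (h : IsKernelCycle V σ w) (hk : SmoothKernel k)
    (hx : x ∈ V) : DifferentiableAt ℝ (cycleIntegral σ w k) x :=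
  DifferentiableAt.fun_sum fun j _ =>
    (h.hasFDerivAt_integral hk j hx).choose_spec.1.differentiableAt

theorem IsKernelCycle.fderiv_apply (h : IsKernelCycle V σ w) (hk : SmoothKernel k) (hx : x ∈ V)
    (v : R6) : fderiv ℝ (cycleIntegral σ w k) x v =
      cycleIntegral σ w (fun s y => fderiv ℝ (k s) y v) x := by
  choose L hL hLv using fun j => h.hasFDerivAt_integral hk j hx
  have : HasFDerivAt (cycleIntegral σ w k) (∑ j, L j) x := HasFDerivAt.fun_sum fun j _ => hL j
  rw [this.fderiv, sum_apply]
  exact Finset.sum_congr rfl fun j _ => hLv j v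

/-- Each directional derivative is again an integral of the same type, with a smooth kernel, so
smoothness follows by induction on the order. -/
theorem IsKernelCycle.contDiffOn (h : IsKernelCycle V σ w) (hk : SmoothKernel k) :
    ContDiffOn ℝ ∞ (cycleIntegral σ w k) V := by
  rw [contDiffOn_infty]
  intro n
  induction n generalizing k with
  | zero =>
    exact contDiffOn_zero.2 fun x hx => (h.differentiableAt hk hx).continuousAt.continuousWithinAt
  | succ n ih =>
    refine contDiffOn_succ_of_fderiv_apply
      (fun x hx => (h.differentiableAt hk hx).differentiableWithinAt)
      (fun e => absurd e (WithTop.natCast_ne_top n)) fun v => ?_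
    refine (ih (hk.fderiv_apply v)).congr fun x hx => ?_
    rw [fderivWithin_of_isOpen h.isOpen hx, h.fderiv_apply hk hx]

theorem IsKernelCycle.pd_cycleIntegral (h : IsKernelCycle V σ w) (hk : SmoothKernel k)
    (i : Fin 6) : EqOn (pd i (cycleIntegral σ w k)) (cycleIntegral σ w fun s => pd i (k s)) V :=
  fun _ hx => h.fderiv_apply hk hx _

/-- An operator that can be interchanged with the integration of smooth kernels. -/
structure IsKernelOp (T : (R6 → Cl5) → (R6 → Cl5)) : Prop where
  congr : ∀ {V : Set R6} {f g : R6 → Cl5}, IsOpen V → EqOn f g V → EqOn (T f) (T g) V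
  smooth : ∀ {k : R6 → R6 → Cl5}, SmoothKernel k → SmoothKernel fun s => T (k s)
  comm : ∀ {V : Set R6} {m : ℕ} {σ : Fin m → ℝ → R6} {w : Fin m → ℝ → Cl5} {k : R6 → R6 → Cl5},
    IsKernelCycle V σ w → SmoothKernel k →
      EqOn (T (cycleIntegral σ w k)) (cycleIntegral σ w fun s => T (k s)) V

theorem IsKernelOp.comp {S T : (R6 → Cl5) → (R6 → Cl5)} (hS : IsKernelOp S) (hT : IsKernelOp T) :
    IsKernelOp fun g => S (T g) where
  congr hV h := hS.congr hV (hT.congr hV h)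
  smooth hk := hS.smooth (hT.smooth hk)
  comm h hk := (hS.congr h.isOpen (hT.comm h hk)).trans (hS.comm h (hT.smooth hk))

theorem SmoothKernel.sum_mul {ι : Type*} (s : Finset ι) (a : ι → Cl5) {k : ι → R6 → R6 → Cl5}
    (hk : ∀ i, SmoothKernel (k i)) : SmoothKernel fun y z => ∑ i ∈ s, a i * k i y z :=
  ContDiffOn.sum fun i _ => contDiffOn_const.mul (hk i)

theorem isKernelOp_diracL : IsKernelOp diracL where
  congr := diracL_congr
  smooth hk := SmoothKernel.sum_mul _ gen hk.pd
  comm h hk := fun x hx => by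
    rw [diracL]
    simp_rw [h.pd_cycleIntegral hk _ hx]
    exact (h.cycleIntegral_sum _ gen hk.pd hx).symm

theorem isKernelOp_diracBarL : IsKernelOp diracBarL where
  congr := diracBarL_congr
  smooth hk := SmoothKernel.sum_mul _ genBar hk.pd
  comm h hk := fun x hx => by
    rw [diracBarL]
    simp_rw [h.pd_cycleIntegral hk _ hx]
    exact (h.cycleIntegral_sum _ genBar hk.pd hx).symm

theorem SmoothKernel.lap_eq (hk : SmoothKernel k) {p : R6 × R6} (hp : p ∈ regularPairs) :
    lap (k p.1) p.2 = ∑ i, 1 * FineStructure.pd i (FineStructure.pd i (k p.1)) p.2 := by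
  simp only [one_mul]
  exact lap_eq_sum (isOpen_regularAt p.1) (hk.contDiffOn_right p.1) hp

theorem isKernelOp_lap : IsKernelOp lap where
  congr := lap_congr
  smooth hk := (SmoothKernel.sum_mul _ (fun _ => 1) fun i => (hk.pd i).pd i).congr
    fun _ hp => hk.lap_eq hp
  comm {V m σ w k} h hk := fun x hx => by
    rw [h.cycleIntegral_congr (k' := fun y z => ∑ i, 1 * pd i (pd i (k y)) z)
        (fun _ hp => hk.lap_eq hp) hx,
      h.cycleIntegral_sum _ (fun _ => 1) (fun i => (hk.pd i).pd i) hx,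
      lap_eq_sum h.isOpen (h.contDiffOn hk) hx]
    refine Finset.sum_congr rfl fun i _ => ?_
    rw [pd_congr h.isOpen (h.pd_cycleIntegral hk i) i hx, h.pd_cycleIntegral (hk.pd i) i hx,
      one_mul]

theorem smoothKernel_cauchyL : SmoothKernel cauchyL := contDiffOn_cauchyL_prod

end

section

/-! ### The slices `ℂ_J` -/

theorem para_add (x y : R6) : para (x + y) = para x + para y := by
  simp [para, add_smul, Finset.sum_add_distrib]

theorem para_smul (c : ℝ) (x : R6) : para (c • x) = c • para x := by
  simp [para, mul_smul, Finset.smul_sum]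

theorem para_single_zero : para (EuclideanSpace.single 0 1) = 1 := by
  simp [para, gen_zero]

theorem para_slicePt (J : R6) (u v : ℝ) :
    para (slicePt J u v) = algebraMap ℝ Cl5 u + v • para J := by
  rw [slicePt, para_add, para_smul, para_smul, para_single_zero, Algebra.algebraMap_eq_smul_one]

variable {J : R6}

theorem para_eq_vecPart (hJ : J ∈ imagSphere) : para J = vecPart J := by
  rw [para_eq, hJ.1, map_zero, zero_add]

theorem para_mul_self (hJ : J ∈ imagSphere) : para J * para J = -1 := by
  have h := norm_sq_eq J
  rw [hJ.1, hJ.2] at h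
  rw [para_eq_vecPart hJ, vecPart_mul_self]
  have : ∑ i : Fin 5, J i.succ ^ 2 = 1 := by linarith
  rw [this, map_one]

theorem slicePt_zero (hJ : J ∈ imagSphere) (u v : ℝ) : slicePt J u v 0 = u := by
  simp [slicePt, hJ.1]

theorem vecPart_slicePt (hJ : J ∈ imagSphere) (u v : ℝ) :
    vecPart (slicePt J u v) = v • para J := by
  have h := para_eq (slicePt J u v)
  rw [para_slicePt, slicePt_zero hJ] at h
  exact (add_left_cancel h).symm

theorem neg_mem_imagSphere (hJ : J ∈ imagSphere) : -J ∈ imagSphere := by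
  refine ⟨?_, ?_⟩
  · simp [hJ.1]
  · rw [norm_neg, hJ.2]

theorem slicePt_neg (J : R6) (u v : ℝ) : slicePt (-J) u v = slicePt J u (-v) := by
  simp [slicePt]

/-- The modulus of the vector part. -/
def vecNorm (x : R6) : ℝ := ‖x - x 0 • EuclideanSpace.single 0 1‖

theorem continuous_vecNorm : Continuous vecNorm := by
  unfold vecNorm
  fun_prop

theorem vecNorm_sq (x : R6) : vecNorm x ^ 2 = ∑ i : Fin 5, x i.succ ^ 2 := by
  rw [vecNorm, norm_sq_eq]
  simp

theorem exists_imagUnit (x : R6) : ∃ I ∈ imagSphere, x = slicePt I (x 0) (vecNorm x) := by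
  by_cases h : vecNorm x = 0
  -- A real point lies on every plane ℂ_I, so any unit serves.
  · refine ⟨EuclideanSpace.single 1 1, ⟨by simp, by simp⟩, ?_⟩
    rw [h, slicePt, zero_smul, add_zero]
    exact sub_eq_zero.1 (norm_eq_zero.1 h)
  · refine ⟨(vecNorm x)⁻¹ • (x - x 0 • EuclideanSpace.single 0 1), ⟨by simp, ?_⟩, ?_⟩
    · rw [norm_smul, norm_inv, Real.norm_of_nonneg (show 0 ≤ vecNorm x from norm_nonneg _)]
      exact inv_mul_cancel₀ h
    · rw [slicePt, smul_smul, mul_inv_cancel₀ h, one_smul]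
      abel

/-- The embedding of the algebra `ℂ` onto `ℂ_J`. -/
def sliceHom (hJ : J ∈ imagSphere) : ℂ →ₐ[ℝ] Cl5 := Complex.lift ⟨para J, para_mul_self hJ⟩

theorem sliceHom_apply (hJ : J ∈ imagSphere) (z : ℂ) : sliceHom hJ z = para (toSlice J z) := by
  rw [toSlice, para_slicePt]
  simp [sliceHom, Complex.lift, Complex.liftAux_apply]

theorem sliceHom_I (hJ : J ∈ imagSphere) : sliceHom hJ Complex.I = para J := by
  rw [sliceHom_apply, toSlice, para_slicePt]
  simp

theorem sliceHom_ofReal (hJ : J ∈ imagSphere) (r : ℝ) : sliceHom hJ r = algebraMap ℝ Cl5 r := by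
  exact (sliceHom hJ).commutes r

/-- The embedding of `ℂ` onto `ℂ_J` as a continuous linear map. -/
def sliceCLM (hJ : J ∈ imagSphere) : ℂ →L[ℝ] Cl5 := (sliceHom hJ).toLinearMap.toContinuousLinearMap

theorem sliceCLM_apply (hJ : J ∈ imagSphere) (z : ℂ) : sliceCLM hJ z = sliceHom hJ z := rfl

theorem continuous_toSlice (J : R6) : Continuous (toSlice J) := by
  unfold toSlice slicePt
  fun_prop

/-- `(ζ - x₀)² + |x̲|²`, the value of `𝒬` in the slice. -/
def sliceQ (ζ : ℂ) (x : R6) : ℂ := (ζ - x 0) ^ 2 + (vecNorm x : ℂ) ^ 2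

theorem subRe_toSlice (hJ : J ∈ imagSphere) (ζ : ℂ) (x : R6) :
    subRe (toSlice J ζ) x = sliceHom hJ (ζ - x 0) := by
  rw [subRe, map_sub, sliceHom_apply, sliceHom_ofReal]

/-- For s in ℂ_J the element 𝒬 depends on x only through real numbers, so it lies in the field ℂ_J.
Its invertibility thus follows from the nonvanishing of a complex number. -/
theorem Qc_toSlice (hJ : J ∈ imagSphere) (ζ : ℂ) (x : R6) :
    Qc (toSlice J ζ) x = sliceHom hJ (sliceQ ζ x) := by
  rw [Qc_eq, subRe_toSlice hJ, ← vecNorm_sq, sliceQ, map_add, map_pow, ← sliceHom_ofReal hJ]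
  simp

theorem mem_regularPairs_toSlice (hJ : J ∈ imagSphere) {ζ : ℂ} {x : R6} (h : sliceQ ζ x ≠ 0) :
    (toSlice J ζ, x) ∈ regularPairs := by
  change IsUnit (Qc (toSlice J ζ) x)
  rw [Qc_toSlice hJ]
  exact (Ne.isUnit h).map (sliceHom hJ)

theorem Qinv_toSlice (hJ : J ∈ imagSphere) {ζ : ℂ} {x : R6} (h : sliceQ ζ x ≠ 0) :
    Qinv (toSlice J ζ) x = sliceHom hJ (sliceQ ζ x)⁻¹ := by
  have hreg : x ∈ regularAt (toSlice J ζ) := mem_regularPairs_toSlice hJ h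
  have h1 : Qc (toSlice J ζ) x * sliceHom hJ (sliceQ ζ x)⁻¹ = 1 := by
    rw [Qc_toSlice hJ, ← map_mul, mul_inv_cancel₀ h, map_one]
  calc Qinv (toSlice J ζ) x
      = Qinv (toSlice J ζ) x * (Qc (toSlice J ζ) x * sliceHom hJ (sliceQ ζ x)⁻¹) := by
        rw [h1, mul_one]
    _ = _ := by rw [← mul_assoc, Qinv_mul_Qc hreg, one_mul]

theorem sliceQ_eq_mul (ζ : ℂ) (x : R6) :
    sliceQ ζ x = (ζ - (x 0 + vecNorm x * Complex.I)) * (ζ - (x 0 - vecNorm x * Complex.I)) := by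
  rw [sliceQ]
  linear_combination ((vecNorm x : ℂ) ^ 2) * Complex.I_sq

/-- Represent s by a point ζ with nonnegative imaginary part. If 𝒬 vanished, ζ would be one of the
two conjugate points representing [x]; in either case the real parts and the moduli of the vector
parts agree, so x would lie in [s]. -/
theorem mem_regularAt_of_notMem_sphereOf {s x : R6} (h : x ∉ sphereOf s) : x ∈ regularAt s := by
  obtain ⟨J, hJ, hs⟩ := exists_imagUnit s
  obtain ⟨I, hI, hx⟩ := exists_imagUnit x
  have hs' : s = toSlice J (s 0 + vecNorm s * Complex.I) := by
    rw [toSlice]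
    simpa using hs
  rw [hs']
  refine mem_regularPairs_toSlice hJ fun h0 => h ⟨I, hI, ?_⟩
  have hsn : 0 ≤ vecNorm s := norm_nonneg _
  have hxn : 0 ≤ vecNorm x := norm_nonneg _
  rw [sliceQ_eq_mul, mul_eq_zero] at h0
  have key : s 0 = x 0 ∧ vecNorm s = vecNorm x := by
    rcases h0 with h0 | h0
    · have h1 := congrArg Complex.re h0
      have h2 := congrArg Complex.im h0
      simp at h1 h2
      exact ⟨by linarith, by linarith⟩
    · have h1 := congrArg Complex.re h0
      have h2 := congrArg Complex.im h0
      simp at h1 h2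
      exact ⟨by linarith, by linarith⟩
  change x = slicePt I (s 0) (vecNorm s)
  rw [key.1, key.2]
  exact hx

theorem cauchyL_toSlice (hJ : J ∈ imagSphere) {ζ : ℂ} {x : R6} (h : sliceQ ζ x ≠ 0) :
    cauchyL (toSlice J ζ) x = sliceHom hJ ((ζ - x 0) * (sliceQ ζ x)⁻¹) +
      vecPart x * sliceHom hJ (sliceQ ζ x)⁻¹ := by
  change subConj _ _ * Qinv _ _ = _
  rw [subConj_eq, add_mul, Qinv_toSlice hJ h, subRe_toSlice hJ, map_mul]

/-! ### Holomorphy of slice hyperholomorphic functions on slices -/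

/-- The `ℂ_J`-linear extension `y ↦ φ(y) - i φ(J y)` of a real functional. -/
def complexFunctional (J : R6) (φ : Cl5 →L[ℝ] ℝ) : Cl5 →L[ℝ] ℂ :=
  Complex.ofRealCLM.comp φ -
    Complex.I • Complex.ofRealCLM.comp (φ.comp (ContinuousLinearMap.mul ℝ Cl5 (para J)))

theorem complexFunctional_apply (J : R6) (φ : Cl5 →L[ℝ] ℝ) (y : Cl5) :
    complexFunctional J φ y = φ y - Complex.I * φ (para J * y) := rfl

/-- Left multiplication by J becomes multiplication by i because J² = -1. This reduces Cauchy's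
formula for `Cl5`-valued functions on ℂ_J to the scalar one. -/
theorem complexFunctional_sliceHom_mul (hJ : J ∈ imagSphere) (φ : Cl5 →L[ℝ] ℝ) (z : ℂ) (y : Cl5) :
    complexFunctional J φ (sliceHom hJ z * y) = z * complexFunctional J φ y := by
  have h1 : para J * (para J * y) = -y := by
    rw [← mul_assoc, para_mul_self hJ, neg_one_mul]
  rw [sliceHom_apply, toSlice, para_slicePt, add_mul, ← Algebra.smul_def, smul_mul_assoc]
  simp only [complexFunctional_apply, h1, map_add, map_smul, map_neg, Complex.real_smul]
  push_cast
  conv_rhs => rw [← Complex.re_add_im z]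
  linear_combination (z.im * (φ (para J * y) : ℂ)) * Complex.I_sq

theorem eq_of_complexFunctional_eq (J : R6) {a b : Cl5}
    (h : ∀ φ : Cl5 →L[ℝ] ℝ, complexFunctional J φ a = complexFunctional J φ b) : a = b := by
  refine (SeparatingDual.eq_iff_forall_dual_eq (R := ℝ)).2 fun φ => ?_
  have := congrArg Complex.re (h φ)
  simpa [complexFunctional_apply] using this

variable {W : Set R6}

theorem AxiallySymmetric.mem_sliceRegion (hW : AxiallySymmetric W) (hJ : J ∈ imagSphere) {u v : ℝ}
    (h : slicePt J u v ∈ W) : (u, v) ∈ sliceRegion W := fun I hI => hW u v J hJ h I hI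

theorem isOpen_sliceOf (hW : IsOpen W) (J : R6) : IsOpen (sliceOf W J) :=
  hW.preimage (continuous_toSlice J)

theorem IsStem.hasFDerivAt_slice {α β : ℝ × ℝ → Cl5} (h : IsStem W α β)
    {z : ℂ} (hz : (z.re, z.im) ∈ sliceRegion W) :
    HasFDerivAt (fun ζ : ℂ => α (ζ.re, ζ.im) + para J * β (ζ.re, ζ.im))
      ((fderiv ℝ α (z.re, z.im)).comp (Complex.equivRealProdCLM : ℂ →L[ℝ] ℝ × ℝ) +
        (ContinuousLinearMap.mul ℝ Cl5 (para J)).comp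
          ((fderiv ℝ β (z.re, z.im)).comp (Complex.equivRealProdCLM : ℂ →L[ℝ] ℝ × ℝ))) z := by
  have he : HasFDerivAt (fun ζ : ℂ => (ζ.re, ζ.im))
      (Complex.equivRealProdCLM : ℂ →L[ℝ] ℝ × ℝ) z := Complex.equivRealProdCLM.hasFDerivAt
  have hα := (h.diff_left _ hz).hasFDerivAt.comp z he
  have hβ := (h.diff_right _ hz).hasFDerivAt.comp z he
  exact hα.add ((ContinuousLinearMap.mul ℝ Cl5 (para J)).hasFDerivAt.comp z hβ)

/-- By the Cauchy-Riemann system ∂ᵥ(α + Jβ) = -∂ᵤβ + J∂ᵤα = J∂ᵤ(α + Jβ), and the functional turns J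
into i. -/
theorem differentiableOn_complexFunctional_slice (hWo : IsOpen W) (hW : AxiallySymmetric W)
    {α β : ℝ × ℝ → Cl5} (h : IsStem W α β) {f : R6 → Cl5}
    (hf : ∀ p ∈ sliceRegion W, ∀ J ∈ imagSphere, f (slicePt J p.1 p.2) = α p + para J * β p)
    (hJ : J ∈ imagSphere) (φ : Cl5 →L[ℝ] ℝ) :
    DifferentiableOn ℂ (fun z => complexFunctional J φ (f (toSlice J z))) (sliceOf W J) := by
  intro z hz
  have hreg : ∀ ζ ∈ sliceOf W J, (ζ.re, ζ.im) ∈ sliceRegion W := fun ζ hζ =>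
    hW.mem_sliceRegion hJ hζ
  have hd := (complexFunctional J φ).hasFDerivAt.comp z (h.hasFDerivAt_slice (J := J) (hreg z hz))
  have hcr1 := sub_eq_zero.1 (h.cr_one _ (hreg z hz))
  have hcr2 := eq_neg_of_add_eq_zero_left (h.cr_two _ (hreg z hz))
  refine DifferentiableAt.differentiableWithinAt (DifferentiableAt.congr_of_eventuallyEq
    (differentiableAt_complex_iff_differentiableAt_real.2 ⟨hd.differentiableAt, ?_⟩) ?_)
  · rw [hd.fderiv]
    simp only [ContinuousLinearMap.comp_apply, add_apply,
      ContinuousLinearEquiv.coe_coe, Complex.equivRealProdCLM_apply, Complex.I_re, Complex.I_im,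
      Complex.one_re, Complex.one_im, ContinuousLinearMap.mul_apply', smul_eq_mul]
    rw [← complexFunctional_sliceHom_mul hJ, sliceHom_I, hcr1, hcr2, mul_add, ← mul_assoc,
      para_mul_self hJ, neg_one_mul, add_comm]
  · filter_upwards [(isOpen_sliceOf hWo J).mem_nhds hz] with ζ hζ
    exact congrArg (complexFunctional J φ) (hf _ (hreg ζ hζ) J hJ)

theorem continuousOn_slice (hWo : IsOpen W) (hW : AxiallySymmetric W)
    {α β : ℝ × ℝ → Cl5} (h : IsStem W α β) {f : R6 → Cl5}
    (hf : ∀ p ∈ sliceRegion W, ∀ J ∈ imagSphere, f (slicePt J p.1 p.2) = α p + para J * β p)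
    (hJ : J ∈ imagSphere) : ContinuousOn (fun z => f (toSlice J z)) (sliceOf W J) := by
  intro z hz
  have hreg : ∀ ζ ∈ sliceOf W J, (ζ.re, ζ.im) ∈ sliceRegion W := fun ζ hζ =>
    hW.mem_sliceRegion hJ hζ
  refine ContinuousAt.continuousWithinAt (ContinuousAt.congr
    (h.hasFDerivAt_slice (J := J) (hreg z hz)).continuousAt ?_)
  filter_upwards [(isOpen_sliceOf hWo J).mem_nhds hz] with ζ hζ
  exact (hf _ (hreg ζ hζ) J hJ).symm

end

section

/-! ### The slice Cauchy formula -/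

variable {J : R6} {W : Set R6} {Ω' : Set ℂ} {m : ℕ} {γ : Fin m → ℝ → ℂ} {f : R6 → Cl5} {z : ℂ}

/-- The curves in `ℂ_J`. -/
def sliceCurve (J : R6) (γ : Fin m → ℝ → ℂ) (k : Fin m) (t : ℝ) : R6 := toSlice J (γ k t)

/-- The weight `ds_J f(s)`. -/
def sliceWeight (J : R6) (γ : Fin m → ℝ → ℂ) (f : R6 → Cl5) (k : Fin m) (t : ℝ) : Cl5 :=
  dsJ J (γ k) t * f (toSlice J (γ k t))

theorem integralL_eq_cycleIntegral (K : R6 → R6 → Cl5) (J : R6) (γ : Fin m → ℝ → ℂ)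
    (f : R6 → Cl5) (x : R6) :
    integralL K J γ f x = cycleIntegral (sliceCurve J γ) (sliceWeight J γ f) K x := by
  simp only [integralL, integrandL, cycleIntegral, sliceCurve, sliceWeight, mul_assoc]

theorem dsJ_eq (hJ : J ∈ imagSphere) (c : ℝ → ℂ) (t : ℝ) :
    dsJ J c t = sliceHom hJ (deriv c t * -Complex.I) := by
  rw [dsJ, map_mul, map_neg, sliceHom_I, sliceHom_apply]

/-- The integrand of the Cauchy integral of `f` in `ℂ_J` at `z`. -/
def sliceCauchyIntegrand (hJ : J ∈ imagSphere) (γ : Fin m → ℝ → ℂ) (f : R6 → Cl5) (z : ℂ)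
    (k : Fin m) (t : ℝ) : Cl5 :=
  sliceHom hJ (deriv (γ k) t * -Complex.I * (γ k t - z)⁻¹) * f (toSlice J (γ k t))

theorem IsNullCycle.intervalIntegrable_sliceWeight
    (h : IsNullCycle (sliceOf W J) Ω' γ fun k => deriv (γ k)) (hJ : J ∈ imagSphere)
    (hf : ContinuousOn (fun z => f (toSlice J z)) (sliceOf W J)) (k : Fin m) :
    IntervalIntegrable (sliceWeight J γ f k) volume 0 1 := by
  have h1 : IntervalIntegrable (dsJ J (γ k)) volume 0 1 := by
    have h2 : IntervalIntegrable (fun t => deriv (γ k) t * -Complex.I) volume 0 1 :=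
      (h.integrable k).mul_const _
    refine intervalIntegrable_iff.2 ?_
    have h3 := (sliceCLM hJ).integrable_comp (intervalIntegrable_iff.1 h2)
    rwa [show dsJ J (γ k) = fun t => sliceCLM hJ (deriv (γ k) t * -Complex.I) from
      funext fun t => dsJ_eq hJ (γ k) t]
  refine h1.mul_continuousOn ?_
  rw [uIcc_of_le zero_le_one]
  exact hf.comp (h.continuousOn k) (h.mem k)

theorem IsNullCycle.intervalIntegrable_sliceCauchyIntegrand
    (h : IsNullCycle (sliceOf W J) Ω' γ fun k => deriv (γ k)) (hJ : J ∈ imagSphere)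
    (hf : ContinuousOn (fun z => f (toSlice J z)) (sliceOf W J))
    (hoff : ∀ k, ∀ t ∈ Icc (0 : ℝ) 1, γ k t ≠ z) (k : Fin m) :
    IntervalIntegrable (sliceCauchyIntegrand hJ γ f z k) volume 0 1 := by
  have hinv : ContinuousOn (fun t => sliceCLM hJ (γ k t - z)⁻¹) (uIcc 0 1) := by
    rw [uIcc_of_le zero_le_one]
    exact (sliceCLM hJ).continuous.comp_continuousOn
      (((h.continuousOn k).sub continuousOn_const).inv₀ fun t ht => sub_ne_zero.2 (hoff k t ht))
  have := (h.intervalIntegrable_sliceWeight hJ hf k).continuousOn_mul hinv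
  refine this.congr fun t _ => ?_
  rw [sliceCauchyIntegrand, sliceWeight, dsJ_eq hJ, sliceCLM_apply, ← mul_assoc, ← map_mul,
    mul_comm (γ k t - z)⁻¹]

/-- Every complexified functional reduces this to the scalar Cauchy formula. The factor -J in ds_J
becomes -i and turns 2πi into 2π. -/
theorem IsNullCycle.sum_integral_sliceCauchyIntegrand
    (h : IsNullCycle (sliceOf W J) Ω' γ fun k => deriv (γ k)) (hJ : J ∈ imagSphere)
    (hf : ContinuousOn (fun z => f (toSlice J z)) (sliceOf W J))
    (hfd : ∀ φ, DifferentiableOn ℂ (fun z => complexFunctional J φ (f (toSlice J z)))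
      (sliceOf W J))
    (hz : z ∈ sliceOf W J) (hoff : ∀ k, ∀ t ∈ Icc (0 : ℝ) 1, γ k t ≠ z) (hind : index γ z = 1) :
    ∑ k, ∫ t in (0 : ℝ)..1, sliceCauchyIntegrand hJ γ f z k t =
      (2 * Real.pi) • f (toSlice J z) := by
  have hpi : (2 * Real.pi * Complex.I : ℂ) ≠ 0 := by simp [Real.pi_ne_zero]
  have hind' : ∑ k, ∫ t in (0 : ℝ)..1, deriv (γ k) t / (γ k t - z) = 2 * Real.pi * Complex.I := by
    rw [index, ← Finset.mul_sum, inv_mul_eq_one₀ hpi] at hind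
    exact hind.symm
  refine eq_of_complexFunctional_eq J fun φ => ?_
  have hC := h.cauchy_formula (hfd φ) hz hoff
  rw [hind'] at hC
  rw [map_sum, map_smul, Complex.real_smul]
  have hk : ∀ k, complexFunctional J φ (∫ t in (0 : ℝ)..1, sliceCauchyIntegrand hJ γ f z k t) =
      -Complex.I * ∫ t in (0 : ℝ)..1,
        deriv (γ k) t * complexFunctional J φ (f (toSlice J (γ k t))) * (γ k t - z)⁻¹ := by
    intro k
    rw [← ContinuousLinearMap.intervalIntegral_comp_comm _
      (h.intervalIntegrable_sliceCauchyIntegrand hJ hf hoff k),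
      ← intervalIntegral.integral_const_mul]
    refine intervalIntegral.integral_congr fun t _ => ?_
    simp only [sliceCauchyIntegrand, complexFunctional_sliceHom_mul]
    ring
  simp_rw [hk, ← Finset.mul_sum]
  rw [hC]
  push_cast
  linear_combination (-(2 * Real.pi * complexFunctional J φ (f (toSlice J z)) : ℂ)) * Complex.I_sq

theorem integral_half_add_mul_sub {g₁ g₂ : ℝ → Cl5} (h₁ : IntervalIntegrable g₁ volume 0 1)
    (h₂ : IntervalIntegrable g₂ volume 0 1) (a : Cl5) :
    ∫ t in (0 : ℝ)..1, ((2⁻¹ : ℝ) • (g₁ t + g₂ t) + a * (g₁ t - g₂ t)) =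
      (2⁻¹ : ℝ) • ((∫ t in (0 : ℝ)..1, g₁ t) + ∫ t in (0 : ℝ)..1, g₂ t) +
        a * ((∫ t in (0 : ℝ)..1, g₁ t) - ∫ t in (0 : ℝ)..1, g₂ t) := by
  have hs := h₁.sub h₂
  have ha : IntervalIntegrable (fun t => a * (g₁ t - g₂ t)) volume 0 1 :=
    hs.continuousOn_mul continuousOn_const
  have hh : IntervalIntegrable (fun t => (2⁻¹ : ℝ) • (g₁ t + g₂ t)) volume 0 1 :=
    (h₁.add h₂).smul (2⁻¹ : ℝ)
  rw [intervalIntegral.integral_add hh ha, intervalIntegral.integral_smul,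
    intervalIntegral.integral_add h₁ h₂, ← intervalIntegral.integral_sub h₁ h₂]
  congr 1
  exact (ContinuousLinearMap.mul ℝ Cl5 a).intervalIntegral_comp_comm hs

/-- The point of the upper half plane that represents `[x]`. -/
def upperPt (x : R6) : ℂ := x 0 + vecNorm x * Complex.I

/-- The point of the lower half plane that represents `[x]`. -/
def lowerPt (x : R6) : ℂ := x 0 - vecNorm x * Complex.I

theorem sliceQ_ne_zero {ζ : ℂ} {x : R6} (h1 : ζ ≠ upperPt x) (h2 : ζ ≠ lowerPt x) :
    sliceQ ζ x ≠ 0 := by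
  rw [sliceQ_eq_mul]
  exact mul_ne_zero (sub_ne_zero.2 h1) (sub_ne_zero.2 h2)

/-- Partial fractions with z = `upperPt x` and z̄ = `lowerPt x`: (ζ - x₀)/𝒬 is half the sum of 1/(ζ
- z) and 1/(ζ - z̄), while |x̲|/𝒬 is their difference divided by 2i, because z - z̄ = 2i|x̲|. The
unit I of x need not commute with ℂ_J and stays on the left. -/
theorem cauchyL_mul_sliceWeight (hJ : J ∈ imagSphere) {I x : R6}
    (hI : vecPart x = vecNorm x • para I) (k : Fin m) {t : ℝ} (h1 : γ k t ≠ upperPt x)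
    (h2 : γ k t ≠ lowerPt x) :
    cauchyL (sliceCurve J γ k t) x * sliceWeight J γ f k t =
      (2⁻¹ : ℝ) • (sliceCauchyIntegrand hJ γ f (upperPt x) k t +
        sliceCauchyIntegrand hJ γ f (lowerPt x) k t) +
      para I * sliceHom hJ (2 * Complex.I)⁻¹ * (sliceCauchyIntegrand hJ γ f (upperPt x) k t -
        sliceCauchyIntegrand hJ γ f (lowerPt x) k t) := by
  have hq := sliceQ_ne_zero h1 h2
  have hu : γ k t - upperPt x ≠ 0 := sub_ne_zero.2 h1
  have hl : γ k t - lowerPt x ≠ 0 := sub_ne_zero.2 h2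
  set A := deriv (γ k) t * -Complex.I
  have hQ : sliceQ (γ k t) x = (γ k t - upperPt x) * (γ k t - lowerPt x) := sliceQ_eq_mul _ _
  have hsum : (γ k t - x 0) * (sliceQ (γ k t) x)⁻¹ * A =
      ((2⁻¹ : ℝ) : ℂ) * (A * (γ k t - upperPt x)⁻¹ + A * (γ k t - lowerPt x)⁻¹) := by
    have : γ k t - x 0 = ((2⁻¹ : ℝ) : ℂ) * ((γ k t - upperPt x) + (γ k t - lowerPt x)) := by
      simp only [upperPt, lowerPt]; push_cast; ring
    rw [this, hQ]
    field_simp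
    ring
  have hdiff : (vecNorm x : ℂ) * (sliceQ (γ k t) x)⁻¹ * A =
      (2 * Complex.I)⁻¹ * (A * (γ k t - upperPt x)⁻¹ - A * (γ k t - lowerPt x)⁻¹) := by
    have : (vecNorm x : ℂ) = (2 * Complex.I)⁻¹ * ((γ k t - lowerPt x) - (γ k t - upperPt x)) := by
      simp only [upperPt, lowerPt]
      field_simp
      ring
    rw [this, hQ]
    field_simp
  have e1 : sliceHom hJ ((γ k t - x 0) * (sliceQ (γ k t) x)⁻¹) * sliceHom hJ A = (2⁻¹ : ℝ) •
      (sliceHom hJ (A * (γ k t - upperPt x)⁻¹) + sliceHom hJ (A * (γ k t - lowerPt x)⁻¹)) := by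
    rw [← map_mul, hsum, map_mul, sliceHom_ofReal, ← Algebra.smul_def, map_add]
  have e2 : vecNorm x • (sliceHom hJ (sliceQ (γ k t) x)⁻¹ * sliceHom hJ A) =
      sliceHom hJ (2 * Complex.I)⁻¹ *
        (sliceHom hJ (A * (γ k t - upperPt x)⁻¹) - sliceHom hJ (A * (γ k t - lowerPt x)⁻¹)) := by
    rw [← map_mul, ← map_sub, ← map_mul, ← hdiff, mul_assoc, map_mul _ (vecNorm x : ℂ),
      sliceHom_ofReal, ← Algebra.smul_def]
  simp only [sliceCauchyIntegrand, sliceWeight, sliceCurve]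
  rw [cauchyL_toSlice hJ hq, dsJ_eq hJ, hI, ← mul_assoc, add_mul, e1, smul_mul_assoc,
    smul_mul_assoc, mul_assoc (para I), ← mul_smul_comm, e2, add_mul, smul_mul_assoc, add_mul,
    ← sub_mul, ← mul_assoc (para I), mul_assoc (para I * _)]

/-- The slice Cauchy formula. -/
theorem IsNullCycle.cycleIntegral_cauchyL (hWo : IsOpen W) (hW : AxiallySymmetric W)
    {α β : ℝ × ℝ → Cl5} (hs : IsStem W α β)
    (hf : ∀ p ∈ sliceRegion W, ∀ J ∈ imagSphere, f (slicePt J p.1 p.2) = α p + para J * β p)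
    (hJ : J ∈ imagSphere) (h : IsNullCycle (sliceOf W J) Ω' γ fun k => deriv (γ k)) {x : R6}
    (hx : x ∈ W) (hoffu : ∀ k, ∀ t ∈ Icc (0 : ℝ) 1, γ k t ≠ upperPt x)
    (hoffl : ∀ k, ∀ t ∈ Icc (0 : ℝ) 1, γ k t ≠ lowerPt x)
    (hindu : index γ (upperPt x) = 1) (hindl : index γ (lowerPt x) = 1) :
    cycleIntegral (sliceCurve J γ) (sliceWeight J γ f) cauchyL x = (2 * Real.pi) • f x := by
  obtain ⟨I, hI, hxI⟩ := exists_imagUnit x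
  have hvec : vecPart x = vecNorm x • para I := by
    conv_lhs => rw [hxI]
    exact vecPart_slicePt hI _ _
  have hreg : (x 0, vecNorm x) ∈ sliceRegion W := hW.mem_sliceRegion hI (hxI ▸ hx)
  have hreg' : (x 0, -vecNorm x) ∈ sliceRegion W := by
    intro K hK
    rw [← slicePt_neg]
    exact hreg _ (neg_mem_imagSphere hK)
  have hup : toSlice J (upperPt x) = slicePt J (x 0) (vecNorm x) := by
    simp [toSlice, upperPt]
  have hlow : toSlice J (lowerPt x) = slicePt J (x 0) (-vecNorm x) := by
    simp [toSlice, lowerPt]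
  have hzu : upperPt x ∈ sliceOf W J := by
    change toSlice J (upperPt x) ∈ W
    rw [hup]; exact hreg J hJ
  have hzl : lowerPt x ∈ sliceOf W J := by
    change toSlice J (lowerPt x) ∈ W
    rw [hlow]; exact hreg' J hJ
  have hcont := continuousOn_slice hWo hW hs hf hJ
  have hfd := differentiableOn_complexFunctional_slice hWo hW hs hf hJ
  have hiu := h.intervalIntegrable_sliceCauchyIntegrand hJ hcont hoffu
  have hil := h.intervalIntegrable_sliceCauchyIntegrand hJ hcont hoffl
  have hk : ∀ k, ∫ t in (0 : ℝ)..1, cauchyL (sliceCurve J γ k t) x * sliceWeight J γ f k t =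
      (2⁻¹ : ℝ) • ((∫ t in (0 : ℝ)..1, sliceCauchyIntegrand hJ γ f (upperPt x) k t) +
        ∫ t in (0 : ℝ)..1, sliceCauchyIntegrand hJ γ f (lowerPt x) k t) +
      para I * sliceHom hJ (2 * Complex.I)⁻¹ *
        ((∫ t in (0 : ℝ)..1, sliceCauchyIntegrand hJ γ f (upperPt x) k t) -
          ∫ t in (0 : ℝ)..1, sliceCauchyIntegrand hJ γ f (lowerPt x) k t) := by
    intro k
    refine (intervalIntegral.integral_congr fun t ht => ?_).trans
      (integral_half_add_mul_sub (hiu k) (hil k) (para I * sliceHom hJ (2 * Complex.I)⁻¹))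
    rw [uIcc_of_le zero_le_one] at ht
    exact cauchyL_mul_sliceWeight hJ hvec k (hoffu k t ht) (hoffl k t ht)
  rw [cycleIntegral]
  simp_rw [hk]
  rw [Finset.sum_add_distrib, ← Finset.smul_sum, ← Finset.mul_sum, Finset.sum_add_distrib,
    Finset.sum_sub_distrib, h.sum_integral_sliceCauchyIntegrand hJ hcont hfd hzu hoffu hindu,
    h.sum_integral_sliceCauchyIntegrand hJ hcont hfd hzl hoffl hindl, hup, hlow,
    hf _ hreg J hJ, hf _ hreg' J hJ]
  -- By parity f takes the values α + Jβ and α - Jβ at the two points. Half their sum is α, and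
  -- I(2J)⁻¹ times their difference is Iβ, so that α + Iβ = f(x) appears.
  have hα := hs.even _ hreg
  have hβ := hs.odd _ hreg
  simp only at hα hβ
  have hβ' : β (x 0, -vecNorm x) = -β (x 0, vecNorm x) := by rw [hβ, neg_neg]
  have hfx : f x = α (x 0, vecNorm x) + para I * β (x 0, vecNorm x) := by
    conv_lhs => rw [hxI]
    exact hf _ hreg I hI
  have hJJ : sliceHom hJ (2 * Complex.I)⁻¹ * para J = algebraMap ℝ Cl5 2⁻¹ := by
    rw [← sliceHom_I hJ, ← map_mul, ← sliceHom_ofReal hJ]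
    congr 1
    push_cast
    field_simp
  have hlast : para I * sliceHom hJ (2 * Complex.I)⁻¹ * (para J * β (x 0, vecNorm x)) =
      (2⁻¹ : ℝ) • (para I * β (x 0, vecNorm x)) := by
    rw [← mul_assoc, mul_assoc (para I), hJJ, ← Algebra.commutes, mul_assoc, ← Algebra.smul_def]
  rw [← hα, hβ', hfx, mul_neg]
  have hd : (2 * Real.pi) • (α (x 0, vecNorm x) + para J * β (x 0, vecNorm x)) -
      (2 * Real.pi) • (α (x 0, vecNorm x) + -(para J * β (x 0, vecNorm x))) =
      (4 * Real.pi) • (para J * β (x 0, vecNorm x)) := by module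
  rw [hd, mul_smul_comm, hlast]
  module

end

section

/-! ### Cycles that represent slice hyperholomorphic functions -/

/-- A cycle in `W ∩ ℂ_J`, null-homologous there, that winds once around the points of `ℂ_J`
that belong to the spheres `[x]`, `x ∈ V`. -/
structure IsSliceCycle (W : Set R6) (J : R6) (V : Set R6) {m : ℕ} (γ : Fin m → ℝ → ℂ) : Prop where
  null : ∃ Ω', IsNullCycle (sliceOf W J) Ω' γ fun k => deriv (γ k)
  isOpen : IsOpen V
  subset : V ⊆ W
  ne_upper : ∀ x ∈ V, ∀ k, ∀ t ∈ Icc (0 : ℝ) 1, γ k t ≠ upperPt x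
  ne_lower : ∀ x ∈ V, ∀ k, ∀ t ∈ Icc (0 : ℝ) 1, γ k t ≠ lowerPt x
  index_upper : ∀ x ∈ V, index γ (upperPt x) = 1
  index_lower : ∀ x ∈ V, index γ (lowerPt x) = 1

variable {J : R6} {W V : Set R6} {m : ℕ} {γ : Fin m → ℝ → ℂ} {f : R6 → Cl5}

theorem IsSliceCycle.isKernelCycle (h : IsSliceCycle W J V γ) (hJ : J ∈ imagSphere)
    (hf : ContinuousOn (fun z => f (toSlice J z)) (sliceOf W J)) :
    IsKernelCycle V (sliceCurve J γ) (sliceWeight J γ f) := by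
  obtain ⟨Ω', hn⟩ := h.null
  refine ⟨h.isOpen, fun k => (continuous_toSlice J).comp_continuousOn (hn.continuousOn k),
    fun k => hn.intervalIntegrable_sliceWeight hJ hf k, fun k t ht x hx => ?_⟩
  exact mem_regularPairs_toSlice hJ (sliceQ_ne_zero (h.ne_upper x hx k t ht)
    (h.ne_lower x hx k t ht))

theorem IsKernelCycle.smul {σ : Fin m → ℝ → R6} {w : Fin m → ℝ → Cl5} (h : IsKernelCycle V σ w)
    (c : ℝ) : IsKernelCycle V σ fun j t => c • w j t :=
  ⟨h.isOpen, h.continuousOn, fun j => (h.integrable j).smul c, h.regular⟩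

theorem cycleIntegral_smul (σ : Fin m → ℝ → R6) (w : Fin m → ℝ → Cl5) (c : ℝ)
    (k : R6 → R6 → Cl5) (x : R6) :
    cycleIntegral σ (fun j t => c • w j t) k x = c • cycleIntegral σ w k x := by
  simp only [cycleIntegral, mul_smul_comm, intervalIntegral.integral_smul, Finset.smul_sum]

theorem SliceHypL.continuousOn_slice (hf : SliceHypL W f) (hWo : IsOpen W)
    (hW : AxiallySymmetric W) (hJ : J ∈ imagSphere) :
    ContinuousOn (fun z => f (toSlice J z)) (sliceOf W J) := by
  obtain ⟨α, β, hs, hf⟩ := hf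
  exact FineStructure.continuousOn_slice hWo hW hs hf hJ

/-- The constant 1/2π is put into the weight, so that f itself is a cycle integral and operators
apply to it without a separate linearity argument. -/
theorem SliceHypL.eqOn_cycleIntegral (hf : SliceHypL W f) (hWo : IsOpen W)
    (hW : AxiallySymmetric W) (hJ : J ∈ imagSphere) (h : IsSliceCycle W J V γ) :
    EqOn f (cycleIntegral (sliceCurve J γ)
      (fun k t => (2 * Real.pi)⁻¹ • sliceWeight J γ f k t) cauchyL) V := by
  intro x hx
  obtain ⟨α, β, hs, hf⟩ := hf
  obtain ⟨Ω', hn⟩ := h.null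
  rw [cycleIntegral_smul, hn.cycleIntegral_cauchyL hWo hW hs hf hJ (h.subset hx) (h.ne_upper x hx)
    (h.ne_lower x hx) (h.index_upper x hx) (h.index_lower x hx), smul_smul,
    inv_mul_cancel₀ (by positivity), one_smul]

theorem SliceHypL.op_eqOn (hf : SliceHypL W f) (hWo : IsOpen W)
    (hW : AxiallySymmetric W) (hJ : J ∈ imagSphere) (h : IsSliceCycle W J V γ)
    {T : (R6 → Cl5) → (R6 → Cl5)} (hT : IsKernelOp T) :
    EqOn (T f) (fun x => (2 * Real.pi)⁻¹ •
      cycleIntegral (sliceCurve J γ) (sliceWeight J γ f) (kernelL T) x) V := by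
  intro x hx
  have hk := (h.isKernelCycle hJ (hf.continuousOn_slice hWo hW hJ)).smul (2 * Real.pi)⁻¹
  rw [hT.congr h.isOpen (hf.eqOn_cycleIntegral hWo hW hJ h) hx,
    hT.comm hk smoothKernel_cauchyL hx, cycleIntegral_smul]
  rfl

theorem SliceHypL.contDiffOn_of_isSliceCycle (hf : SliceHypL W f) (hWo : IsOpen W)
    (hW : AxiallySymmetric W) (hJ : J ∈ imagSphere) (h : IsSliceCycle W J V γ) :
    ContDiffOn ℝ ∞ f V :=
  (((h.isKernelCycle hJ (hf.continuousOn_slice hWo hW hJ)).smul (2 * Real.pi)⁻¹).contDiffOn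
    smoothKernel_cauchyL).congr (hf.eqOn_cycleIntegral hWo hW hJ h)

/-! ### Boundaries of slice Cauchy domains -/

theorem IsPiecewiseC1Jordan.continuousOn {c : ℝ → ℂ} (h : IsPiecewiseC1Jordan c) :
    ContinuousOn c (Icc 0 1) := by
  obtain ⟨n, p, h0, h1, hp⟩ := h.piecewise
  have key : ∀ j ≤ n, p 0 ≤ p j ∧ ContinuousOn c (Icc (p 0) (p j)) := by
    intro j
    induction j with
    | zero => intro _; simp
    | succ j ih =>
      intro hj
      obtain ⟨hle, hc⟩ := ih (by omega)
      obtain ⟨hlt, hd⟩ := hp j (by omega)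
      refine ⟨hle.trans hlt.le, ?_⟩
      rw [← Icc_union_Icc_eq_Icc hle hlt.le]
      exact hc.union_of_isClosed hd.continuousOn isClosed_Icc isClosed_Icc
  have := (key n le_rfl).2
  rwa [h0, h1] at this

/-- Inside each piece `deriv` agrees with the continuous `derivWithin`. The finitely many
breakpoints, where `deriv` may be the default value 0, do not affect integrability. -/
theorem IsPiecewiseC1Jordan.intervalIntegrable_deriv {c : ℝ → ℂ} (h : IsPiecewiseC1Jordan c) :
    IntervalIntegrable (deriv c) volume 0 1 := by
  obtain ⟨n, p, h0, h1, hp⟩ := h.piecewise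
  rw [← h0, ← h1]
  refine IntervalIntegrable.trans_iterate fun i hi => ?_
  obtain ⟨hlt, hd⟩ := hp i hi
  have hc := hd.continuousOn_derivWithin (uniqueDiffOn_Icc hlt) le_rfl
  have hbd : IntervalIntegrable (derivWithin c (Icc (p i) (p (i + 1)))) volume (p i)
      (p (i + 1)) := ContinuousOn.intervalIntegrable (by rwa [uIcc_of_le hlt.le])
  refine hbd.congr_uIoo fun t ht => ?_
  rw [uIoo_of_le hlt.le] at ht
  exact derivWithin_of_mem_nhds (Icc_mem_nhds ht.1 ht.2)

/-- The crude constant comes from bounding |Re z| by one and |Im z| by two times the norm. It is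
used only for boundedness. -/
theorem norm_le_norm_toSlice (hJ : J ∈ imagSphere) (z : ℂ) : ‖z‖ ≤ 3 * ‖toSlice J z‖ := by
  have h0 : |z.re| ≤ ‖toSlice J z‖ := by
    have := PiLp.norm_apply_le (toSlice J z) 0
    rwa [toSlice, slicePt_zero hJ, Real.norm_eq_abs] at this
  have h1 : |z.im| ≤ ‖toSlice J z‖ + |z.re| := by
    have e : z.im • J = toSlice J z - z.re • EuclideanSpace.single 0 1 := by
      simp [toSlice, slicePt]
    have := norm_sub_le (toSlice J z) (z.re • EuclideanSpace.single 0 1)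
    rw [← e, norm_smul, norm_smul, hJ.2] at this
    simpa using this
  have := Complex.norm_le_abs_re_add_abs_im z
  linarith

theorem isBounded_sliceOf (hJ : J ∈ imagSphere) {U : Set R6} (hU : Bornology.IsBounded U) :
    Bornology.IsBounded (sliceOf U J) := by
  obtain ⟨C, hC⟩ := hU.exists_norm_le
  refine isBounded_iff_forall_norm_le.2 ⟨3 * C, fun z hz => ?_⟩
  have := norm_le_norm_toSlice hJ z
  have := hC _ hz
  linarith

theorem toSlice_upperPt (J x : R6) : toSlice J (upperPt x) = slicePt J (x 0) (vecNorm x) := by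
  simp [toSlice, upperPt]

theorem toSlice_lowerPt (J x : R6) : toSlice J (lowerPt x) = slicePt (-J) (x 0) (vecNorm x) := by
  simp [toSlice, lowerPt, slicePt_neg]

theorem AxiallySymmetric.upperPt_mem {U : Set R6} (hU : AxiallySymmetric U) (hJ : J ∈ imagSphere)
    {x : R6} (hx : x ∈ U) : upperPt x ∈ sliceOf U J := by
  obtain ⟨I, hI, hxI⟩ := exists_imagUnit x
  change toSlice J (upperPt x) ∈ U
  rw [toSlice_upperPt]
  exact hU _ _ I hI (hxI ▸ hx) J hJ

theorem AxiallySymmetric.lowerPt_mem {U : Set R6} (hU : AxiallySymmetric U) (hJ : J ∈ imagSphere)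
    {x : R6} (hx : x ∈ U) : lowerPt x ∈ sliceOf U J := by
  obtain ⟨I, hI, hxI⟩ := exists_imagUnit x
  change toSlice J (lowerPt x) ∈ U
  rw [toSlice_lowerPt]
  exact hU _ _ I hI (hxI ▸ hx) _ (neg_mem_imagSphere hJ)

theorem sum_integral_eq_zero_of_index {z : ℂ} (h : index γ z = 0) :
    ∑ k, ∫ t in (0 : ℝ)..1, deriv (γ k) t / (γ k t - z) = 0 := by
  have hpi : (2 * Real.pi * Complex.I : ℂ) ≠ 0 := by simp [Real.pi_ne_zero]
  rw [index, ← Finset.mul_sum] at h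
  exact (mul_eq_zero.1 h).resolve_left (inv_ne_zero hpi)

/-- The second open set is the complement of the closure of U ∩ ℂ_J, where the winding number is 0
by orientation; the cover holds because the closure of U lies in W. Axial symmetry puts both points
of [x] ∩ ℂ_J into U, where the winding number is 1, and the frontier of an open set avoids them. -/
theorem IsContour.isSliceCycle {U : Set R6} (hWo : IsOpen W) (h : IsContour W U J γ) :
    IsSliceCycle W J U γ := by
  have hUo := h.cauchy.1
  have hUa := h.cauchy.2.1
  have hso : IsOpen (sliceOf U J) := isOpen_sliceOf hUo J
  have hfr : ∀ k, ∀ t ∈ Icc (0 : ℝ) 1, γ k t ∈ frontier (sliceOf U J) := by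
    intro k t ht
    rw [h.boundary.frontier_eq]
    exact mem_iUnion.2 ⟨k, t, ht, rfl⟩
  have hcl : closure (sliceOf U J) ⊆ sliceOf W J := by
    refine (Continuous.closure_preimage_subset (continuous_toSlice J) U).trans ?_
    exact preimage_mono h.closure_subset
  have hne : ∀ z ∈ sliceOf U J, ∀ k, ∀ t ∈ Icc (0 : ℝ) 1, γ k t ≠ z := by
    intro z hz k t ht e
    have := hfr k t ht
    rw [e, hso.frontier_eq] at this
    exact this.2 hz
  refine ⟨⟨(closure (sliceOf U J))ᶜ, isOpen_sliceOf hWo J, isClosed_closure.isOpen_compl, ?_, ?_,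
    fun k => (h.boundary.jordan k).continuousOn,
    fun k => (h.boundary.jordan k).intervalIntegrable_deriv,
    fun k t ht => hcl (frontier_subset_closure (hfr k t ht)),
    fun k t ht hn => hn (frontier_subset_closure (hfr k t ht)),
    fun z hz => sum_integral_eq_zero_of_index (h.oriented.2 z hz)⟩, hUo,
    subset_closure.trans h.closure_subset,
    fun x hx => hne _ (hUa.upperPt_mem h.unit hx), fun x hx => hne _ (hUa.lowerPt_mem h.unit hx),
    fun x hx => h.oriented.1 _ (hUa.upperPt_mem h.unit hx),
    fun x hx => h.oriented.1 _ (hUa.lowerPt_mem h.unit hx)⟩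
  · refine eq_univ_of_forall fun z => ?_
    by_cases hz : z ∈ closure (sliceOf U J)
    · exact Or.inl (hcl hz)
    · exact Or.inr hz
  · rw [compl_compl]
    exact (isBounded_sliceOf h.unit h.bounded).closure

/-! ### Small circles -/

/-- Circles of radius `r`, parametrized by `[0, 1]`. -/
def circles (c : Fin m → ℂ) (r : ℝ) (k : Fin m) (t : ℝ) : ℂ := circleMap (c k) r (2 * Real.pi * t)

theorem hasDerivAt_circles (c : Fin m → ℂ) (r : ℝ) (k : Fin m) (t : ℝ) :
    HasDerivAt (circles c r k)
      ((2 * Real.pi) • deriv (circleMap (c k) r) (2 * Real.pi * t)) t := by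
  have h1 : HasDerivAt (fun t : ℝ => 2 * Real.pi * t) (2 * Real.pi) t := by
    simpa using (hasDerivAt_id t).const_mul (2 * Real.pi)
  exact (differentiable_circleMap (c k) r (2 * Real.pi * t)).hasDerivAt.scomp t h1

theorem integral_circles (c : Fin m → ℂ) (r : ℝ) (k : Fin m) (z : ℂ) :
    ∫ t in (0 : ℝ)..1, deriv (circles c r k) t / (circles c r k t - z) =
      circleIntegral (fun w => (w - z)⁻¹) (c k) r := by
  have hpi : (2 * Real.pi) ≠ 0 := by positivity
  have h := intervalIntegral.integral_comp_mul_left (a := 0) (b := 1)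
    (fun θ => deriv (circleMap (c k) r) θ • (circleMap (c k) r θ - z)⁻¹) hpi
  rw [mul_zero, mul_one] at h
  rw [circleIntegral, ← smul_inv_smul₀ hpi (∫ θ in (0 : ℝ)..2 * Real.pi, _), ← h,
    ← intervalIntegral.integral_smul]
  refine intervalIntegral.integral_congr fun t _ => ?_
  simp only [(hasDerivAt_circles c r k t).deriv, circles, div_eq_mul_inv, smul_mul_assoc,
    smul_eq_mul]

theorem integral_circles_of_notMem {c : Fin m → ℂ} {r : ℝ} (hr : 0 < r) {k : Fin m} {z : ℂ}
    (hz : z ∉ closedBall (c k) r) :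
    ∫ t in (0 : ℝ)..1, deriv (circles c r k) t / (circles c r k t - z) = 0 := by
  rw [integral_circles]
  have hd : DifferentiableOn ℂ (fun w => (w - z)⁻¹) (closedBall (c k) r) :=
    DifferentiableOn.inv (by fun_prop) fun w hw e => hz (by rwa [← sub_eq_zero.1 e])
  refine Complex.circleIntegral_eq_zero_of_differentiable_on_off_countable hr.le countable_empty
    hd.continuousOn fun w hw => ?_
  exact hd.differentiableAt (closedBall_mem_nhds_of_mem hw.1)

theorem index_circles_of_notMem {c : Fin m → ℂ} {r : ℝ} (hr : 0 < r) {z : ℂ}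
    (hz : ∀ k, z ∉ closedBall (c k) r) : index (circles c r) z = 0 :=
  Finset.sum_eq_zero fun k _ => by rw [integral_circles_of_notMem hr (hz k), mul_zero]

theorem index_circles_of_mem {c : Fin m → ℂ} {r : ℝ} (hr : 0 < r) {z : ℂ} {k : Fin m}
    (hz : z ∈ ball (c k) r) (hdisj : ∀ l ≠ k, z ∉ closedBall (c l) r) :
    index (circles c r) z = 1 := by
  have hpi : (2 * Real.pi * Complex.I : ℂ) ≠ 0 := by simp [Real.pi_ne_zero]
  rw [index, Finset.sum_eq_single k]
  · rw [integral_circles, circleIntegral.integral_sub_inv_of_mem_ball hz, inv_mul_cancel₀ hpi]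
  · intro l _ hl
    rw [integral_circles_of_notMem hr (hdisj l hl), mul_zero]
  · intro h
    exact absurd (Finset.mem_univ k) h

theorem circles_mem_sphere (c : Fin m → ℂ) {r : ℝ} (hr : 0 < r) (k : Fin m) (t : ℝ) :
    circles c r k t ∈ sphere (c k) r := circleMap_mem_sphere _ hr.le _

/-- A circle does not wind around points outside its closed disc, and the discs lie in `Ω`. -/
theorem isNullCycle_circles {Ω : Set ℂ} (hΩ : IsOpen Ω) {c : Fin m → ℂ} {r : ℝ} (hr : 0 < r)
    (hsub : ∀ k, closedBall (c k) r ⊆ Ω) :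
    IsNullCycle Ω (⋃ k, closedBall (c k) r)ᶜ (circles c r) fun k => deriv (circles c r k) := by
  have hcl : IsCompact (⋃ k, closedBall (c k) r) := isCompact_iUnion fun k => isCompact_closedBall _ _
  refine ⟨hΩ, hcl.isClosed.isOpen_compl, ?_, ?_, ?_, ?_, ?_, ?_, ?_⟩
  · refine eq_univ_of_forall fun z => ?_
    by_cases hz : z ∈ ⋃ k, closedBall (c k) r
    · obtain ⟨k, hk⟩ := mem_iUnion.1 hz
      exact Or.inl (hsub k hk)
    · exact Or.inr hz
  · rw [compl_compl]
    exact hcl.isBounded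
  · exact fun k t _ => (hasDerivAt_circles c r k t).continuousAt.continuousWithinAt
  · intro k
    have : deriv (circles c r k) = fun t =>
        (2 * Real.pi) • (circleMap 0 r (2 * Real.pi * t) * Complex.I) := by
      ext t
      rw [(hasDerivAt_circles c r k t).deriv, deriv_circleMap]
    rw [this]
    refine Continuous.intervalIntegrable ?_ _ _
    fun_prop
  · exact fun k t _ => hsub k (sphere_subset_closedBall (circles_mem_sphere c hr k t))
  · exact fun k t _ hn =>
      hn (mem_iUnion.2 ⟨k, sphere_subset_closedBall (circles_mem_sphere c hr k t)⟩)
  · exact fun z hz => sum_integral_eq_zero_of_index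
      (index_circles_of_notMem hr fun k hk => hz (mem_iUnion.2 ⟨k, hk⟩))

theorem continuous_upperPt : Continuous upperPt := by
  have := continuous_vecNorm
  unfold upperPt
  fun_prop

theorem continuous_lowerPt : Continuous lowerPt := by
  have := continuous_vecNorm
  unfold lowerPt
  fun_prop

/-- Disjoint small discs around the points of `[x₀] ∩ ℂ_J` give a slice cycle near `x₀`. -/
theorem isSliceCycle_circles (hWo : IsOpen W) {c : Fin m → ℂ} {r : ℝ}
    (hr : 0 < r) (hsub : ∀ k, closedBall (c k) r ⊆ sliceOf W J)
    (hdisj : ∀ k l, k ≠ l → Disjoint (closedBall (c k) r) (closedBall (c l) r)) :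
    IsSliceCycle W J (W ∩ (upperPt ⁻¹' (⋃ k, ball (c k) r) ∩ lowerPt ⁻¹' (⋃ k, ball (c k) r)))
      (circles c r) := by
  have hso : IsOpen (⋃ k, ball (c k) r) := isOpen_iUnion fun _ => isOpen_ball
  have hne : ∀ z ∈ ⋃ k, ball (c k) r, ∀ k, ∀ t ∈ Icc (0 : ℝ) 1, circles c r k t ≠ z := by
    intro z hz k t _ e
    obtain ⟨l, hl⟩ := mem_iUnion.1 hz
    have hs := circles_mem_sphere c hr k t
    rw [e] at hs
    rcases eq_or_ne k l with rfl | hkl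
    · exact (mem_ball.1 hl).ne (mem_sphere.1 hs)
    · exact disjoint_left.1 (hdisj k l hkl) (sphere_subset_closedBall hs)
        (ball_subset_closedBall hl)
  have hind : ∀ z ∈ ⋃ k, ball (c k) r, index (circles c r) z = 1 := by
    intro z hz
    obtain ⟨k, hk⟩ := mem_iUnion.1 hz
    exact index_circles_of_mem hr hk fun l hl hzl =>
      disjoint_left.1 (hdisj l k hl) hzl (ball_subset_closedBall hk)
  exact ⟨⟨_, isNullCycle_circles (isOpen_sliceOf hWo J) hr hsub⟩,
    hWo.inter ((hso.preimage continuous_upperPt).inter (hso.preimage continuous_lowerPt)),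
    inter_subset_left, fun x hx => hne _ hx.2.1, fun x hx => hne _ hx.2.2,
    fun x hx => hind _ hx.2.1, fun x hx => hind _ hx.2.2⟩

/-- This makes regularity and Δ²𝒟f = 0 available near every point of W. A real point needs one disc,
since its two representatives coincide; any other point needs two. -/
theorem exists_isSliceCycle (hWo : IsOpen W) (hW : AxiallySymmetric W) (hJ : J ∈ imagSphere)
    {x : R6} (hx : x ∈ W) :
    ∃ (V : Set R6) (m : ℕ) (γ : Fin m → ℝ → ℂ), x ∈ V ∧ IsSliceCycle W J V γ := by
  have hΩ := isOpen_sliceOf hWo J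
  obtain ⟨r₁, hr₁, h₁⟩ := nhds_basis_closedBall.mem_iff.1 (hΩ.mem_nhds (hW.upperPt_mem hJ hx))
  obtain ⟨r₂, hr₂, h₂⟩ := nhds_basis_closedBall.mem_iff.1 (hΩ.mem_nhds (hW.lowerPt_mem hJ hx))
  by_cases hv : vecNorm x = 0
  · have e : lowerPt x = upperPt x := by simp [lowerPt, upperPt, hv]
    refine ⟨_, 1, _, ?_, isSliceCycle_circles (c := fun _ => upperPt x) hWo hr₁
      (fun _ => h₁) fun k l hkl => absurd (Subsingleton.elim k l) hkl⟩
    refine ⟨hx, ?_, ?_⟩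
    · exact mem_iUnion.2 ⟨0, mem_ball_self hr₁⟩
    · exact mem_iUnion.2 ⟨0, by rw [e]; exact mem_ball_self hr₁⟩
  · have hvpos : 0 < vecNorm x := lt_of_le_of_ne (norm_nonneg _) (Ne.symm hv)
    -- The centres are 2|x̲| apart, so radii of at most |x̲|/2 keep the closed discs disjoint.
    set r := min (min r₁ r₂) (vecNorm x / 2) with hr
    have hrpos : 0 < r := lt_min (lt_min hr₁ hr₂) (half_pos hvpos)
    have hrv : r ≤ vecNorm x / 2 := min_le_right _ _
    have hdist : dist (upperPt x) (lowerPt x) = 2 * vecNorm x := by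
      rw [dist_eq_norm, show upperPt x - lowerPt x = ((2 * vecNorm x : ℝ) : ℂ) * Complex.I by
        simp only [upperPt, lowerPt]; push_cast; ring, norm_mul, Complex.norm_I, mul_one,
        Complex.norm_real, Real.norm_of_nonneg (by linarith)]
    have hd : Disjoint (closedBall (upperPt x) r) (closedBall (lowerPt x) r) :=
      closedBall_disjoint_closedBall (by rw [hdist]; linarith)
    refine ⟨_, 2, _, ?_, isSliceCycle_circles (c := ![upperPt x, lowerPt x]) hWo hrpos ?_ ?_⟩
    · exact ⟨hx, mem_iUnion.2 ⟨0, mem_ball_self hrpos⟩, mem_iUnion.2 ⟨1, mem_ball_self hrpos⟩⟩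
    · intro k
      fin_cases k
      · exact (closedBall_subset_closedBall ((min_le_left _ _).trans (min_le_left _ _))).trans h₁
      · exact (closedBall_subset_closedBall ((min_le_left _ _).trans (min_le_right _ _))).trans h₂
    · intro k l hkl
      fin_cases k <;> fin_cases l
      · exact absurd rfl hkl
      · exact hd
      · exact hd.symm
      · exact absurd rfl hkl

end

section

/-! ### Left slice hyperholomorphic functions -/

variable {W : Set R6} {f : R6 → Cl5}

theorem exists_mem_imagSphere : ∃ J : R6, J ∈ imagSphere :=
  ⟨EuclideanSpace.single 1 1, by simp, by simp⟩

theorem SliceHypL.contDiffOn (hf : SliceHypL W f) (hWo : IsOpen W) (hW : AxiallySymmetric W) :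
    ContDiffOn ℝ ∞ f W := by
  intro x hx
  obtain ⟨J, hJ⟩ := exists_mem_imagSphere
  obtain ⟨V, m, γ, hxV, h⟩ := exists_isSliceCycle hWo hW hJ hx
  exact ((hf.contDiffOn_of_isSliceCycle hWo hW hJ h).contDiffAt
    (h.isOpen.mem_nhds hxV)).contDiffWithinAt

/-- The Fueter-Sce theorem in this dimension: Δ²𝒟 annihilates the Cauchy kernel and passes under the
local Cauchy integral. -/
theorem SliceHypL.lap_lap_diracL (hf : SliceHypL W f) (hWo : IsOpen W) (hW : AxiallySymmetric W) :
    EqOn (lap (lap (diracL f))) (fun _ => 0) W := by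
  intro x hx
  obtain ⟨J, hJ⟩ := exists_mem_imagSphere
  obtain ⟨V, m, γ, hxV, h⟩ := exists_isSliceCycle hWo hW hJ hx
  have hT := isKernelOp_lap.comp (isKernelOp_lap.comp isKernelOp_diracL)
  have hk := h.isKernelCycle hJ (hf.continuousOn_slice hWo hW hJ)
  refine (hf.op_eqOn hWo hW hJ h hT hxV).trans ?_
  simp only
  rw [hk.cycleIntegral_congr (k' := fun _ _ => 0) (fun p hp => lap_lap_diracL_cauchyL hp) hxV]
  simp [cycleIntegral]

/-- `𝒟 Δ² f = 0`. -/
theorem SliceHypL.diracL_lap_lap (hf : SliceHypL W f) (hWo : IsOpen W) (hW : AxiallySymmetric W) :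
    EqOn (diracL (lap (lap f))) (fun _ => 0) W := by
  have hs := hf.contDiffOn hWo hW
  exact ((diracL_lap hWo (contDiffOn_lap hWo hs)).trans
    (lap_congr hWo (diracL_lap hWo hs))).trans (hf.lap_lap_diracL hWo hW)

theorem contDiffOn_nat_of_infty {V : Set R6} {g : R6 → Cl5} (h : ContDiffOn ℝ ∞ g V) (n : ℕ) :
    ContDiffOn ℝ n g V := contDiffOn_infty.1 h n

theorem SliceHypL.isPolyharmonic_opDL (hf : SliceHypL W f) (hWo : IsOpen W)
    (hW : AxiallySymmetric W) {l : ℕ} (hl : l ≤ 1) : IsPolyharmonic (l + 1) W (opDL l f) := by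
  have hD := contDiffOn_diracL hWo (hf.contDiffOn hWo hW)
  interval_cases l
  · exact ⟨contDiffOn_nat_of_infty (contDiffOn_lap hWo hD) _, hf.lap_lap_diracL hWo hW⟩
  · exact ⟨contDiffOn_nat_of_infty hD _, hf.lap_lap_diracL hWo hW⟩

theorem SliceHypL.isHolCliffordL_lap (hf : SliceHypL W f) (hWo : IsOpen W)
    (hW : AxiallySymmetric W) : IsHolCliffordL 1 W (lap f) := by
  have hs := hf.contDiffOn hWo hW
  exact ⟨contDiffOn_nat_of_infty (contDiffOn_lap hWo hs) _,
    (lap_congr hWo (diracL_lap hWo hs)).trans (hf.lap_lap_diracL hWo hW)⟩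

/-- Δ𝒟²𝒟̄f = Δ𝒟Δf = Δ²𝒟f. -/
theorem SliceHypL.isPolyCliffordL_diracBarL (hf : SliceHypL W f) (hWo : IsOpen W)
    (hW : AxiallySymmetric W) : IsPolyCliffordL 1 2 W (diracBarL f) := by
  have hs := hf.contDiffOn hWo hW
  exact ⟨contDiffOn_nat_of_infty (contDiffOn_diracBarL hWo hs) _,
    (lap_congr hWo ((diracL_congr hWo (diracL_diracBarL hWo hs)).trans
      (diracL_lap hWo hs))).trans (hf.lap_lap_diracL hWo hW)⟩

theorem SliceHypL.isPolyanalyticL_opDBarL (hf : SliceHypL W f) (hWo : IsOpen W)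
    (hW : AxiallySymmetric W) {l : ℕ} (hl : l ≤ 1) : IsPolyanalyticL (3 - l) W (opDBarL l f) := by
  have hs := hf.contDiffOn hWo hW
  have hB := contDiffOn_diracBarL hWo hs
  -- 𝒟²Δ𝒟̄f = 𝒟Δ(𝒟𝒟̄f) = 𝒟Δ²f = 0. The case l = 0 reduces to it because 𝒟³𝒟̄² = 𝒟²Δ𝒟̄.
  have key : EqOn (diracL (diracL (lap (diracBarL f)))) (fun _ => 0) W := by
    refine (diracL_congr hWo ?_).trans (hf.diracL_lap_lap hWo hW)
    exact (diracL_lap hWo hB).trans (lap_congr hWo (diracL_diracBarL hWo hs))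
  interval_cases l
  · refine ⟨contDiffOn_nat_of_infty (contDiffOn_diracBarL hWo hB) _, ?_⟩
    exact (diracL_congr hWo (diracL_congr hWo (diracL_diracBarL hWo hB))).trans key
  · exact ⟨contDiffOn_nat_of_infty (contDiffOn_lap hWo hB) _, key⟩

theorem SliceHypL.isAntiHolCliffordL_opDSqL (hf : SliceHypL W f) (hWo : IsOpen W)
    (hW : AxiallySymmetric W) : IsAntiHolCliffordL 1 W (opDSqL f) := by
  have hD := contDiffOn_diracL hWo (hf.contDiffOn hWo hW)
  exact ⟨contDiffOn_nat_of_infty (contDiffOn_diracL hWo hD) _,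
    (lap_congr hWo (diracBarL_diracL hWo hD)).trans (hf.lap_lap_diracL hWo hW)⟩

/-! ### Integral representations and independence of the contour -/

theorem SliceHypL.hasIntegralRepL (hf : SliceHypL W f) (hWo : IsOpen W) (hW : AxiallySymmetric W)
    {T : (R6 → Cl5) → (R6 → Cl5)} (hT : IsKernelOp T) : HasIntegralRepL W f T := by
  intro U J m γ hc x hx
  have h := hc.isSliceCycle hWo
  have hk := h.isKernelCycle hc.unit (hf.continuousOn_slice hWo hW hc.unit)
  refine ⟨fun k => ?_, ?_⟩
  · have := hk.intervalIntegrable (hT.smooth smoothKernel_cauchyL) k hx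
    refine this.congr fun t _ => ?_
    simp only [integrandL, sliceWeight, sliceCurve, kernelL, mul_assoc]
  · rw [integralL_eq_cycleIntegral]
    exact hf.op_eqOn hWo hW hc.unit h hT hx

/-- Both integrals equal 2π T f(x). -/
theorem HasIntegralRepL.integralIndepL {T : (R6 → Cl5) → (R6 → Cl5)}
    (h : HasIntegralRepL W f T) : IntegralIndepL W f T := by
  intro U J m γ U' J' m' γ' hc hc' x hx
  have h1 := (h U J m γ hc x hx.1).2
  rw [(h U' J' m' γ' hc' x hx.2).2] at h1
  exact (smul_right_injective Cl5 (inv_ne_zero (by positivity : (2 * Real.pi) ≠ 0)) h1).symm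

theorem isKernelOp_opDL {l : ℕ} (hl : l ≤ 1) : IsKernelOp (opDL l) := by
  interval_cases l
  · exact isKernelOp_lap.comp isKernelOp_diracL
  · exact isKernelOp_diracL

theorem isKernelOp_opDBarL {l : ℕ} (hl : l ≤ 1) : IsKernelOp (opDBarL l) := by
  interval_cases l
  · exact isKernelOp_diracBarL.comp isKernelOp_diracBarL
  · exact isKernelOp_lap.comp isKernelOp_diracBarL

theorem isKernelOp_opDSqL : IsKernelOp opDSqL := isKernelOp_diracL.comp isKernelOp_diracL

/-! ### The kernels in closed form -/

variable {s x : R6}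

theorem subConj_mul_Qinv_pow_mul (hx : x ∈ regularAt s) (k n : ℕ) :
    (para s - para (pconj x)) * Qinv s x ^ k * (para s - algebraMap ℝ Cl5 (x 0)) ^ n =
      subConj s x * (subRe s x ^ n * Qinv s x ^ k) := by
  change subConj s x * Qinv s x ^ k * subRe s x ^ n = _
  rw [mul_assoc, (((commute_subRe_Qinv hx).pow_right k).pow_left n).eq]

theorem pconj_zero (x : R6) : pconj x 0 = x 0 := by simp [pconj]

theorem pconj_pconj (x : R6) : pconj (pconj x) = x := by
  ext i
  by_cases h : i = 0
  · subst h; simp [pconj]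
  · simp [pconj, h]

theorem norm_pconj (x : R6) : ‖pconj x‖ = ‖x‖ := by
  rw [← sq_eq_sq₀ (norm_nonneg _) (norm_nonneg _), norm_sq_eq, norm_sq_eq]
  simp [pconj, Fin.succ_ne_zero]

theorem Qinv_pconj (s x : R6) : Qinv s (pconj x) = Qinv s x := by
  rw [Qinv, Qinv, pconj_zero, norm_pconj]

theorem cauchyL_pconj (s x : R6) :
    cauchyL s (pconj x) = (subRe s x - vecPart x) * Qinv s x := by
  rw [cauchyL, pconj_pconj, Qinv_pconj, para_eq x, subRe, sub_sub]

end

section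

/-! ### Reversion and right slice hyperholomorphic functions -/

/-- Reversion, the antiautomorphism of `ℝ₅` that fixes the generators. -/
def rev : Cl5 ≃L[ℝ] Cl5 :=
  (LinearEquiv.ofInvolutive (CliffordAlgebra.reverse (Q := negForm))
    CliffordAlgebra.reverse_involutive).toContinuousLinearEquiv

theorem rev_rev (a : Cl5) : rev (rev a) = a := CliffordAlgebra.reverse_reverse a

theorem rev_mul (a b : Cl5) : rev (a * b) = rev b * rev a := CliffordAlgebra.reverse.map_mul a b

theorem rev_one : rev 1 = 1 := CliffordAlgebra.reverse.map_one

theorem rev_algebraMap (r : ℝ) : rev (algebraMap ℝ Cl5 r) = algebraMap ℝ Cl5 r :=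
  CliffordAlgebra.reverse.commutes r

theorem rev_pow (a : Cl5) (n : ℕ) : rev (a ^ n) = rev a ^ n := by
  induction n with
  | zero => simp [rev_one]
  | succ n ih => rw [pow_succ, rev_mul, ih, pow_succ']

theorem rev_gen (i : Fin 6) : rev (gen i) = gen i := by
  refine Fin.cases rev_one (fun j => ?_) i
  exact CliffordAlgebra.reverse_ι _

theorem rev_genBar (i : Fin 6) : rev (genBar i) = genBar i := by
  refine Fin.cases rev_one (fun j => ?_) i
  rw [genBar_succ, map_neg, rev_gen]

theorem rev_para (x : R6) : rev (para x) = para x := by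
  simp only [para, map_sum, map_smul, rev_gen]

theorem rev_Qc (s x : R6) : rev (Qc s x) = Qc s x := by
  simp only [Qc, map_add, map_sub, map_smul, rev_pow, rev_para, rev_algebraMap]

theorem rev_Qinv (s x : R6) : rev (Qinv s x) = Qinv s x := by
  by_cases h : x ∈ regularAt s
  · have h1 := congrArg rev (Qc_mul_Qinv h)
    rw [rev_mul, rev_Qc, rev_one] at h1
    calc rev (Qinv s x) = rev (Qinv s x) * (Qc s x * Qinv s x) := by rw [Qc_mul_Qinv h, mul_one]
      _ = Qinv s x := by rw [← mul_assoc, h1, one_mul]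
  -- At singular points `Ring.inverse` has the default value 0, which reversion fixes. The identity
  -- thus holds for all x, as needed when operators act on whole functions.
  · rw [Qinv_eq, Ring.inverse_non_unit _ h, map_zero]

theorem rev_cauchyR (s x : R6) : rev (cauchyR s x) = cauchyL s x := by
  rw [cauchyR, cauchyL, rev_mul, rev_Qinv, map_sub, rev_para, rev_para]

/-- Reversion intertwines the operator `TL`, acting from the left, and `TR`, acting from the
right. -/
def Intertwined (TL TR : (R6 → Cl5) → (R6 → Cl5)) : Prop :=
  ∀ g, TL (fun x => rev (g x)) = fun x => rev (TR g x)

theorem Intertwined.comp {SL SR TL TR : (R6 → Cl5) → (R6 → Cl5)} (hS : Intertwined SL SR)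
    (hT : Intertwined TL TR) : Intertwined (fun g => SL (TL g)) fun g => SR (TR g) := by
  intro g
  simp only
  rw [hT g, hS]

theorem Intertwined.iterate {TL TR : (R6 → Cl5) → (R6 → Cl5)} (hT : Intertwined TL TR) (n : ℕ) :
    Intertwined TL^[n] TR^[n] := by
  induction n with
  | zero => intro g; rfl
  | succ n ih =>
    intro g
    rw [Function.iterate_succ_apply, Function.iterate_succ_apply, hT g, ih]

/-- No differentiability is needed: composition with a linear equivalence commutes with `fderiv`
even where the latter is 0 by default. Hence the operators are intertwined on arbitrary functions.
-/
theorem pd_rev (g : R6 → Cl5) (i : Fin 6) (x : R6) :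
    pd i (fun y => rev (g y)) x = rev (pd i g x) := by
  rw [pd, show (fun y => rev (g y)) = rev ∘ g from rfl, rev.comp_fderiv]
  rfl

theorem intertwined_diracL : Intertwined diracL diracR := by
  intro g
  ext x
  simp only [diracL, diracR, pd_rev, map_sum, rev_mul, rev_gen]

theorem intertwined_diracBarL : Intertwined diracBarL diracBarR := by
  intro g
  ext x
  simp only [diracBarL, diracBarR, pd_rev, map_sum, rev_mul, rev_genBar]

theorem intertwined_lap : Intertwined lap lap := by
  intro g
  exact InnerProductSpace.laplacian_CLE_comp_left (l := rev) (f := g)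

theorem intertwined_opDL (l : ℕ) : Intertwined (opDL l) (opDR l) :=
  (intertwined_lap.iterate (1 - l)).comp intertwined_diracL

theorem intertwined_opDBarL (l : ℕ) : Intertwined (opDBarL l) (opDBarR l) :=
  (intertwined_lap.iterate l).comp (intertwined_diracBarL.iterate (2 - l))

theorem intertwined_opDSqL : Intertwined opDSqL opDSqR :=
  intertwined_diracL.comp intertwined_diracL

theorem Intertwined.kernelR_eq {TL TR : (R6 → Cl5) → (R6 → Cl5)} (h : Intertwined TL TR)
    (s x : R6) : kernelR TR s x = rev (kernelL TL s x) := by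
  rw [kernelR, kernelL, show cauchyL s = fun x => rev (cauchyR s x) from
    funext fun x => (rev_cauchyR s x).symm, h, rev_rev]

variable {W : Set R6} {f : R6 → Cl5}

theorem fderiv_rev (α : ℝ × ℝ → Cl5) (p v : ℝ × ℝ) :
    fderiv ℝ (fun q => rev (α q)) p v = rev (fderiv ℝ α p v) := by
  rw [show (fun q => rev (α q)) = rev ∘ α from rfl, rev.comp_fderiv]
  rfl

/-- Reversion fixes J and reverses products, so α + βJ becomes rev α + J rev β; being real linear,
it preserves parity and the Cauchy-Riemann system. -/
theorem SliceHypR.sliceHypL_rev (hf : SliceHypR W f) : SliceHypL W fun x => rev (f x) := by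
  obtain ⟨α, β, hs, hf⟩ := hf
  refine ⟨fun p => rev (α p), fun p => rev (β p),
    ⟨fun p hp => ?_, fun p hp => ?_, fun p hp => ?_, fun p hp => ?_, fun p hp => ?_,
      fun p hp => ?_⟩, fun p hp J hJ => ?_⟩
  · exact rev.differentiableAt.comp p (hs.diff_left p hp)
  · exact rev.differentiableAt.comp p (hs.diff_right p hp)
  · rw [hs.even p hp]
  · rw [hs.odd p hp, map_neg]
  · rw [fderiv_rev, fderiv_rev, ← map_sub, hs.cr_one p hp, map_zero]
  · rw [fderiv_rev, fderiv_rev, ← map_add, hs.cr_two p hp, map_zero]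
  · simp only [hf p hp J hJ]
    rw [map_add, rev_mul, rev_para]

theorem contDiffOn_of_rev {n : ℕ} (h : ContDiffOn ℝ n (fun x => rev (f x)) W) :
    ContDiffOn ℝ n f W := by
  have := rev.contDiff.comp_contDiffOn h
  refine this.congr fun x _ => ?_
  exact (rev_rev (f x)).symm

theorem Intertwined.eq_zero_of_rev {TL TR : (R6 → Cl5) → (R6 → Cl5)} (h : Intertwined TL TR)
    (h0 : ∀ x ∈ W, TL (fun x => rev (f x)) x = 0) : ∀ x ∈ W, TR f x = 0 := by
  intro x hx
  have := h0 x hx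
  rw [h f] at this
  exact (map_eq_zero_iff _ rev.injective).1 this

theorem IsPolyharmonic.of_rev {k : ℕ} (h : IsPolyharmonic k W fun x => rev (f x)) :
    IsPolyharmonic k W f :=
  ⟨contDiffOn_of_rev h.1, (intertwined_lap.iterate k).eq_zero_of_rev h.2⟩

theorem IsHolCliffordL.of_rev {k : ℕ} (h : IsHolCliffordL k W fun x => rev (f x)) :
    IsHolCliffordR k W f :=
  ⟨contDiffOn_of_rev h.1,
    ((intertwined_lap.iterate k).comp intertwined_diracL).eq_zero_of_rev h.2⟩

theorem IsAntiHolCliffordL.of_rev {k : ℕ} (h : IsAntiHolCliffordL k W fun x => rev (f x)) :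
    IsAntiHolCliffordR k W f :=
  ⟨contDiffOn_of_rev h.1,
    ((intertwined_lap.iterate k).comp intertwined_diracBarL).eq_zero_of_rev h.2⟩

theorem IsPolyanalyticL.of_rev {k : ℕ} (h : IsPolyanalyticL k W fun x => rev (f x)) :
    IsPolyanalyticR k W f :=
  ⟨contDiffOn_of_rev h.1, (intertwined_diracL.iterate k).eq_zero_of_rev h.2⟩

theorem IsPolyCliffordL.of_rev {k l : ℕ} (h : IsPolyCliffordL k l W fun x => rev (f x)) :
    IsPolyCliffordR k l W f :=
  ⟨contDiffOn_of_rev h.1,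
    ((intertwined_lap.iterate k).comp (intertwined_diracL.iterate l)).eq_zero_of_rev h.2⟩

/-- The values of ds_J lie in ℂ_J, hence are paravectors. -/
theorem rev_dsJ {J : R6} (hJ : J ∈ imagSphere) (c : ℝ → ℂ) (t : ℝ) :
    rev (dsJ J c t) = dsJ J c t := by
  rw [dsJ_eq hJ, sliceHom_apply, rev_para]

theorem Intertwined.integrandR_eq {TL TR : (R6 → Cl5) → (R6 → Cl5)} (h : Intertwined TL TR)
    {J : R6} (hJ : J ∈ imagSphere) (c : ℝ → ℂ) (x : R6) (t : ℝ) :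
    integrandR (kernelR TR) J c f x t =
      rev (integrandL (kernelL TL) J c (fun y => rev (f y)) x t) := by
  rw [integrandR, integrandL, rev_mul, rev_mul, rev_rev, rev_dsJ hJ, h.kernelR_eq, mul_assoc]

theorem Intertwined.hasIntegralRepR {TL TR : (R6 → Cl5) → (R6 → Cl5)} (h : Intertwined TL TR)
    (hL : HasIntegralRepL W (fun y => rev (f y)) TL) : HasIntegralRepR W f TR := by
  intro U J m γ hc x hx
  obtain ⟨h1, h2⟩ := hL U J m γ hc x hx
  refine ⟨fun k => ?_, ?_⟩
  · refine intervalIntegrable_iff.2 ?_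
    have := (rev : Cl5 →L[ℝ] Cl5).integrable_comp (intervalIntegrable_iff.1 (h1 k))
    exact this.congr (Eventually.of_forall fun t => (h.integrandR_eq hc.unit (γ k) x t).symm)
  · have h3 : integralR (kernelR TR) J γ f x =
        rev (integralL (kernelL TL) J γ (fun y => rev (f y)) x) := by
      rw [integralR, integralL, map_sum]
      refine Finset.sum_congr rfl fun k _ => ?_
      simp_rw [h.integrandR_eq hc.unit]
      exact (rev : Cl5 →L[ℝ] Cl5).intervalIntegral_comp_comm (h1 k)
    rw [h3, ← map_smul, ← h2, h f, rev_rev]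

theorem HasIntegralRepR.integralIndepR {T : (R6 → Cl5) → (R6 → Cl5)}
    (h : HasIntegralRepR W f T) : IntegralIndepR W f T := by
  intro U J m γ U' J' m' γ' hc hc' x hx
  have h1 := (h U J m γ hc x hx.1).2
  rw [(h U' J' m' γ' hc' x hx.2).2] at h1
  exact (smul_right_injective Cl5 (inv_ne_zero (by positivity : (2 * Real.pi) ≠ 0)) h1).symm

end

end FineStructure

end

/-! ### The main theorem -/

open FineStructure in
theorem mainTheorem2 :
    -- the explicit form of the kernels
    (∀ s x : R6, x ∉ sphereOf s →
      kernelL (opDL 1) s x = (-4 : ℝ) • Qinv s x ∧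
      kernelR (opDR 1) s x = (-4 : ℝ) • Qinv s x ∧
      kernelL (opDL 0) s x = (16 : ℝ) • Qinv s x ^ 2 ∧
      kernelR (opDR 0) s x = (16 : ℝ) • Qinv s x ^ 2 ∧
      kernelL lap s x = (-8 : ℝ) • (cauchyL s x * Qinv s x) ∧
      kernelR lap s x = (-8 : ℝ) • (Qinv s x * cauchyR s x) ∧
      kernelL diracBarL s x =
        (4 : ℝ) • ((para s - para (pconj x)) * Qinv s x ^ 2 * (para s - algebraMap ℝ Cl5 (x 0)))
          + (2 : ℝ) • Qinv s x ∧
      kernelR diracBarR s x =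
        (4 : ℝ) • ((para s - algebraMap ℝ Cl5 (x 0)) * Qinv s x ^ 2 * (para s - para (pconj x)))
          + (2 : ℝ) • Qinv s x ∧
      kernelL (opDBarL 0) s x =
        (32 : ℝ) •
          ((para s - para (pconj x)) * Qinv s x ^ 3 * (para s - algebraMap ℝ Cl5 (x 0)) ^ 2) ∧
      kernelR (opDBarR 0) s x =
        (32 : ℝ) •
          ((para s - algebraMap ℝ Cl5 (x 0)) ^ 2 * Qinv s x ^ 3 * (para s - para (pconj x))) ∧
      kernelL (opDBarL 1) s x =
        (-64 : ℝ) •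
          ((para s - para (pconj x)) * Qinv s x ^ 3 * (para s - algebraMap ℝ Cl5 (x 0))) ∧
      kernelR (opDBarR 1) s x =
        (-64 : ℝ) •
          ((para s - algebraMap ℝ Cl5 (x 0)) * Qinv s x ^ 3 * (para s - para (pconj x))) ∧
      kernelL opDSqL s x = (-8 : ℝ) • (cauchyL s (pconj x) * Qinv s x) ∧
      kernelR opDSqR s x = (-8 : ℝ) • (Qinv s x * cauchyR s (pconj x))) ∧
    -- the integral representations
    ∀ W : Set R6, IsOpen W → AxiallySymmetric W →
      (∀ f : R6 → Cl5, SliceHypL W f →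
        (∀ l : ℕ, l ≤ 1 → IsPolyharmonic (l + 1) W (opDL l f) ∧
          HasIntegralRepL W f (opDL l) ∧ IntegralIndepL W f (opDL l)) ∧
        (IsHolCliffordL 1 W (lap f) ∧
          HasIntegralRepL W f lap ∧ IntegralIndepL W f lap) ∧
        (IsPolyCliffordL 1 2 W (diracBarL f) ∧
          HasIntegralRepL W f diracBarL ∧ IntegralIndepL W f diracBarL) ∧
        (∀ l : ℕ, l ≤ 1 → IsPolyanalyticL (3 - l) W (opDBarL l f) ∧
          HasIntegralRepL W f (opDBarL l) ∧ IntegralIndepL W f (opDBarL l)) ∧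
        (IsAntiHolCliffordL 1 W (opDSqL f) ∧
          HasIntegralRepL W f opDSqL ∧ IntegralIndepL W f opDSqL)) ∧
      (∀ f : R6 → Cl5, SliceHypR W f →
        (∀ l : ℕ, l ≤ 1 → IsPolyharmonic (l + 1) W (opDR l f) ∧
          HasIntegralRepR W f (opDR l) ∧ IntegralIndepR W f (opDR l)) ∧
        (IsHolCliffordR 1 W (lap f) ∧
          HasIntegralRepR W f lap ∧ IntegralIndepR W f lap) ∧
        (IsPolyCliffordR 1 2 W (diracBarR f) ∧
          HasIntegralRepR W f diracBarR ∧ IntegralIndepR W f diracBarR) ∧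
        (∀ l : ℕ, l ≤ 1 → IsPolyanalyticR (3 - l) W (opDBarR l f) ∧
          HasIntegralRepR W f (opDBarR l) ∧ IntegralIndepR W f (opDBarR l)) ∧
        (IsAntiHolCliffordR 1 W (opDSqR f) ∧
          HasIntegralRepR W f opDSqR ∧ IntegralIndepR W f opDSqR)) := by
  refine ⟨fun s x hx => ?_, fun W hWo hW => ⟨fun f hf => ?_, fun f hf => ?_⟩⟩
  · have hr := mem_regularAt_of_notMem_sphereOf hx
    have k1 : kernelL (opDL 1) s x = (-4 : ℝ) • Qinv s x := diracL_cauchyL s hr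
    have k2 : kernelL (opDL 0) s x = (16 : ℝ) • Qinv s x ^ 2 := lap_diracL_cauchyL s hr
    have k3 : kernelL lap s x = (-8 : ℝ) • (cauchyL s x * Qinv s x) := by
      rw [cauchyL, mul_assoc, ← sq]
      exact lap_cauchyL s hr
    have k4 : kernelL diracBarL s x =
        (4 : ℝ) • ((para s - para (pconj x)) * Qinv s x ^ 2 * (para s - algebraMap ℝ Cl5 (x 0)))
          + (2 : ℝ) • Qinv s x := by
      have := subConj_mul_Qinv_pow_mul hr 2 1
      rw [pow_one, pow_one] at this
      rw [this]
      exact diracBarL_cauchyL s hr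
    have k5 : kernelL (opDBarL 0) s x = (32 : ℝ) •
        ((para s - para (pconj x)) * Qinv s x ^ 3 * (para s - algebraMap ℝ Cl5 (x 0)) ^ 2) := by
      rw [subConj_mul_Qinv_pow_mul hr, sq (subRe s x), mul_assoc]
      exact diracBarL_diracBarL_cauchyL hr
    have k6 : kernelL (opDBarL 1) s x = (-64 : ℝ) •
        ((para s - para (pconj x)) * Qinv s x ^ 3 * (para s - algebraMap ℝ Cl5 (x 0))) := by
      have := subConj_mul_Qinv_pow_mul hr 3 1
      rw [pow_one, pow_one] at this
      rw [this]
      exact lap_diracBarL_cauchyL hr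
    have k7 : kernelL opDSqL s x = (-8 : ℝ) • (cauchyL s (pconj x) * Qinv s x) := by
      rw [cauchyL_pconj, mul_assoc, ← sq]
      exact diracL_diracL_cauchyL hr
    refine ⟨k1, ?_, k2, ?_, k3, ?_, k4, ?_, k5, ?_, k6, ?_, k7, ?_⟩
    · rw [(intertwined_opDL 1).kernelR_eq, k1, map_smul, rev_Qinv]
    · rw [(intertwined_opDL 0).kernelR_eq, k2, map_smul, rev_pow, rev_Qinv]
    · rw [intertwined_lap.kernelR_eq, k3, map_smul, rev_mul, rev_Qinv, ← rev_cauchyR, rev_rev]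
    · rw [intertwined_diracBarL.kernelR_eq, k4]
      simp only [map_add, map_sub, map_smul, rev_mul, rev_pow, rev_Qinv, rev_para, rev_algebraMap,
        mul_assoc]
    · rw [(intertwined_opDBarL 0).kernelR_eq, k5]
      simp only [map_sub, map_smul, rev_mul, rev_pow, rev_Qinv, rev_para, rev_algebraMap,
        mul_assoc]
    · rw [(intertwined_opDBarL 1).kernelR_eq, k6]
      simp only [map_sub, map_smul, rev_mul, rev_pow, rev_Qinv, rev_para, rev_algebraMap,
        mul_assoc]
    · rw [intertwined_opDSqL.kernelR_eq, k7, map_smul, rev_mul, rev_Qinv, ← rev_cauchyR, rev_rev]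
  · have rep {T : (R6 → Cl5) → (R6 → Cl5)} (hT : IsKernelOp T) :
        HasIntegralRepL W f T ∧ IntegralIndepL W f T :=
      ⟨hf.hasIntegralRepL hWo hW hT, (hf.hasIntegralRepL hWo hW hT).integralIndepL⟩
    exact ⟨fun l hl => ⟨hf.isPolyharmonic_opDL hWo hW hl, rep (isKernelOp_opDL hl)⟩,
      ⟨hf.isHolCliffordL_lap hWo hW, rep isKernelOp_lap⟩,
      ⟨hf.isPolyCliffordL_diracBarL hWo hW, rep isKernelOp_diracBarL⟩,
      fun l hl => ⟨hf.isPolyanalyticL_opDBarL hWo hW hl, rep (isKernelOp_opDBarL hl)⟩,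
      ⟨hf.isAntiHolCliffordL_opDSqL hWo hW, rep isKernelOp_opDSqL⟩⟩
  -- The right half is the left half for the reversed function, carried back by the intertwining
  -- relations.
  · have hr := hf.sliceHypL_rev
    have rep {TL TR : (R6 → Cl5) → (R6 → Cl5)} (h : Intertwined TL TR) (hT : IsKernelOp TL) :
        HasIntegralRepR W f TR ∧ IntegralIndepR W f TR :=
      have hrep := h.hasIntegralRepR (hr.hasIntegralRepL hWo hW hT)
      ⟨hrep, hrep.integralIndepR⟩
    refine ⟨fun l hl => ⟨?_, rep (intertwined_opDL l) (isKernelOp_opDL hl)⟩,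
      ⟨?_, rep intertwined_lap isKernelOp_lap⟩,
      ⟨?_, rep intertwined_diracBarL isKernelOp_diracBarL⟩,
      fun l hl => ⟨?_, rep (intertwined_opDBarL l) (isKernelOp_opDBarL hl)⟩,
      ⟨?_, rep intertwined_opDSqL isKernelOp_opDSqL⟩⟩
    · refine IsPolyharmonic.of_rev ?_
      rw [← intertwined_opDL l f]
      exact hr.isPolyharmonic_opDL hWo hW hl
    · refine IsHolCliffordL.of_rev ?_
      rw [← intertwined_lap f]
      exact hr.isHolCliffordL_lap hWo hW
    · refine IsPolyCliffordL.of_rev ?_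
      rw [← intertwined_diracBarL f]
      exact hr.isPolyCliffordL_diracBarL hWo hW
    · refine IsPolyanalyticL.of_rev ?_
      rw [← intertwined_opDBarL l f]
      exact hr.isPolyanalyticL_opDBarL hWo hW hl
    · refine IsAntiHolCliffordL.of_rev ?_
      rw [← intertwined_opDSqL f]
      exact hr.isAntiHolCliffordL_opDSqL hWo hW
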